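/- Let $k,m$ be integers with $k>4$ and $m\ge 1$. Let $J^{cusp}_{k,m}$ be the space of Jacobi cusp forms of weight $k$ and index $m$ for the Jacobi group $\Gamma^J=SL_2(\mathbb Z)\ltimes(\mathbb Z\times\mathbb Z)$, that is, of holomorphic functions $\phi(\tau,z)$ on $\mathbb H\times\mathbb C$ that are invariant under the weight $k$, index $m$ slash action of $\Gamma^J$ and have a Fourier expansion $\phi(\tau,z)=\sum_{n,r\in\mathbb Z,\ 4nm-r^2>0}c(n,r)q^n\zeta^r$, $q=e^{2\pi i\tau}$, $\zeta=e^{2\pi i z}$. For $\phi,\psi \in J^{cusp}_{k,m}$ let $$\langle\phi,\psi\rangle=\int_{\Gamma^J\backslash\mathbb H\times\mathbb C}\phi(\tau,z)\overline{\psi(\tau,z)}\,v^k e^{-4\pi m y^2/v}\,\frac{du\,dv\,dx\,dy}{v^3},\qquad \tau=u+iv,\ z=x+iy,$$ be the Petersson scalar product (computed over any fundamental domain; the integral converges absolutely). Put $D_\tau=\frac1{2\pi i}\frac{\partial}{\partial\tau}$, $D_z=\frac1{2\pi i}\frac{\partial}{\partial z}$, $\sigma_1(n)=\sum_{d\mid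 n}d$, $E_2(\tau)=1-24\sum_{n\ge1}\sigma_1(n)q^n$, and let $$\mathcal L_{k,m}\colon J^{cusp}_{k,m}\to J^{cusp}_{k+2,m},\qquad \mathcal L_{k,m}\phi=4mD_\tau\phi-D_z^2\phi-\tfrac{m(2k-1)}6E_2\,\phi$$ be the modified heat operator (it does map Jacobi cusp forms of weight $k$ to Jacobi cusp forms of weight $k+2$). Then $\mathcal L_{k,m}$ has a unique adjoint, i.e. there is a unique linear map $\mathcal L_{k,m}^*\colon J^{cusp}_{k+2,m}\to J^{cusp}_{k,m}$ with $\langle\mathcal L_{k,m}^*\phi,f\rangle=\langle\phi,\mathcal L_{k,m}f\rangle$ for all $\phi\in J^{cusp}_{k+2,m}$ and $f\in J^{cusp}_{k,m}$. For $\phi\in J^{cusp}_{k+2,m}$ with Fourier expansion $\phi=\sum_{4nm-r^2>0}c(n,r)q^n\zeta^r$, the Jacobi cusp form $\mathcal L_{k,m}^*\phi$ of weight $k$ and index $m$ has the Fourier expansion $$\mathcal L_{k,m}^*\phi(\tau,z)=\sum_{\substack{\ell,w\in\mathbb Z\\4\ell m-w^2>0}}c_{\mathcal A}(\ell,w)\,q^\ell\zeta^w,$$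 where $$c_{\mathcal A}(\ell,w)=\beta_{k,m,\ell,w}\left(\frac{(4\ell m-w^2)-\frac{m(2k-1)}6}{(4\ell m-w^2)^{k+\frac12}}\,c(\ell,w)+4m(2k-1)\sum_{p=1}^\infty\frac{\sigma_1(p)\,c(\ell+p,w)}{(4(\ell+p)m-w^2)^{k+\frac12}}\right),$$ $$\beta_{k,m,\ell,w}=\frac{m^2\left(k-\frac12\right)\left(k-\frac32\right)(4\ell m-w^2)^{k-\frac32}}{\pi^2},$$ and the series over $p$ converges absolutely. -/

import Mathlib

open UpperHalfPlane MeasureTheory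
open scoped MatrixGroups ComplexConjugate

noncomputable section

/-- The Jacobi group `SL₂(ℤ) ⋉ (ℤ × ℤ)`: pairs `(γ, (lam, mu))`. -/
@[ext]
structure JacobiGroup where
  mat : SL(2, ℤ)
  lam : ℤ
  mu : ℤ

namespace JacobiGroup

/-- `(M, X) * (M', X') = (M M', X M' + X')`, where `X = (lam, mu)` is a row vector. -/
instance : Mul JacobiGroup where
  mul g h :=
    ⟨g.mat * h.mat,
     g.lam * h.mat 0 0 + g.mu * h.mat 1 0 + h.lam,
     g.lam * h.mat 0 1 + g.mu * h.mat 1 1 + h.mu⟩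

instance : One JacobiGroup where
  one := ⟨1, 0, 0⟩

instance : Inv JacobiGroup where
  inv g :=
    ⟨g.mat⁻¹,
     -(g.lam * g.mat⁻¹ 0 0 + g.mu * g.mat⁻¹ 1 0),
     -(g.lam * g.mat⁻¹ 0 1 + g.mu * g.mat⁻¹ 1 1)⟩

@[simp] theorem mul_mat (g h : JacobiGroup) : (g * h).mat = g.mat * h.mat := rfl
@[simp] theorem mul_lam (g h : JacobiGroup) :
    (g * h).lam = g.lam * h.mat 0 0 + g.mu * h.mat 1 0 + h.lam := rfl
@[simp] theorem mul_mu (g h : JacobiGroup) :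
    (g * h).mu = g.lam * h.mat 0 1 + g.mu * h.mat 1 1 + h.mu := rfl
@[simp] theorem one_mat : (1 : JacobiGroup).mat = 1 := rfl
@[simp] theorem one_lam : (1 : JacobiGroup).lam = 0 := rfl
@[simp] theorem one_mu : (1 : JacobiGroup).mu = 0 := rfl
@[simp] theorem inv_mat (g : JacobiGroup) : g⁻¹.mat = g.mat⁻¹ := rfl
@[simp] theorem inv_lam (g : JacobiGroup) :
    g⁻¹.lam = -(g.lam * g.mat⁻¹ 0 0 + g.mu * g.mat⁻¹ 1 0) := rfl
@[simp] theorem inv_mu (g : JacobiGroup) :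
    g⁻¹.mu = -(g.lam * g.mat⁻¹ 0 1 + g.mu * g.mat⁻¹ 1 1) := rfl

instance : Group JacobiGroup :=
  Group.ofLeftAxioms
    (by
      intro a b c
      apply JacobiGroup.ext
      · simp [mul_assoc]
      · simp [Matrix.mul_apply, Fin.sum_univ_two]; ring
      · simp [Matrix.mul_apply, Fin.sum_univ_two]; ring)
    (by intro a; ext <;> simp)
    (by
      intro a
      have hd := Matrix.det_fin_two a.mat.1
      rw [a.mat.2] at hd
      apply JacobiGroup.ext
      · simp
      · simp [Matrix.adjugate_fin_two]
        linear_combination a.lam * hd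
      · simp [Matrix.adjugate_fin_two]
        linear_combination a.mu * hd)

/-- The automorphy denominator `c τ + d`. -/
def den (g : JacobiGroup) (τ : ℍ) : ℂ := (g.mat 1 0 : ℂ) * τ + (g.mat 1 1 : ℂ)

/-- The action `(γ, (lam, mu)) • (τ, z) = ((a τ + b) / (c τ + d), (z + lam τ + mu) / (c τ + d))`
on `ℍ × ℂ`. -/
instance : SMul JacobiGroup (ℍ × ℂ) where
  smul g p := (g.mat • p.1, (p.2 + g.lam * (p.1 : ℂ) + g.mu) / g.den p.1)

theorem smul_def (g : JacobiGroup) (p : ℍ × ℂ) :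
    g • p = (g.mat • p.1, (p.2 + g.lam * (p.1 : ℂ) + g.mu) / g.den p.1) := rfl

theorem den_ne_zero (g : JacobiGroup) (τ : ℍ) : g.den τ ≠ 0 := by
  have h := UpperHalfPlane.denom_ne_zero (g.mat : GL (Fin 2) ℝ) τ
  simpa [den, UpperHalfPlane.denom] using h

theorem coe_mat_smul (g : JacobiGroup) (τ : ℍ) :
    ((g.mat • τ : ℍ) : ℂ) = ((g.mat 0 0 : ℂ) * τ + (g.mat 0 1 : ℂ)) / g.den τ := by
  rw [UpperHalfPlane.specialLinearGroup_apply]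
  simp [den]

theorem den_mul (g h : JacobiGroup) (τ : ℍ) :
    (g * h).den τ = g.den (h.mat • τ) * h.den τ := by
  have h0 := den_ne_zero h τ
  rw [den, den, coe_mat_smul]
  field_simp
  simp [den, Matrix.mul_apply, Fin.sum_univ_two]
  ring

instance : MulAction JacobiGroup (ℍ × ℂ) where
  one_smul p := by
    ext1 <;> simp [smul_def, den]
  mul_smul g h p := by
    have h0 := den_ne_zero h p.1
    have h1 := den_ne_zero g (h.mat • p.1)
    ext1
    · simp [smul_def, mul_smul]
    · simp only [smul_def, den_mul, coe_mat_smul]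
      field_simp
      simp [den]
      ring

end JacobiGroup

/-- The slash (stroke) operator `φ |_{k,m} g` of weight `k` and index `m`. -/
def jacobiSlash (k m : ℕ) (φ : ℍ × ℂ → ℂ) (g : JacobiGroup) : ℍ × ℂ → ℂ := fun p =>
  g.den p.1 ^ (-(k : ℤ)) *
    Complex.exp (2 * Real.pi * Complex.I * m *
      (-((g.mat 1 0 : ℂ) * (p.2 + g.lam * (p.1 : ℂ) + g.mu) ^ 2 / g.den p.1)
        + (g.lam : ℂ) ^ 2 * (p.1 : ℂ) + 2 * g.lam * p.2)) *
    φ (g • p)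

/-- `φ(τ, z) = ∑_{n, r ∈ ℤ} c(n, r) q ^ n ζ ^ r` on `ℍ × ℂ` (absolutely convergent), with
`q = exp (2 π i τ)` and `ζ = exp (2 π i z)`. -/
def HasJacobiFourierExpansion (φ : ℍ × ℂ → ℂ) (c : ℤ → ℤ → ℂ) : Prop :=
  ∀ (τ : ℍ) (z : ℂ),
    HasSum (fun nr : ℤ × ℤ =>
      c nr.1 nr.2 * Complex.exp (2 * Real.pi * Complex.I * (nr.1 * (τ : ℂ) + nr.2 * z))) (φ (τ, z))

/-- Jacobi forms of weight `k` and index `m` for the full Jacobi group. -/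
structure IsJacobiForm (k m : ℕ) (φ : ℍ × ℂ → ℂ) : Prop where
  holo : DifferentiableOn ℂ (fun p : ℂ × ℂ => φ (ofComplex p.1, p.2)) {p | 0 < p.1.im}
  slash_eq : ∀ g : JacobiGroup, jacobiSlash k m φ g = φ
  fourier : ∃ c : ℤ → ℤ → ℂ, HasJacobiFourierExpansion φ c ∧
    ∀ n r : ℤ, c n r ≠ 0 → 0 ≤ 4 * n * m - r ^ 2

/-- Jacobi cusp forms of weight `k` and index `m`. -/
structure IsJacobiCuspForm (k m : ℕ) (φ : ℍ × ℂ → ℂ) : Prop extends IsJacobiForm k m φ where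
  cusp : ∃ c : ℤ → ℤ → ℂ, HasJacobiFourierExpansion φ c ∧
    ∀ n r : ℤ, c n r ≠ 0 → 0 < 4 * n * m - r ^ 2

/-- The space `J_{k,m}^{cusp}`. -/
def JacobiCuspForms (k m : ℕ) : Submodule ℂ (ℍ × ℂ → ℂ) where
  carrier := {φ | IsJacobiCuspForm k m φ}
  zero_mem' := by
    have hf : HasJacobiFourierExpansion 0 (fun _ _ => 0) := by
      intro τ z
      simp
    exact ⟨⟨by simp, fun g => by ext p; simp [jacobiSlash],
      ⟨_, hf, by simp⟩⟩, ⟨_, hf, by simp⟩⟩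
  add_mem' := by
    rintro φ ψ ⟨⟨h1, h2, -⟩, c, h3, h4⟩ ⟨⟨h1', h2', -⟩, c', h3', h4'⟩
    have hf : HasJacobiFourierExpansion (φ + ψ) (fun n r => c n r + c' n r) := by
      intro τ z
      simpa [add_mul] using (h3 τ z).add (h3' τ z)
    have hc : ∀ n r : ℤ, c n r + c' n r ≠ 0 → 0 < 4 * n * m - r ^ 2 := by
      intro n r h
      by_cases hn : c n r = 0
      · exact h4' n r (by simpa [hn] using h)
      · exact h4 n r hn
    refine ⟨⟨h1.add h1', fun g => ?_, ⟨_, hf, fun n r h => (hc n r h).le⟩⟩, ⟨_, hf, hc⟩⟩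
    conv_rhs => rw [← h2 g, ← h2' g]
    ext p
    simp [jacobiSlash, mul_add]
  smul_mem' := by
    rintro a φ ⟨⟨h1, h2, -⟩, c, h3, h4⟩
    have hf : HasJacobiFourierExpansion (a • φ) (fun n r => a * c n r) := by
      intro τ z
      simpa [mul_assoc] using (h3 τ z).mul_left a
    have hc : ∀ n r : ℤ, a * c n r ≠ 0 → 0 < 4 * n * m - r ^ 2 :=
      fun n r h => h4 n r (right_ne_zero_of_mul h)
    refine ⟨⟨h1.const_smul a, fun g => ?_, ⟨_, hf, fun n r h => (hc n r h).le⟩⟩, ⟨_, hf, hc⟩⟩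
    conv_rhs => rw [← h2 g]
    ext p
    simp [jacobiSlash]
    ring

/-- The invariant measure `dV_J = du dv dx dy / v ^ 3` on `ℍ × ℂ` (`τ = u + i v`, `z = x + i y`);
Mathlib's measure on `ℍ` is `du dv / v ^ 2`. -/
def jacobiMeasure : Measure (ℍ × ℂ) :=
  ((volume : Measure ℍ).prod (volume : Measure ℂ)).withDensity
    fun p => ENNReal.ofReal (1 / p.1.im)

/-- The integrand `φ conj(ψ) v ^ k exp (-4 π m y ^ 2 / v)` of the Petersson scalar product. -/
def jacobiPeterssonIntegrand (k m : ℕ) (φ ψ : ℍ × ℂ → ℂ) (p : ℍ × ℂ) : ℂ :=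
  φ p * conj (ψ p) * ((p.1.im ^ k * Real.exp (-4 * Real.pi * m * p.2.im ^ 2 / p.1.im) : ℝ) : ℂ)

/-- The Petersson scalar product `⟨φ, ψ⟩` in weight `k` and index `m`, computed over the
fundamental domain `F`. -/
def jacobiPetersson (k m : ℕ) (F : Set (ℍ × ℂ)) (φ ψ : ℍ × ℂ → ℂ) : ℂ :=
  ∫ p in F, jacobiPeterssonIntegrand k m φ ψ p ∂jacobiMeasure

/-- `D_τ = (2 π i)⁻¹ ∂/∂τ`. -/
def jacobiDτ (φ : ℍ × ℂ → ℂ) : ℍ × ℂ → ℂ := fun p =>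
  (2 * Real.pi * Complex.I)⁻¹ * deriv (fun t : ℂ => φ (ofComplex t, p.2)) (p.1 : ℂ)

/-- `D_z = (2 π i)⁻¹ ∂/∂z`. -/
def jacobiDz (φ : ℍ × ℂ → ℂ) : ℍ × ℂ → ℂ := fun p =>
  (2 * Real.pi * Complex.I)⁻¹ * deriv (fun w : ℂ => φ (p.1, w)) p.2

/-- The heat operator `L_m = 4 m D_τ - D_z ^ 2`. -/
def heatOperator (m : ℕ) (φ : ℍ × ℂ → ℂ) : ℍ × ℂ → ℂ := fun p =>
  4 * m * jacobiDτ φ p - jacobiDz (jacobiDz φ) p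

/-- The modified heat operator `L_{k,m} = L_m - (m (2 k - 1) / 6) E₂`. -/
def modifiedHeatOperator (k m : ℕ) (φ : ℍ × ℂ → ℂ) : ℍ × ℂ → ℂ := fun p =>
  heatOperator m φ p - (m * (2 * k - 1) / 6 : ℂ) * EisensteinSeries.E2 p.1 * φ p

/-- `4 n m - r ^ 2`, as a real number. -/
def jacobiDisc (m : ℕ) (n r : ℤ) : ℝ := 4 * n * m - r ^ 2

/-- The constant `β_{k,m,ℓ,w}`. -/
def adjointBeta (k m : ℕ) (ℓ w : ℤ) : ℝ :=
  m ^ 2 * (k - 1 / 2) * (k - 3 / 2) * jacobiDisc m ℓ w ^ ((k : ℝ) - 3 / 2) / Real.pi ^ 2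

/-- The terms `σ₁(p) c(ℓ + p, w) / (4 (ℓ + p) m - w ^ 2) ^ (k + 1/2)`, `p ≥ 1`. -/
def adjointSeriesTerm (k m : ℕ) (c : ℤ → ℤ → ℂ) (ℓ w : ℤ) (p : ℕ+) : ℂ :=
  (ArithmeticFunction.sigma 1 (p : ℕ) : ℂ) * c (ℓ + (p : ℕ)) w /
    ((jacobiDisc m (ℓ + (p : ℕ)) w ^ ((k : ℝ) + 1 / 2) : ℝ) : ℂ)

/-- The coefficient `c_A(ℓ, w)` (for `4 ℓ m - w ^ 2 > 0`). -/
def adjointCoeff (k m : ℕ) (c : ℤ → ℤ → ℂ) (ℓ w : ℤ) : ℂ :=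
  (adjointBeta k m ℓ w : ℂ) *
    ((((jacobiDisc m ℓ w - m * (2 * k - 1) / 6) /
        jacobiDisc m ℓ w ^ ((k : ℝ) + 1 / 2) : ℝ) : ℂ) * c ℓ w
      + 4 * m * (2 * k - 1) * ∑' p : ℕ+, adjointSeriesTerm k m c ℓ w p)

/-- `T : J_{k+2,m}^{cusp} → J_{k,m}^{cusp}` is adjoint to `L : J_{k,m}^{cusp} → J_{k+2,m}^{cusp}` for
the Petersson scalar products: `⟨T φ, f⟩ = ⟨φ, L f⟩`. -/
def IsPeterssonAdjoint (k m : ℕ) (F : Set (ℍ × ℂ))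
    (L : JacobiCuspForms k m →ₗ[ℂ] JacobiCuspForms (k + 2) m)
    (T : JacobiCuspForms (k + 2) m →ₗ[ℂ] JacobiCuspForms k m) : Prop :=
  ∀ (φ : JacobiCuspForms (k + 2) m) (f : JacobiCuspForms k m),
    jacobiPetersson k m F (T φ) f = jacobiPetersson (k + 2) m F φ (L f)

end

/-!
The cusp forms of given weight and index form a finite-dimensional space. Indeed a cusp form is
bounded in the invariant norm `|φ| v ^ (k / 2) exp (-2 π m y ^ 2 / v)`; if its Fourier coefficients
vanish up to a large discriminant, the expansion in a Siegel set shows that the supremum of this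
norm is at most half of itself (`exists_forall_eq_zero_of_coeff_eq_zero`), while the remaining
coefficients reduce to finitely many because `c(n, r)` depends only on `4 n m - r ^ 2` and on `r`
modulo `2 m` (`HasJacobiFourierExpansion.coeff_add`). The Petersson scalar product is positive
definite (`jacobiCore`), so the modified heat operator `L`, which commutes with the slash action by
the quasi-modularity of `E₂` (`JacobiGroup.modifiedHeatOperator_slash`), has a unique adjoint `T`.

The coefficient of `T φ` at `q ^ ℓ ζ ^ w` is read off by pairing with the Poincaré series `P`, the
sum of the slashes of `q ^ ℓ ζ ^ w` over the cosets of the translations. It is a cusp form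
(`isJacobiCuspForm_poincare`; the series converges absolutely for `k ≥ 4`, and the decay at the cusp
uses `k > 4`). Unfolding the integral over a fundamental domain into one over the strip
`0 < u, x ≤ 1` (`integral_fundamentalDomain_eq_strip`) shows that `⟨ψ, P⟩` is a constant times the
coefficient of `ψ` (`jacobiPetersson_poincare`). On the other hand `⟨T φ, P⟩ = ⟨φ, L P⟩`, and since
`L` commutes with the slash action and may be applied termwise, `L P` is the sum of the slashes of
`L (q ^ ℓ ζ ^ w) = ∑ b j q ^ (ℓ + j) ζ ^ w`, where `b j` is a multiple of `σ₁(j)` for `j > 0`.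
Unfolding once more gives the series of the theorem
(`hasSum_jacobiPetersson_modifiedHeatOperator_poincare`).

Two convergence questions are delicate for the smallest weight `k = 5`. The second unfolding needs
absolute integrability over the strip. The mean of `|L (q ^ ℓ ζ ^ w)|` over a horizontal torus is
therefore bounded by its quadratic mean, which Parseval's identity expresses through the `b j`, and
these are estimated by `σ₁(j) ≤ 5 j ^ (5 / 4)` (`exists_hasSum_sq_mul_exp_le`,
`integrableOn_strip_row`). The absolute convergence of the series over `σ₁(p) c(ℓ + p, w)` follows
from Bessel's inequality for the coefficients of `φ` and the Cauchy–Schwarz inequality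
(`sum_sq_coeff_le`, `summable_sigma_mul_coeff`).
-/

open scoped Pointwise

noncomputable section

/-! ### The automorphy factor and the invariant weight -/

/-- The first real coordinate of `(τ, z)`, where `z = α τ + β` with `α, β` real. -/
def jacobiAlpha (p : ℍ × ℂ) : ℝ := p.2.im / p.1.im

/-- The second real coordinate of `(τ, z)`, where `z = α τ + β` with `α, β` real. -/
def jacobiBeta (p : ℍ × ℂ) : ℝ := p.2.re - jacobiAlpha p * p.1.re

theorem jacobiAlpha_mul_im (p : ℍ × ℂ) : jacobiAlpha p * p.1.im = p.2.im :=
  div_mul_cancel₀ _ p.1.im_pos.ne'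

theorem eq_alpha_mul_add_beta (p : ℍ × ℂ) :
    p.2 = (jacobiAlpha p : ℂ) * p.1 + jacobiBeta p := by
  apply Complex.ext
  · simp [jacobiBeta]
  · simp [jacobiAlpha_mul_im]

theorem alpha_beta_unique {p : ℍ × ℂ} {a b : ℝ} (h : p.2 = (a : ℂ) * p.1 + b) :
    jacobiAlpha p = a ∧ jacobiBeta p = b := by
  have h1 : p.2.im = a * p.1.im := by rw [h]; simp
  have h2 : p.2.re = a * p.1.re + b := by rw [h]; simp
  have h3 : jacobiAlpha p = a := by
    rw [jacobiAlpha, h1, mul_div_cancel_right₀ _ p.1.im_pos.ne']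
  exact ⟨h3, by rw [jacobiBeta, h3, h2]; ring⟩

namespace JacobiGroup

theorem det_eq (g : JacobiGroup) :
    g.mat 0 0 * g.mat 1 1 - g.mat 0 1 * g.mat 1 0 = 1 := by
  have hd := Matrix.det_fin_two g.mat.1
  rw [g.mat.2] at hd
  exact hd.symm

theorem smul_fst (g : JacobiGroup) (p : ℍ × ℂ) : (g • p).1 = g.mat • p.1 := rfl

theorem smul_snd (g : JacobiGroup) (p : ℍ × ℂ) :
    (g • p).2 = (p.2 + g.lam * (p.1 : ℂ) + g.mu) / g.den p.1 := rfl

/-- In the real coordinates the group acts on `(α, β)` by integral affine maps. -/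
theorem alpha_beta_smul (g : JacobiGroup) (p : ℍ × ℂ) :
    jacobiAlpha (g • p) =
        (jacobiAlpha p + g.lam) * g.mat 1 1 - (jacobiBeta p + g.mu) * g.mat 1 0 ∧
      jacobiBeta (g • p) =
        -(jacobiAlpha p + g.lam) * g.mat 0 1 + (jacobiBeta p + g.mu) * g.mat 0 0 := by
  apply alpha_beta_unique
  have h0 := den_ne_zero g p.1
  have hdet : ((g.mat 0 0 : ℂ) * g.mat 1 1 - g.mat 0 1 * g.mat 1 0) = 1 := by
    exact_mod_cast congrArg (Int.cast : ℤ → ℂ) g.det_eq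
  rw [smul_snd, smul_fst, coe_mat_smul]
  conv_lhs => rw [eq_alpha_mul_add_beta p]
  rw [div_eq_iff h0, add_mul, mul_assoc, div_mul_cancel₀ _ h0]
  push_cast
  rw [den]
  linear_combination (-((jacobiAlpha p + g.lam) * (p.1 : ℂ)) - (jacobiBeta p + g.mu)) * hdet

/-- The exponent of the index part of the automorphy factor of the slash operator. -/
def expo (g : JacobiGroup) (p : ℍ × ℂ) : ℂ :=
  -((g.mat 1 0 : ℂ) * (p.2 + g.lam * (p.1 : ℂ) + g.mu) ^ 2 / g.den p.1)
        + (g.lam : ℂ) ^ 2 * (p.1 : ℂ) + 2 * g.lam * p.2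

/-- Up to a real bilinear term, the exponent is the coboundary of `p ↦ α z`. -/
theorem expo_eq (g : JacobiGroup) (p : ℍ × ℂ) :
    g.expo p = jacobiAlpha (g • p) * (g • p).2 - jacobiAlpha p * p.2
      - (jacobiAlpha p * g.mu - g.lam * jacobiBeta p) - g.lam * g.mu := by
  have h0 := den_ne_zero g p.1
  rw [smul_snd, (alpha_beta_smul g p).1, expo]
  push_cast
  rw [eq_alpha_mul_add_beta p]
  generalize (jacobiAlpha p : ℂ) = a
  generalize (jacobiBeta p : ℂ) = b
  simp only [den] at h0 ⊢
  field_simp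
  ring

theorem expo_mul (g h : JacobiGroup) (p : ℍ × ℂ) :
    ∃ N : ℤ, (g * h).expo p = g.expo (h • p) + h.expo p + N := by
  refine ⟨-((g * h).lam * (g * h).mu) + g.lam * g.mu + h.lam * h.mu
    + (h.lam * (g.mu * h.mat 1 1 + g.lam * h.mat 0 1)
      - h.mu * (g.mu * h.mat 1 0 + g.lam * h.mat 0 0)), ?_⟩
  rw [expo_eq, expo_eq, expo_eq, mul_smul, (alpha_beta_smul h p).1, (alpha_beta_smul h p).2]
  push_cast
  simp only [mul_lam, mul_mu]
  push_cast
  ring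

/-- The automorphy factor of the slash operator of weight `k` and index `m`. -/
def autoFactor (k m : ℕ) (g : JacobiGroup) (p : ℍ × ℂ) : ℂ :=
  g.den p.1 ^ (-(k : ℤ)) * Complex.exp (2 * Real.pi * Complex.I * m * g.expo p)

/-- The cocycle relation. The exponents agree up to an integer, which is invisible because the index
is an integer. -/
theorem autoFactor_mul (k m : ℕ) (g h : JacobiGroup) (p : ℍ × ℂ) :
    autoFactor k m (g * h) p = autoFactor k m g (h • p) * autoFactor k m h p := by
  obtain ⟨N, hN⟩ := expo_mul g h p
  have h1 : Complex.exp (2 * Real.pi * Complex.I * m * (g * h).expo p) =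
      Complex.exp (2 * Real.pi * Complex.I * m * g.expo (h • p)) *
        Complex.exp (2 * Real.pi * Complex.I * m * h.expo p) := by
    rw [← Complex.exp_add, Complex.exp_eq_exp_iff_exists_int]
    refine ⟨m * N, ?_⟩
    rw [hN]
    push_cast
    ring
  rw [autoFactor, autoFactor, autoFactor, h1, den_mul, mul_zpow, smul_fst]
  ring

theorem jacobiSlash_apply (k m : ℕ) (φ : ℍ × ℂ → ℂ) (g : JacobiGroup) (p : ℍ × ℂ) :
    jacobiSlash k m φ g p = autoFactor k m g p * φ (g • p) := rfl

theorem jacobiSlash_mul (k m : ℕ) (φ : ℍ × ℂ → ℂ) (g h : JacobiGroup) :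
    jacobiSlash k m φ (g * h) = jacobiSlash k m (jacobiSlash k m φ g) h := by
  ext p
  simp only [jacobiSlash_apply, autoFactor_mul, mul_smul]
  ring

theorem im_smul (g : JacobiGroup) (p : ℍ × ℂ) :
    (g • p).1.im = p.1.im / ‖g.den p.1‖ ^ 2 := by
  rw [smul_fst, ModularGroup.im_smul_eq_div_normSq, ModularGroup.denom_apply,
    Complex.normSq_eq_norm_sq]
  rfl

end JacobiGroup

/-- `v ^ (k / 2) exp (-2 π m y ^ 2 / v)`, the square root of the weight in the Petersson scalar
product. -/
def jacobiWeight (k m : ℕ) (p : ℍ × ℂ) : ℝ :=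
  p.1.im ^ ((k : ℝ) / 2) * Real.exp (-2 * Real.pi * m * (jacobiAlpha p ^ 2 * p.1.im))

theorem jacobiWeight_pos (k m : ℕ) (p : ℍ × ℂ) : 0 < jacobiWeight k m p :=
  mul_pos (Real.rpow_pos_of_pos p.1.im_pos _) (Real.exp_pos _)

theorem jacobiWeight_sq (k m : ℕ) (p : ℍ × ℂ) :
    jacobiWeight k m p ^ 2 =
      p.1.im ^ k * Real.exp (-4 * Real.pi * m * p.2.im ^ 2 / p.1.im) := by
  rw [jacobiWeight, mul_pow, ← Real.rpow_natCast, ← Real.rpow_mul p.1.im_pos.le,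
    ← Real.exp_nat_mul, jacobiAlpha]
  congr 1
  · rw [← Real.rpow_natCast]; congr 1; push_cast; ring
  · congr 1
    have := p.1.im_pos.ne'
    field_simp
    push_cast; ring

/-- The modulus of the automorphy factor is the quotient of the weights, since the imaginary part
of its exponent is the coboundary of `α y = α ^ 2 v`. -/
theorem norm_autoFactor_mul_weight (k m : ℕ) (g : JacobiGroup) (p : ℍ × ℂ) :
    ‖g.autoFactor k m p‖ * jacobiWeight k m p = jacobiWeight k m (g • p) := by
  have h0 : 0 < ‖g.den p.1‖ := norm_pos_iff.mpr (JacobiGroup.den_ne_zero g p.1)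
  have hv := p.1.im_pos
  have hv' := (g • p).1.im_pos
  have him : (g.expo p).im = jacobiAlpha (g • p) ^ 2 * (g • p).1.im
      - jacobiAlpha p ^ 2 * p.1.im := by
    rw [JacobiGroup.expo_eq]
    simp only [Complex.sub_im, Complex.im_ofReal_mul, ← jacobiAlpha_mul_im]
    have h1 : (g.mu : ℂ).im = 0 := by simp
    have h2 : ((g.lam : ℂ) * g.mu).im = 0 := by simp
    have h3 : ((g.lam : ℂ) * jacobiBeta p).im = 0 := by simp
    rw [h1, h2, h3]; ring
  have hexp : ‖Complex.exp (2 * Real.pi * Complex.I * m * g.expo p)‖ =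
      Real.exp (-2 * Real.pi * m * (g.expo p).im) := by
    rw [Complex.norm_exp]
    congr 1
    have : 2 * (Real.pi : ℂ) * Complex.I * m * g.expo p =
      ((2 * Real.pi * m : ℝ) : ℂ) * (Complex.I * g.expo p) := by push_cast; ring
    rw [this, Complex.re_ofReal_mul]
    simp
  have hpow : ‖g.den p.1 ^ (-(k : ℤ))‖ * p.1.im ^ ((k : ℝ) / 2) =
      (g • p).1.im ^ ((k : ℝ) / 2) := by
    rw [JacobiGroup.im_smul, Real.div_rpow hv.le (by positivity), ← Real.rpow_natCast,
      ← Real.rpow_mul h0.le, norm_zpow, zpow_neg, zpow_natCast]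
    rw [show ((2 : ℕ) : ℝ) * ((k : ℝ) / 2) = (k : ℕ) by push_cast; ring, Real.rpow_natCast]
    field_simp
  rw [JacobiGroup.autoFactor, norm_mul, hexp, him, jacobiWeight, jacobiWeight, ← hpow]
  rw [show -2 * Real.pi * m * (jacobiAlpha (g • p) ^ 2 * (g • p).1.im) =
    -2 * Real.pi * m * (jacobiAlpha (g • p) ^ 2 * (g • p).1.im - jacobiAlpha p ^ 2 * p.1.im)
      + -2 * Real.pi * m * (jacobiAlpha p ^ 2 * p.1.im) by ring, Real.exp_add]
  ring

/-- `|φ| v ^ (k / 2) exp (-2 π m y ^ 2 / v)`, which is invariant under the Jacobi group if `φ` is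
invariant under the slash action. -/
def jacobiNorm (k m : ℕ) (φ : ℍ × ℂ → ℂ) (p : ℍ × ℂ) : ℝ := ‖φ p‖ * jacobiWeight k m p

theorem jacobiNorm_nonneg (k m : ℕ) (φ : ℍ × ℂ → ℂ) (p : ℍ × ℂ) : 0 ≤ jacobiNorm k m φ p :=
  mul_nonneg (norm_nonneg _) (jacobiWeight_pos k m p).le

theorem jacobiNorm_slash (k m : ℕ) (φ : ℍ × ℂ → ℂ) (g : JacobiGroup) (p : ℍ × ℂ) :
    jacobiNorm k m (jacobiSlash k m φ g) p = jacobiNorm k m φ (g • p) := by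
  rw [jacobiNorm, jacobiNorm, JacobiGroup.jacobiSlash_apply, norm_mul,
    ← norm_autoFactor_mul_weight k m g p]
  ring

theorem jacobiNorm_smul {k m : ℕ} {φ : ℍ × ℂ → ℂ} (hφ : ∀ g, jacobiSlash k m φ g = φ)
    (g : JacobiGroup) (p : ℍ × ℂ) : jacobiNorm k m φ (g • p) = jacobiNorm k m φ p := by
  rw [← jacobiNorm_slash, hφ]

theorem jacobiPeterssonIntegrand_eq (k m : ℕ) (φ ψ : ℍ × ℂ → ℂ) (p : ℍ × ℂ) :
    jacobiPeterssonIntegrand k m φ ψ p =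
      φ p * conj (ψ p) * ((jacobiWeight k m p ^ 2 : ℝ) : ℂ) := by
  rw [jacobiPeterssonIntegrand, jacobiWeight_sq]

theorem norm_jacobiPeterssonIntegrand (k m : ℕ) (φ ψ : ℍ × ℂ → ℂ) (p : ℍ × ℂ) :
    ‖jacobiPeterssonIntegrand k m φ ψ p‖ = jacobiNorm k m φ p * jacobiNorm k m ψ p := by
  rw [jacobiPeterssonIntegrand_eq, norm_mul, norm_mul, RCLike.norm_conj, Complex.norm_real,
    Real.norm_of_nonneg (by positivity), jacobiNorm, jacobiNorm]
  ring

/-- The Petersson integrand of two functions at `g • p` is the integrand of their slashes at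
`p`. -/
theorem jacobiPeterssonIntegrand_slash (k m : ℕ) (φ ψ : ℍ × ℂ → ℂ) (g : JacobiGroup)
    (p : ℍ × ℂ) :
    jacobiPeterssonIntegrand k m (jacobiSlash k m φ g) (jacobiSlash k m ψ g) p =
      jacobiPeterssonIntegrand k m φ ψ (g • p) := by
  rw [jacobiPeterssonIntegrand_eq, jacobiPeterssonIntegrand_eq, JacobiGroup.jacobiSlash_apply,
    JacobiGroup.jacobiSlash_apply, ← norm_autoFactor_mul_weight k m g p, mul_pow, map_mul]
  have h := Complex.mul_conj' (g.autoFactor k m p)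
  push_cast
  linear_combination (φ (g • p) * conj (ψ (g • p)) * (jacobiWeight k m p : ℂ) ^ 2) * h

/-! ### Equivariance of the modified heat operator -/

/-- Holomorphy on `ℍ × ℂ`, expressed on the open subset `{Im τ > 0}` of `ℂ × ℂ`. -/
def JacobiHolomorphic (φ : ℍ × ℂ → ℂ) : Prop :=
  DifferentiableOn ℂ (fun p : ℂ × ℂ => φ (ofComplex p.1, p.2)) {p | 0 < p.1.im}

theorem isOpen_im_fst_pos : IsOpen {p : ℂ × ℂ | 0 < p.1.im} :=
  isOpen_lt continuous_const (Complex.continuous_im.comp continuous_fst)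

namespace JacobiHolomorphic

variable {φ : ℍ × ℂ → ℂ}

theorem differentiableAt (hφ : JacobiHolomorphic φ) (p : ℍ × ℂ) :
    DifferentiableAt ℂ (fun p : ℂ × ℂ => φ (ofComplex p.1, p.2)) ((p.1 : ℂ), p.2) :=
  DifferentiableOn.differentiableAt hφ (isOpen_im_fst_pos.mem_nhds p.1.im_pos)

theorem continuous (hφ : JacobiHolomorphic φ) : Continuous φ := by
  rw [continuous_iff_continuousAt]
  intro p
  have h := (hφ.differentiableAt p).continuousAt
  have h2 : ContinuousAt (fun q : ℍ × ℂ => (((q.1 : ℂ), q.2) : ℂ × ℂ)) p := by fun_prop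
  have h3 := ContinuousAt.comp (f := fun q : ℍ × ℂ => (((q.1 : ℂ), q.2) : ℂ × ℂ)) h h2
  simpa [Function.comp_def, ofComplex_apply] using h3

theorem differentiable_snd (hφ : JacobiHolomorphic φ) (τ : ℍ) :
    Differentiable ℂ (fun w : ℂ => φ (τ, w)) := by
  intro w
  have h := hφ.differentiableAt (τ, w)
  have h2 : DifferentiableAt ℂ (fun w : ℂ => (((τ : ℂ), w) : ℂ × ℂ)) w := by fun_prop
  have h3 := DifferentiableAt.comp (f := fun w : ℂ => (((τ : ℂ), w) : ℂ × ℂ)) w h h2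
  simpa [Function.comp_def, ofComplex_apply] using h3

theorem hasDerivAt_snd (hφ : JacobiHolomorphic φ) (τ : ℍ) (w : ℂ) :
    HasDerivAt (fun w : ℂ => φ (τ, w)) (2 * Real.pi * Complex.I * jacobiDz φ (τ, w)) w := by
  have h := (hφ.differentiable_snd τ w).hasDerivAt
  rwa [jacobiDz, mul_inv_cancel_left₀ Complex.two_pi_I_ne_zero]

theorem hasDerivAt_snd_snd (hφ : JacobiHolomorphic φ) (τ : ℍ) (w : ℂ) :
    HasDerivAt (fun w : ℂ => jacobiDz φ (τ, w))
      (2 * Real.pi * Complex.I * jacobiDz (jacobiDz φ) (τ, w)) w := by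
  have h0 : Differentiable ℂ (deriv fun w : ℂ => φ (τ, w)) := fun w =>
    ((hφ.differentiable_snd τ).differentiableOn.deriv isOpen_univ).differentiableAt
      Filter.univ_mem
  have h := ((h0 w).const_mul (2 * Real.pi * Complex.I)⁻¹).hasDerivAt
  rw [jacobiDz, mul_inv_cancel_left₀ Complex.two_pi_I_ne_zero]
  exact h

/-- The derivative of `φ` along a curve `t ↦ (a t, b t)`. -/
theorem hasDerivAt_comp (hφ : JacobiHolomorphic φ) {a b : ℂ → ℂ} {a' b' t : ℂ} {p : ℍ × ℂ}
    (ha : HasDerivAt a a' t) (hb : HasDerivAt b b' t) (hp1 : a t = p.1) (hp2 : b t = p.2) :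
    HasDerivAt (fun t => φ (ofComplex (a t), b t))
      (2 * Real.pi * Complex.I * (a' * jacobiDτ φ p + b' * jacobiDz φ p)) t := by
  have h := (hφ.differentiableAt p).hasFDerivAt
  set L := fderiv ℂ (fun p : ℂ × ℂ => φ (ofComplex p.1, p.2)) ((p.1 : ℂ), p.2) with hL
  have h1 : HasDerivAt (fun s : ℂ => φ (ofComplex s, p.2)) (L (1, 0)) (p.1 : ℂ) :=
    HasFDerivAt.comp_hasDerivAt (f := fun s : ℂ => (s, p.2)) _ h
      ((hasDerivAt_id _).prodMk (hasDerivAt_const _ _))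
  have h2 : HasDerivAt (fun w : ℂ => φ (p.1, w)) (L (0, 1)) p.2 := by
    have := HasFDerivAt.comp_hasDerivAt (f := fun w : ℂ => ((p.1 : ℂ), w)) p.2 h
      ((hasDerivAt_const _ _).prodMk (hasDerivAt_id _))
    simpa [Function.comp_def, ofComplex_apply] using this
  rw [← hp1, ← hp2] at h
  have h3 := HasFDerivAt.comp_hasDerivAt (f := fun t : ℂ => (a t, b t)) t h (ha.prodMk hb)
  refine h3.congr_deriv ?_
  have e1 : 2 * Real.pi * Complex.I * jacobiDτ φ p = L (1, 0) := by
    rw [jacobiDτ, mul_inv_cancel_left₀ Complex.two_pi_I_ne_zero, h1.deriv]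
  have e2 : 2 * Real.pi * Complex.I * jacobiDz φ p = L (0, 1) := by
    rw [jacobiDz, mul_inv_cancel_left₀ Complex.two_pi_I_ne_zero, h2.deriv]
  have e3 : ((a', b') : ℂ × ℂ) = a' • ((1 : ℂ), (0 : ℂ)) + b' • ((0 : ℂ), (1 : ℂ)) := by simp
  rw [e3, map_add, map_smul, map_smul, smul_eq_mul, smul_eq_mul, ← e1, ← e2]
  ring

end JacobiHolomorphic

namespace JacobiGroup

theorem autoFactor_add_two (k m : ℕ) (g : JacobiGroup) (p : ℍ × ℂ) :
    autoFactor (k + 2) m g p = autoFactor k m g p / g.den p.1 ^ 2 := by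
  have h0 := den_ne_zero g p.1
  rw [autoFactor, autoFactor, show (-((k + 2 : ℕ) : ℤ)) = -(k : ℤ) - (2 : ℕ) by push_cast; ring,
    zpow_sub₀ h0, zpow_natCast]
  ring

/-- The quasi-modularity of `E₂`. -/
theorem E2_smul (g : JacobiGroup) (τ : ℍ) :
    EisensteinSeries.E2 (g.mat • τ) = g.den τ ^ 2 * EisensteinSeries.E2 τ
      - 6 * Complex.I / Real.pi * g.mat 1 0 * g.den τ := by
  have h0 := den_ne_zero g τ
  have h := congrFun (EisensteinSeries.E2_slash_action g.mat) τ
  rw [ModularForm.SL_slash_apply, ModularGroup.denom_apply] at h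
  simp only [Pi.sub_apply, Pi.smul_apply, smul_eq_mul, EisensteinSeries.D2,
    ModularGroup.denom_apply, riemannZeta_two] at h
  rw [← den] at h
  have hpi : (Real.pi : ℂ) ≠ 0 := by exact_mod_cast Real.pi_ne_zero
  rw [zpow_neg, mul_inv_eq_iff_eq_mul₀ (zpow_ne_zero _ h0)] at h
  rw [h]
  field_simp

/-- The `z`-derivative of the automorphy factor. -/
theorem hasDerivAt_autoFactor_snd (k m : ℕ) (g : JacobiGroup) (τ : ℍ) (w : ℂ) :
    HasDerivAt (fun w : ℂ => autoFactor k m g (τ, w))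
      (autoFactor k m g (τ, w) * (2 * Real.pi * Complex.I * (2 * m *
        (g.lam - g.mat 1 0 * (w + g.lam * (τ : ℂ) + g.mu) / g.den τ)))) w := by
  have h1 : HasDerivAt (fun w : ℂ => w + g.lam * (τ : ℂ) + g.mu) 1 w :=
    ((hasDerivAt_id w).add_const _).add_const _
  have h2 := (((((h1.pow 2).const_mul (g.mat 1 0 : ℂ)).div_const (g.den τ)).neg.add_const
    ((g.lam : ℂ) ^ 2 * (τ : ℂ))).add ((hasDerivAt_id w).const_mul (2 * (g.lam : ℂ))))
  have h3 := ((h2.const_mul (2 * Real.pi * Complex.I * m)).cexp).const_mul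
    (g.den τ ^ (-(k : ℤ)))
  refine h3.congr_deriv ?_
  simp only [autoFactor, expo, Pi.add_apply, Pi.neg_apply, Pi.pow_apply, id]
  ring

/-- The `τ`-derivative of the automorphy factor. -/
theorem hasDerivAt_autoFactor_fst (k m : ℕ) (g : JacobiGroup) (τ : ℍ) (z : ℂ) :
    HasDerivAt (fun t : ℂ => autoFactor k m g (ofComplex t, z))
      (autoFactor k m g (τ, z) * (-k * g.mat 1 0 / g.den τ + 2 * Real.pi * Complex.I * m *
        (g.lam - g.mat 1 0 * (z + g.lam * (τ : ℂ) + g.mu) / g.den τ) ^ 2)) (τ : ℂ) := by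
  have h0 := den_ne_zero g τ
  have hd : HasDerivAt (fun t : ℂ => (g.mat 1 0 : ℂ) * t + g.mat 1 1) (g.mat 1 0 : ℂ) (τ : ℂ) := by
    simpa using ((hasDerivAt_id (τ : ℂ)).const_mul (g.mat 1 0 : ℂ)).add_const (g.mat 1 1 : ℂ)
  have h1 : HasDerivAt (fun t : ℂ => z + g.lam * t + g.mu) g.lam (τ : ℂ) := by
    simpa using (((hasDerivAt_id (τ : ℂ)).const_mul (g.lam : ℂ)).const_add z).add_const (g.mu : ℂ)
  have h2 := ((((h1.pow 2).const_mul (g.mat 1 0 : ℂ)).div hd h0).neg.add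
    ((hasDerivAt_id (τ : ℂ)).const_mul ((g.lam : ℂ) ^ 2))).add_const (2 * (g.lam : ℂ) * z)
  have hz := HasDerivAt.comp (τ : ℂ) (hasDerivAt_zpow (-(k : ℤ)) _ (Or.inl h0)) hd
  have h3 := hz.mul (h2.const_mul (2 * Real.pi * Complex.I * m)).cexp
  have heq : (fun t : ℂ => autoFactor k m g (ofComplex t, z)) =ᶠ[nhds (τ : ℂ)]
      (fun t : ℂ => ((g.mat 1 0 : ℂ) * t + g.mat 1 1) ^ (-(k : ℤ)) *
        Complex.exp (2 * Real.pi * Complex.I * m *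
          (-((g.mat 1 0 : ℂ) * (z + g.lam * t + g.mu) ^ 2 / ((g.mat 1 0 : ℂ) * t + g.mat 1 1))
            + (g.lam : ℂ) ^ 2 * t + 2 * g.lam * z))) := by
    filter_upwards [(isOpen_lt continuous_const Complex.continuous_im).mem_nhds τ.im_pos] with t ht
    simp only [autoFactor, expo, den, ofComplex_apply_of_im_pos ht]
  refine (HasDerivAt.congr_of_eventuallyEq h3 heq).congr_deriv ?_
  simp only [autoFactor, expo, Pi.add_apply, Pi.neg_apply, Pi.pow_apply,
    Pi.div_apply, id, Function.comp]
  rw [den] at h0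
  simp only [den]
  rw [zpow_sub_one₀ h0]
  generalize ((g.mat 1 0 : ℂ) * (τ : ℂ) + (g.mat 1 1 : ℂ)) ^ (-(k : ℤ)) = A
  push_cast
  field_simp
  ring

/-- The holomorphic defect of modularity of the heat operator is cancelled by that of `E₂`. -/
theorem modifiedHeatOperator_slash {φ : ℍ × ℂ → ℂ} (hφ : JacobiHolomorphic φ) (k m : ℕ)
    (g : JacobiGroup) :
    modifiedHeatOperator k m (jacobiSlash k m φ g) =
      jacobiSlash (k + 2) m (modifiedHeatOperator k m φ) g := by
  ext ⟨τ, z⟩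
  have h0 := den_ne_zero g τ
  have hpi : (Real.pi : ℂ) ≠ 0 := by exact_mod_cast Real.pi_ne_zero
  -- derivatives of `p ↦ g • p`
  have hq (w : ℂ) : HasDerivAt (fun w : ℂ => (w + g.lam * (τ : ℂ) + g.mu) / g.den τ)
      (1 / g.den τ) w :=
    (((hasDerivAt_id w).add_const _).add_const _).div_const _
  -- first and second derivative in `z`
  have hz1 (w : ℂ) : jacobiDz (jacobiSlash k m φ g) (τ, w) = autoFactor k m g (τ, w) *
      (2 * m * (g.lam - g.mat 1 0 * (w + g.lam * (τ : ℂ) + g.mu) / g.den τ) * φ (g • (τ, w)) +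
        jacobiDz φ (g • (τ, w)) / g.den τ) := by
    have h := (hasDerivAt_autoFactor_snd k m g τ w).mul
      ((hφ.hasDerivAt_snd (g.mat • τ) _).comp w (hq w))
    rw [jacobiDz, inv_mul_eq_iff_eq_mul₀ Complex.two_pi_I_ne_zero]
    refine h.deriv.trans ?_
    simp only [smul_def, Function.comp]
    ring
  have hz2 : jacobiDz (jacobiDz (jacobiSlash k m φ g)) (τ, z) = autoFactor k m g (τ, z) *
      ((2 * m * (g.lam - g.mat 1 0 * (z + g.lam * (τ : ℂ) + g.mu) / g.den τ)) ^ 2 *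
          φ (g • (τ, z))
        + 2 * (2 * m * (g.lam - g.mat 1 0 * (z + g.lam * (τ : ℂ) + g.mu) / g.den τ)) *
          (jacobiDz φ (g • (τ, z)) / g.den τ)
        + jacobiDz (jacobiDz φ) (g • (τ, z)) / g.den τ ^ 2
        - (2 * Real.pi * Complex.I)⁻¹ * (2 * m * g.mat 1 0 / g.den τ) * φ (g • (τ, z))) := by
    have hl : HasDerivAt (fun w : ℂ => 2 * m *
        (g.lam - g.mat 1 0 * (w + g.lam * (τ : ℂ) + g.mu) / g.den τ))
        (2 * m * (-(g.mat 1 0 * 1 / g.den τ))) z :=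
      ((((((hasDerivAt_id z).add_const _).add_const _).const_mul _).div_const _).const_sub
        _).const_mul _
    have h := (hasDerivAt_autoFactor_snd k m g τ z).mul
      ((hl.mul ((hφ.hasDerivAt_snd (g.mat • τ) _).comp z (hq z))).add
        (((hφ.hasDerivAt_snd_snd (g.mat • τ) _).comp z (hq z)).div_const (g.den τ)))
    rw [jacobiDz, inv_mul_eq_iff_eq_mul₀ Complex.two_pi_I_ne_zero]
    simp only [hz1]
    refine h.deriv.trans ?_
    simp only [smul_def, Function.comp, Pi.mul_apply, Pi.add_apply]
    field_simp
    ring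
  -- derivative in `τ`
  have ht : jacobiDτ (jacobiSlash k m φ g) (τ, z) = autoFactor k m g (τ, z) *
      (((2 * Real.pi * Complex.I)⁻¹ * (-k * g.mat 1 0 / g.den τ) + m *
        (g.lam - g.mat 1 0 * (z + g.lam * (τ : ℂ) + g.mu) / g.den τ) ^ 2) * φ (g • (τ, z))
        + (1 / g.den τ ^ 2) * jacobiDτ φ (g • (τ, z))
        + (g.lam - g.mat 1 0 * (z + g.lam * (τ : ℂ) + g.mu) / g.den τ) / g.den τ *
          jacobiDz φ (g • (τ, z))) := by
    have hd : HasDerivAt (fun t : ℂ => (g.mat 1 0 : ℂ) * t + g.mat 1 1) (g.mat 1 0 : ℂ)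
        (τ : ℂ) := by
      simpa using ((hasDerivAt_id (τ : ℂ)).const_mul (g.mat 1 0 : ℂ)).add_const (g.mat 1 1 : ℂ)
    have hn : HasDerivAt (fun t : ℂ => (g.mat 0 0 : ℂ) * t + g.mat 0 1) (g.mat 0 0 : ℂ)
        (τ : ℂ) := by
      simpa using ((hasDerivAt_id (τ : ℂ)).const_mul (g.mat 0 0 : ℂ)).add_const (g.mat 0 1 : ℂ)
    have hx : HasDerivAt (fun t : ℂ => z + g.lam * t + g.mu) (g.lam : ℂ) (τ : ℂ) := by
      simpa using (((hasDerivAt_id (τ : ℂ)).const_mul (g.lam : ℂ)).const_add z).add_const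
        (g.mu : ℂ)
    have hc := hφ.hasDerivAt_comp (p := g • (τ, z)) (hn.div hd h0) (hx.div hd h0)
      (by rw [smul_fst, coe_mat_smul]; rfl) rfl
    have h := (hasDerivAt_autoFactor_fst k m g τ z).mul hc
    have heq : (fun t : ℂ => jacobiSlash k m φ g (ofComplex t, z)) =ᶠ[nhds (τ : ℂ)]
        (fun t : ℂ => autoFactor k m g (ofComplex t, z) *
          φ (ofComplex (((g.mat 0 0 : ℂ) * t + g.mat 0 1) / ((g.mat 1 0 : ℂ) * t + g.mat 1 1)),
            (z + g.lam * t + g.mu) / ((g.mat 1 0 : ℂ) * t + g.mat 1 1))) := by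
      filter_upwards [(isOpen_lt continuous_const Complex.continuous_im).mem_nhds τ.im_pos]
        with t ht
      rw [jacobiSlash_apply, smul_def]
      have e : (ofComplex t : ℂ) = t := by rw [ofComplex_apply_of_im_pos ht]
      have e2 := coe_mat_smul g (ofComplex t)
      simp only [den, e] at e2 ⊢
      rw [← e2, ofComplex_apply]
    have h' := HasDerivAt.congr_of_eventuallyEq h heq
    have hdet : ((g.mat 0 0 : ℂ) * g.mat 1 1 - g.mat 0 1 * g.mat 1 0) = 1 := by
      exact_mod_cast congrArg (Int.cast : ℤ → ℂ) g.det_eq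
    rw [jacobiDτ, inv_mul_eq_iff_eq_mul₀ Complex.two_pi_I_ne_zero]
    refine h'.deriv.trans ?_
    simp only [Pi.div_apply]
    rw [← den, ← coe_mat_smul]
    simp only [ofComplex_apply]
    rw [
      show (g.mat • τ, (z + g.lam * (τ : ℂ) + g.mu) / g.den τ) = g • (τ, z) from rfl]
    have e1 : (g.mat 0 0 : ℂ) * g.den τ - (g.mat 0 0 * (τ : ℂ) + g.mat 0 1) * g.mat 1 0 = 1 := by
      rw [den]; linear_combination hdet
    rw [e1]
    field_simp
    ring
  have hE := E2_smul g τ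
  rw [modifiedHeatOperator, heatOperator, ht, hz2, jacobiSlash_apply, jacobiSlash_apply,
    autoFactor_add_two, modifiedHeatOperator, heatOperator, smul_fst]
  simp only
  rw [hE]
  field_simp
  ring_nf
  simp only [Complex.I_sq]
  ring

end JacobiGroup

/-! ### Termwise differentiation of locally uniformly convergent series -/

/-- Locally around each point, the series `∑ F i` is dominated by a summable family. -/
def LocallySummable {ι X : Type*} [TopologicalSpace X] (F : ι → X → ℂ) : Prop :=
  ∀ p : X, ∃ U ∈ nhds p, ∃ u : ι → ℝ, Summable u ∧ ∀ i, ∀ q ∈ U, ‖F i q‖ ≤ u i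

theorem LocallySummable.comp {ι X Y : Type*} [TopologicalSpace X] [TopologicalSpace Y]
    {F : ι → X → ℂ} (hF : LocallySummable F) {f : Y → X} (hf : Continuous f) :
    LocallySummable fun i y => F i (f y) := by
  intro y
  obtain ⟨U, hU, u, hu, h⟩ := hF (f y)
  exact ⟨f ⁻¹' U, hf.continuousAt.preimage_mem_nhds hU, u, hu, fun i q hq => h i _ hq⟩

/-- Termwise first and second derivatives of a series of entire functions that converges locally
uniformly. -/
theorem hasSum_deriv_of_locallySummable {ι : Type*} {F : ι → ℂ → ℂ} {f : ℂ → ℂ}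
    (hF : ∀ i, Differentiable ℂ (F i)) (hloc : LocallySummable F)
    (hs : ∀ z, HasSum (fun i => F i z) (f z)) (z : ℂ) :
    HasSum (fun i => deriv (F i) z) (deriv f z) ∧
      HasSum (fun i => deriv (deriv (F i)) z) (deriv (deriv f) z) := by
  have hf : f = fun w => ∑' i, F i w := funext fun w => (hs w).tsum_eq.symm
  have h1 : ∀ z, HasSum (fun i => deriv (F i) z) (deriv f z) := by
    intro z
    obtain ⟨U, hU, u, hu, h⟩ := hloc z
    obtain ⟨R, hR, hRU⟩ := Metric.mem_nhds_iff.mp hU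
    rw [hf]
    exact Complex.hasSum_deriv_of_summable_norm hu (fun i => (hF i).differentiableOn)
      Metric.isOpen_ball (fun i w hw => h i w (hRU hw)) (Metric.mem_ball_self hR)
  refine ⟨h1 z, ?_⟩
  obtain ⟨U, hU, u, hu, h⟩ := hloc z
  obtain ⟨R, hR, hRU⟩ := Metric.mem_nhds_iff.mp hU
  have hdf : deriv f = fun w => ∑' i, deriv (F i) w := funext fun w => (h1 w).tsum_eq.symm
  rw [hdf]
  refine Complex.hasSum_deriv_of_summable_norm (u := fun i => u i / (R / 2))
    (U := Metric.ball z (R / 2)) (hu.div_const _)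
    (fun i => ((hF i).differentiableOn.deriv isOpen_univ).mono (Set.subset_univ _))
    Metric.isOpen_ball (fun i w hw => ?_) (Metric.mem_ball_self (by positivity))
  refine Complex.norm_deriv_le_of_forall_mem_sphere_norm_le (by positivity)
    (hF i).diffContOnCl fun x hx => h i x (hRU ?_)
  rw [Metric.mem_ball] at hw ⊢
  rw [mem_sphere_iff_norm] at hx
  calc dist x z ≤ dist x w + dist w z := dist_triangle _ _ _
    _ < R := by rw [dist_eq_norm, hx]; linarith

/-- Cauchy's estimate for the Fréchet derivative. -/
theorem norm_fderiv_le_of_forall_mem_ball {f : ℂ × ℂ → ℂ} {x : ℂ × ℂ} {R C : ℝ} (hR : 0 < R)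
    (hf : DifferentiableOn ℂ f (Metric.ball x R)) (hC : ∀ q ∈ Metric.ball x R, ‖f q‖ ≤ C) :
    ‖fderiv ℂ f x‖ ≤ C / (R / 2) := by
  have hC0 : 0 ≤ C := (norm_nonneg _).trans (hC x (Metric.mem_ball_self hR))
  refine ContinuousLinearMap.opNorm_le_bound _ (by positivity) fun v => ?_
  rcases eq_or_ne v 0 with rfl | hv
  · simp
  have hv' : 0 < ‖v‖ := norm_pos_iff.mpr hv
  have hmem : ∀ t : ℂ, ‖t‖ ≤ R / 2 / ‖v‖ → x + t • v ∈ Metric.ball x R := by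
    intro t ht
    rw [mem_ball_iff_norm, add_sub_cancel_left, norm_smul]
    calc ‖t‖ * ‖v‖ ≤ R / 2 / ‖v‖ * ‖v‖ := by gcongr
      _ = R / 2 := by field_simp
      _ < R := by linarith
  have hline : ∀ t : ℂ, HasDerivAt (fun t : ℂ => x + t • v) v t := by
    intro t
    simpa using ((hasDerivAt_id t).smul_const v).const_add x
  have hd : HasDerivAt (fun t : ℂ => f (x + t • v)) (fderiv ℂ f x v) 0 := by
    have hx : DifferentiableAt ℂ f (x + (0 : ℂ) • v) := by
      simpa using hf.differentiableAt (Metric.ball_mem_nhds x hR)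
    have := hx.hasFDerivAt.comp_hasDerivAt (0 : ℂ) (hline 0)
    simpa [Function.comp_def] using this
  rw [← hd.deriv]
  have := Complex.norm_deriv_le_of_forall_mem_sphere_norm_le (f := fun t : ℂ => f (x + t • v))
    (c := 0) (R := R / 2 / ‖v‖) (C := C) (by positivity) ?_ ?_
  · refine this.trans_eq ?_
    field_simp
  · refine DifferentiableOn.diffContOnCl (s := Metric.ball (0 : ℂ) (R / 2 / ‖v‖)) ?_
    intro t ht
    have htm : ‖t‖ ≤ R / 2 / ‖v‖ := by
      have := Metric.closure_ball_subset_closedBall ht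
      simpa using this
    have hx := (hf.differentiableAt (Metric.isOpen_ball.mem_nhds (hmem t htm)))
    exact (hx.comp t (hline t).differentiableAt).differentiableWithinAt
  · intro t ht
    refine hC _ (hmem t ?_)
    simpa using (mem_sphere_iff_norm.mp ht).le

theorem tendsto_ofComplex_prod (p : ℍ × ℂ) :
    Filter.Tendsto (fun q : ℂ × ℂ => ((ofComplex q.1, q.2) : ℍ × ℂ)) (nhds ((p.1 : ℂ), p.2))
      (nhds p) := by
  have h := (contMDiffAt_ofComplex (n := 0) p.1.im_pos).continuousAt
  rw [ContinuousAt, ofComplex_apply] at h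
  exact (h.comp continuous_fst.continuousAt.tendsto).prodMk_nhds
    (continuous_snd.tendsto ((p.1 : ℂ), p.2))

/-- A locally uniformly convergent series of holomorphic functions on `ℍ × ℂ` is holomorphic. -/
theorem jacobiHolomorphic_of_hasSum {ι : Type*} {F : ι → ℍ × ℂ → ℂ} {φ : ℍ × ℂ → ℂ}
    (hF : ∀ i, JacobiHolomorphic (F i)) (hloc : LocallySummable F)
    (hs : ∀ p, HasSum (fun i => F i p) (φ p)) : JacobiHolomorphic φ := by
  rintro p hp
  obtain ⟨U, hU, u, hu, h⟩ := hloc (ofComplex p.1, p.2)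
  have hpe : (((ofComplex p.1 : ℍ) : ℂ), p.2) = p := by
    rw [ofComplex_apply_of_im_pos hp]
  have ht := tendsto_ofComplex_prod (ofComplex p.1, p.2)
  simp only [hpe] at ht
  obtain ⟨R, hR, hRU⟩ := Metric.mem_nhds_iff.mp
    (Filter.inter_mem (ht hU) (isOpen_im_fst_pos.mem_nhds hp))
  have hsub : ∀ q ∈ Metric.ball p (R / 2), Metric.ball q (R / 2) ⊆ Metric.ball p R := by
    intro q hq x hx
    rw [Metric.mem_ball] at *
    linarith [dist_triangle x q p]
  have hdiff : ∀ i, DifferentiableOn ℂ (fun q : ℂ × ℂ => F i (ofComplex q.1, q.2))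
      (Metric.ball p R) := fun i => (hF i).mono fun q hq => (hRU hq).2
  have key := hasFDerivAt_tsum_of_isPreconnected (𝕜 := ℂ)
    (f := fun i (q : ℂ × ℂ) => F i (ofComplex q.1, q.2)) (s := Metric.ball p (R / 2))
    (f' := fun i q => fderiv ℂ (fun q : ℂ × ℂ => F i (ofComplex q.1, q.2)) q)
    (u := fun i => u i / (R / 2 / 2)) (x₀ := p) (x := p) (hu.div_const _) Metric.isOpen_ball
    (convex_ball p (R / 2)).isPreconnected
    (fun i q hq => ((hdiff i).differentiableAt (Metric.isOpen_ball.mem_nhds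
      (hsub q hq (Metric.mem_ball_self (by positivity))))).hasFDerivAt)
    (fun i q hq => norm_fderiv_le_of_forall_mem_ball (by positivity)
      ((hdiff i).mono (hsub q hq)) (fun x hx => h i _ (hRU (hsub q hq hx)).1))
    (Metric.mem_ball_self (by positivity)) (hs _).summable (Metric.mem_ball_self (by positivity))
  have he : (fun q : ℂ × ℂ => φ (ofComplex q.1, q.2)) =
      fun q => ∑' i, F i (ofComplex q.1, q.2) := funext fun q => (hs _).tsum_eq.symm
  rw [he]
  exact key.differentiableAt.differentiableWithinAt

theorem hasSum_jacobiDz {ι : Type*} {F : ι → ℍ × ℂ → ℂ} {φ : ℍ × ℂ → ℂ}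
    (hF : ∀ i, JacobiHolomorphic (F i)) (hloc : LocallySummable F)
    (hs : ∀ p, HasSum (fun i => F i p) (φ p)) (p : ℍ × ℂ) :
    HasSum (fun i => jacobiDz (F i) p) (jacobiDz φ p) ∧
      HasSum (fun i => jacobiDz (jacobiDz (F i)) p) (jacobiDz (jacobiDz φ) p) := by
  have h := hasSum_deriv_of_locallySummable (fun i => (hF i).differentiable_snd p.1)
    (hloc.comp (by fun_prop : Continuous fun w : ℂ => ((p.1, w) : ℍ × ℂ)))
    (fun w => hs (p.1, w)) p.2
  refine ⟨h.1.mul_left _, ?_⟩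
  have e : ∀ ψ : ℍ × ℂ → ℂ, jacobiDz (jacobiDz ψ) p = (2 * Real.pi * Complex.I)⁻¹ *
      ((2 * Real.pi * Complex.I)⁻¹ * deriv (deriv fun w => ψ (p.1, w)) p.2) := by
    intro ψ
    simp only [jacobiDz]
    rw [deriv_const_mul_field]
  simp only [e]
  exact (h.2.mul_left _).mul_left _

theorem hasSum_jacobiDτ {ι : Type*} {F : ι → ℍ × ℂ → ℂ} {φ : ℍ × ℂ → ℂ}
    (hF : ∀ i, JacobiHolomorphic (F i)) (hloc : LocallySummable F)
    (hs : ∀ p, HasSum (fun i => F i p) (φ p)) (p : ℍ × ℂ) :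
    HasSum (fun i => jacobiDτ (F i) p) (jacobiDτ φ p) := by
  obtain ⟨U, hU, u, hu, h⟩ := hloc p
  have h1 : Continuous fun t : ℂ => ((t, p.2) : ℂ × ℂ) := by fun_prop
  have ht : Filter.Tendsto (fun t : ℂ => ((ofComplex t, p.2) : ℍ × ℂ)) (nhds (p.1 : ℂ))
      (nhds p) := (tendsto_ofComplex_prod p).comp h1.continuousAt.tendsto
  obtain ⟨R, hR, hRU⟩ := Metric.mem_nhds_iff.mp (Filter.inter_mem (ht hU)
    ((isOpen_lt continuous_const Complex.continuous_im).mem_nhds p.1.im_pos))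
  have hd := Complex.hasSum_deriv_of_summable_norm
    (F := fun i (t : ℂ) => F i (ofComplex t, p.2)) (U := Metric.ball (p.1 : ℂ) R) hu
    (fun i t ht => ?_) Metric.isOpen_ball (fun i t ht => h i _ (hRU ht).1)
    (Metric.mem_ball_self hR)
  · have he : (fun t : ℂ => φ (ofComplex t, p.2)) =
        fun t => ∑' i, F i (ofComplex t, p.2) := funext fun t => (hs _).tsum_eq.symm
    simp only [jacobiDτ, he]
    exact hd.mul_left _
  · have h2 := DifferentiableOn.differentiableAt (hF i)
      (isOpen_im_fst_pos.mem_nhds (x := ((t, p.2) : ℂ × ℂ)) (hRU ht).2)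
    have h3 : DifferentiableAt ℂ (fun t : ℂ => ((t, p.2) : ℂ × ℂ)) t := by fun_prop
    exact (DifferentiableAt.comp (f := fun t : ℂ => ((t, p.2) : ℂ × ℂ)) t h2
      h3).differentiableWithinAt

/-- The modified heat operator may be applied termwise. -/
theorem hasSum_modifiedHeatOperator {ι : Type*} {F : ι → ℍ × ℂ → ℂ} {φ : ℍ × ℂ → ℂ}
    (hF : ∀ i, JacobiHolomorphic (F i)) (hloc : LocallySummable F)
    (hs : ∀ p, HasSum (fun i => F i p) (φ p)) (k m : ℕ) (p : ℍ × ℂ) :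
    HasSum (fun i => modifiedHeatOperator k m (F i) p) (modifiedHeatOperator k m φ p) :=
  (((hasSum_jacobiDτ hF hloc hs p).mul_left _).sub (hasSum_jacobiDz hF hloc hs p).2).sub
    ((hs p).mul_left _)

/-! ### Fourier expansions -/

/-- The monomial `q ^ n ζ ^ r`. -/
def jacobiExp (n r : ℤ) (p : ℍ × ℂ) : ℂ :=
  Complex.exp (2 * Real.pi * Complex.I * (n * (p.1 : ℂ) + r * p.2))

theorem hasJacobiFourierExpansion_iff {φ : ℍ × ℂ → ℂ} {c : ℤ → ℤ → ℂ} :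
    HasJacobiFourierExpansion φ c ↔
      ∀ p, HasSum (fun nr : ℤ × ℤ => c nr.1 nr.2 * jacobiExp nr.1 nr.2 p) (φ p) :=
  ⟨fun h p => h p.1 p.2, fun h τ z => h (τ, z)⟩

theorem norm_jacobiExp (n r : ℤ) (p : ℍ × ℂ) :
    ‖jacobiExp n r p‖ = Real.exp (-2 * Real.pi * (n * p.1.im + r * p.2.im)) := by
  rw [jacobiExp, Complex.norm_exp]
  congr 1
  have : 2 * (Real.pi : ℂ) * Complex.I * (n * (p.1 : ℂ) + r * p.2) =
    ((2 * Real.pi : ℝ) : ℂ) * (Complex.I * (n * (p.1 : ℂ) + r * p.2)) := by push_cast; ring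
  rw [this, Complex.re_ofReal_mul]
  simp
  ring

theorem jacobiExp_add (n r n' r' : ℤ) (p : ℍ × ℂ) :
    jacobiExp (n + n') (r + r') p = jacobiExp n r p * jacobiExp n' r' p := by
  rw [jacobiExp, jacobiExp, jacobiExp, ← Complex.exp_add]
  congr 1
  push_cast
  ring

theorem jacobiHolomorphic_jacobiExp (n r : ℤ) : JacobiHolomorphic (jacobiExp n r) := by
  have h : DifferentiableOn ℂ (fun p : ℂ × ℂ =>
      Complex.exp (2 * Real.pi * Complex.I * (n * p.1 + r * p.2))) {p | 0 < p.1.im} := by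
    fun_prop
  refine h.congr fun p hp => ?_
  rw [jacobiExp, ofComplex_apply_of_im_pos hp]

theorem JacobiHolomorphic.const_mul {φ : ℍ × ℂ → ℂ} (hφ : JacobiHolomorphic φ) (a : ℂ) :
    JacobiHolomorphic fun p => a * φ p :=
  DifferentiableOn.const_mul hφ a

theorem jacobiDz_const_mul_jacobiExp (a : ℂ) (n r : ℤ) :
    jacobiDz (fun p => a * jacobiExp n r p) = fun p => r * a * jacobiExp n r p := by
  ext p
  have h : HasDerivAt (fun w : ℂ => a * jacobiExp n r (p.1, w))
      (a * (jacobiExp n r p * (2 * Real.pi * Complex.I * (r * 1)))) p.2 := by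
    change HasDerivAt (fun w : ℂ => a * Complex.exp (2 * Real.pi * Complex.I *
      (n * (p.1 : ℂ) + r * w))) (a * (Complex.exp (2 * Real.pi * Complex.I *
      (n * (p.1 : ℂ) + r * p.2)) * (2 * Real.pi * Complex.I * (r * 1)))) p.2
    exact ((((hasDerivAt_id p.2).const_mul (r : ℂ)).const_add _).const_mul _).cexp.const_mul a
  rw [jacobiDz, h.deriv, inv_mul_eq_iff_eq_mul₀ Complex.two_pi_I_ne_zero]
  ring

theorem jacobiDτ_const_mul_jacobiExp (a : ℂ) (n r : ℤ) :
    jacobiDτ (fun p => a * jacobiExp n r p) = fun p => n * a * jacobiExp n r p := by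
  ext p
  have h : HasDerivAt (fun t : ℂ => a * Complex.exp (2 * Real.pi * Complex.I *
      (n * t + r * p.2))) (a * (jacobiExp n r p * (2 * Real.pi * Complex.I * (n * 1))))
      (p.1 : ℂ) :=
    ((((hasDerivAt_id (p.1 : ℂ)).const_mul (n : ℂ)).add_const _).const_mul _).cexp.const_mul a
  have heq : (fun t : ℂ => a * jacobiExp n r (ofComplex t, p.2)) =ᶠ[nhds (p.1 : ℂ)]
      fun t : ℂ => a * Complex.exp (2 * Real.pi * Complex.I * (n * t + r * p.2)) := by
    filter_upwards [(isOpen_lt continuous_const Complex.continuous_im).mem_nhds p.1.im_pos]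
      with t ht
    rw [jacobiExp, ofComplex_apply_of_im_pos ht]
  rw [jacobiDτ, (h.congr_of_eventuallyEq heq).deriv,
    inv_mul_eq_iff_eq_mul₀ Complex.two_pi_I_ne_zero]
  ring

theorem heatOperator_const_mul_jacobiExp (m : ℕ) (a : ℂ) (n r : ℤ) (p : ℍ × ℂ) :
    heatOperator m (fun p => a * jacobiExp n r p) p =
      (4 * n * m - r ^ 2) * a * jacobiExp n r p := by
  rw [heatOperator, jacobiDz_const_mul_jacobiExp, jacobiDz_const_mul_jacobiExp,
    jacobiDτ_const_mul_jacobiExp]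
  ring

/-- On a square the exponential of a linear form is largest at a corner. -/
theorem exp_le_sum_corners (a b x y δ : ℝ) {x' y' : ℝ} (hx : |x' - x| ≤ δ) (hy : |y' - y| ≤ δ) :
    Real.exp (-(a * x' + b * y')) ≤
      Real.exp (-(a * (x - δ) + b * (y - δ))) + Real.exp (-(a * (x - δ) + b * (y + δ))) +
      (Real.exp (-(a * (x + δ) + b * (y - δ))) + Real.exp (-(a * (x + δ) + b * (y + δ)))) := by
  have p1 := Real.exp_pos (-(a * (x - δ) + b * (y - δ)))
  have p2 := Real.exp_pos (-(a * (x - δ) + b * (y + δ)))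
  have p3 := Real.exp_pos (-(a * (x + δ) + b * (y - δ)))
  have p4 := Real.exp_pos (-(a * (x + δ) + b * (y + δ)))
  rw [abs_le] at hx hy
  rcases le_total 0 a with ha | ha <;> rcases le_total 0 b with hb | hb
  · have : Real.exp (-(a * x' + b * y')) ≤ Real.exp (-(a * (x - δ) + b * (y - δ))) :=
      Real.exp_le_exp.mpr (by nlinarith)
    linarith
  · have : Real.exp (-(a * x' + b * y')) ≤ Real.exp (-(a * (x - δ) + b * (y + δ))) :=
      Real.exp_le_exp.mpr (by nlinarith)
    linarith
  · have : Real.exp (-(a * x' + b * y')) ≤ Real.exp (-(a * (x + δ) + b * (y - δ))) :=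
      Real.exp_le_exp.mpr (by nlinarith)
    linarith
  · have : Real.exp (-(a * x' + b * y')) ≤ Real.exp (-(a * (x + δ) + b * (y + δ))) :=
      Real.exp_le_exp.mpr (by nlinarith)
    linarith

namespace HasJacobiFourierExpansion

variable {φ : ℍ × ℂ → ℂ} {c : ℤ → ℤ → ℂ}

theorem summable_norm (h : HasJacobiFourierExpansion φ c) {v : ℝ} (hv : 0 < v) (y : ℝ) :
    Summable fun nr : ℤ × ℤ =>
      ‖c nr.1 nr.2‖ * Real.exp (-2 * Real.pi * (nr.1 * v + nr.2 * y)) := by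
  have := (hasJacobiFourierExpansion_iff.mp h
    ((⟨Complex.I * v, by simpa using hv⟩ : ℍ), Complex.I * y)).summable.norm
  refine this.congr fun nr => ?_
  rw [norm_mul, norm_jacobiExp]
  congr 4
  · simp [UpperHalfPlane.im]
  · simp

/-- Absolute convergence on `ℍ × ℂ` implies locally uniform convergence. -/
theorem locallySummable (h : HasJacobiFourierExpansion φ c) :
    LocallySummable fun (nr : ℤ × ℤ) (p : ℍ × ℂ) => c nr.1 nr.2 * jacobiExp nr.1 nr.2 p := by
  intro p
  set δ := p.1.im / 2 with hδ
  have hv := p.1.im_pos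
  have hδ0 : 0 < δ := by positivity
  have s1 := h.summable_norm (v := p.1.im - δ) (by linarith) (p.2.im - δ)
  have s2 := h.summable_norm (v := p.1.im - δ) (by linarith) (p.2.im + δ)
  have s3 := h.summable_norm (v := p.1.im + δ) (by linarith) (p.2.im - δ)
  have s4 := h.summable_norm (v := p.1.im + δ) (by linarith) (p.2.im + δ)
  refine ⟨{q | |q.1.im - p.1.im| < δ ∧ |q.2.im - p.2.im| < δ}, ?_, _,
    (s1.add s2).add (s3.add s4), ?_⟩
  · have hc1 : Continuous fun q : ℍ × ℂ => |q.1.im - p.1.im| := by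
      have := UpperHalfPlane.continuous_im
      fun_prop
    have hc2 : Continuous fun q : ℍ × ℂ => |q.2.im - p.2.im| := by
      have := Complex.continuous_im
      fun_prop
    exact ((isOpen_lt hc1 continuous_const).inter (isOpen_lt hc2 continuous_const)).mem_nhds
      (by simp [hδ0])
  · rintro ⟨n, r⟩ q ⟨hq1, hq2⟩
    rw [norm_mul, norm_jacobiExp]
    have := exp_le_sum_corners (2 * Real.pi * n) (2 * Real.pi * r) p.1.im p.2.im δ hq1.le hq2.le
    have e : ∀ a b : ℝ, -(2 * Real.pi * n * a + 2 * Real.pi * r * b) =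
      -2 * Real.pi * (n * a + r * b) := fun a b => by ring
    simp only [e] at this
    calc _ ≤ ‖c n r‖ * _ := mul_le_mul_of_nonneg_left this (norm_nonneg _)
      _ = _ := by ring

theorem jacobiHolomorphic (h : HasJacobiFourierExpansion φ c) : JacobiHolomorphic φ :=
  jacobiHolomorphic_of_hasSum (fun _ => (jacobiHolomorphic_jacobiExp _ _).const_mul _)
    h.locallySummable (hasJacobiFourierExpansion_iff.mp h)

theorem heatOperator (h : HasJacobiFourierExpansion φ c) (m : ℕ) :
    HasJacobiFourierExpansion (heatOperator m φ) fun n r => (4 * n * m - r ^ 2) * c n r := by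
  rw [hasJacobiFourierExpansion_iff]
  intro p
  have hF := fun nr : ℤ × ℤ => (jacobiHolomorphic_jacobiExp nr.1 nr.2).const_mul (c nr.1 nr.2)
  have hs := hasJacobiFourierExpansion_iff.mp h
  refine (((hasSum_jacobiDτ hF h.locallySummable hs p).mul_left (4 * m : ℂ)).sub
    (hasSum_jacobiDz hF h.locallySummable hs p).2).congr_fun ?_
  intro nr
  exact (heatOperator_const_mul_jacobiExp m _ _ _ p).symm

end HasJacobiFourierExpansion

/-- The coefficients of `E₂ = ∑ e(j) q ^ j`. -/
def e2Coeff (j : ℕ) : ℂ := if j = 0 then 1 else -24 * (ArithmeticFunction.sigma 1 j : ℂ)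

theorem jacobiExp_add_natCast (n r : ℤ) (j : ℕ) (p : ℍ × ℂ) :
    jacobiExp (n + j) r p =
      Complex.exp (2 * Real.pi * Complex.I * p.1) ^ j * jacobiExp n r p := by
  have := jacobiExp_add j 0 n r p
  rw [zero_add, add_comm (j : ℤ)] at this
  rw [this, ← Complex.exp_nat_mul]
  congr 1
  rw [jacobiExp]
  congr 1
  push_cast
  ring

theorem hasSum_E2 (τ : ℍ) :
    HasSum (fun j : ℕ => e2Coeff j * Complex.exp (2 * Real.pi * Complex.I * τ) ^ j)
      (EisensteinSeries.E2 τ) :=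
  EisensteinSeries.hasSum_qExpansion_E2 τ

theorem hasSum_E2_mul_jacobiExp (n r : ℤ) (p : ℍ × ℂ) :
    HasSum (fun j : ℕ => e2Coeff j * jacobiExp (n + j) r p)
      (EisensteinSeries.E2 p.1 * jacobiExp n r p) := by
  simp only [jacobiExp_add_natCast, ← mul_assoc]
  exact (hasSum_E2 p.1).mul_right _

/-- The bijection behind the Cauchy product of a power series in `q` and a Jacobi series. -/
def jacobiCauchyEquiv : (ℤ × ℤ) × ℕ ≃ ℕ × (ℤ × ℤ) where
  toFun x := (x.2, (x.1.1 - x.2, x.1.2))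
  invFun x := ((x.2.1 + x.1, x.2.2), x.1)
  left_inv x := by simp
  right_inv x := by simp

theorem hasSum_mul_prod {ι κ : Type*} {f : ι → ℂ} {g : κ → ℂ} {a b : ℂ} (hf : HasSum f a)
    (hg : HasSum g b) : HasSum (fun x : ι × κ => f x.1 * g x.2) (a * b) :=
  hf.mul hg (summable_mul_of_summable_norm hf.summable.norm hg.summable.norm)

theorem HasJacobiFourierExpansion.E2_mul {φ : ℍ × ℂ → ℂ} {c : ℤ → ℤ → ℂ}
    (h : HasJacobiFourierExpansion φ c) :
    HasJacobiFourierExpansion (fun p => EisensteinSeries.E2 p.1 * φ p)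
      fun n r => ∑' j : ℕ, e2Coeff j * c (n - j) r := by
  rw [hasJacobiFourierExpansion_iff] at h ⊢
  intro p
  have h3 := hasSum_mul_prod (hasSum_E2 p.1) (h p)
  have h4 : HasSum (fun x : (ℤ × ℤ) × ℕ =>
      (e2Coeff x.2 * c (x.1.1 - x.2) x.1.2) * jacobiExp x.1.1 x.1.2 p)
      (EisensteinSeries.E2 p.1 * φ p) := by
    refine (jacobiCauchyEquiv.hasSum_iff.mpr h3).congr_fun ?_
    rintro ⟨⟨n, r⟩, j⟩
    have e := jacobiExp_add_natCast (n - j) r j p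
    rw [sub_add_cancel] at e
    simp only [jacobiCauchyEquiv, Function.comp, Equiv.coe_fn_mk, e]
    ring
  refine h4.prod_fiberwise (g := fun nr : ℤ × ℤ =>
    (∑' j : ℕ, e2Coeff j * c (nr.1 - j) nr.2) * jacobiExp nr.1 nr.2 p) ?_
  rintro ⟨n, r⟩
  have := (h4.summable.prod_factor (n, r)).hasSum
  dsimp only at this ⊢
  rwa [tsum_mul_right] at this

/-- The coefficients of the image under the modified heat operator. -/
theorem HasJacobiFourierExpansion.modifiedHeatOperator {φ : ℍ × ℂ → ℂ} {c : ℤ → ℤ → ℂ}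
    (h : HasJacobiFourierExpansion φ c) (k m : ℕ) :
    HasJacobiFourierExpansion (modifiedHeatOperator k m φ) fun n r =>
      (4 * n * m - r ^ 2) * c n r
        - (m * (2 * k - 1) / 6) * ∑' j : ℕ, e2Coeff j * c (n - j) r := by
  have h1 := hasJacobiFourierExpansion_iff.mp (h.heatOperator m)
  have h2 := hasJacobiFourierExpansion_iff.mp h.E2_mul
  rw [hasJacobiFourierExpansion_iff]
  intro p
  have := (h1 p).sub ((h2 p).mul_left (m * (2 * k - 1) / 6 : ℂ))
  rw [← mul_assoc] at this
  refine this.congr_fun fun nr => ?_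
  ring

theorem IsJacobiCuspForm.modifiedHeatOperator {k m : ℕ} {φ : ℍ × ℂ → ℂ}
    (h : IsJacobiCuspForm k m φ) : IsJacobiCuspForm (k + 2) m (modifiedHeatOperator k m φ) := by
  obtain ⟨c, hc, hc0⟩ := h.cusp
  have hf := hc.modifiedHeatOperator k m
  have hpos : ∀ n r : ℤ, (4 * (n : ℂ) * m - (r : ℂ) ^ 2) * c n r
        - (m * (2 * k - 1) / 6) * ∑' j : ℕ, e2Coeff j * c (n - j) r ≠ 0 →
      0 < 4 * n * m - r ^ 2 := by
    intro n r hnr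
    by_contra hD
    have hz : ∀ j : ℕ, c (n - j) r = 0 := by
      intro j
      by_contra hj
      have := hc0 _ _ hj
      have h2 : (0 : ℤ) ≤ 4 * j * m := by positivity
      nlinarith
    have hz0 := hz 0
    simp only [Nat.cast_zero, sub_zero] at hz0
    simp [hz, hz0] at hnr
  refine ⟨⟨hf.jacobiHolomorphic, fun g => ?_, _, hf, fun n r hnr => (hpos n r hnr).le⟩,
    _, hf, hpos⟩
  rw [← JacobiGroup.modifiedHeatOperator_slash hc.jacobiHolomorphic, h.slash_eq]

/-! ### Fourier series on the torus -/

/-- Lebesgue measure on the unit square. -/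
def unitSquare : Measure (ℝ × ℝ) :=
  (volume.restrict (Set.Ioc 0 1)).prod (volume.restrict (Set.Ioc 0 1))

instance : IsProbabilityMeasure (volume.restrict (Set.Ioc (0 : ℝ) 1)) := ⟨by simp⟩

instance : IsProbabilityMeasure unitSquare := by
  unfold unitSquare
  infer_instance

theorem unitSquare_eq :
    unitSquare = volume.restrict (Set.Ioc (0 : ℝ) 1 ×ˢ Set.Ioc (0 : ℝ) 1) := by
  rw [unitSquare, Measure.prod_restrict]
  rfl

theorem Continuous.integrable_unitSquare {E : Type*} [NormedAddCommGroup E] {f : ℝ × ℝ → E}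
    (hf : Continuous f) : Integrable f unitSquare := by
  rw [unitSquare_eq]
  exact (hf.continuousOn.integrableOn_compact (K := Set.Icc (0 : ℝ) 1 ×ˢ Set.Icc (0 : ℝ) 1)
    (isCompact_Icc.prod isCompact_Icc)).mono_set
    (Set.prod_mono Set.Ioc_subset_Icc_self Set.Ioc_subset_Icc_self)

theorem ae_unitSquare_mem : ∀ᵐ s ∂unitSquare, s ∈ Set.Ioc (0 : ℝ) 1 ×ˢ Set.Ioc (0 : ℝ) 1 := by
  rw [unitSquare_eq]
  exact ae_restrict_mem (measurableSet_Ioc.prod measurableSet_Ioc)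

/-- The character `(u, x) ↦ e(n u + r x)` of the torus. -/
def torusExp (n r : ℤ) (s : ℝ × ℝ) : ℂ :=
  Complex.exp (2 * Real.pi * Complex.I * (n * s.1 + r * s.2))

theorem continuous_torusExp (n r : ℤ) : Continuous (torusExp n r) := by
  unfold torusExp
  fun_prop

theorem norm_torusExp (n r : ℤ) (s : ℝ × ℝ) : ‖torusExp n r s‖ = 1 := by
  rw [torusExp, show 2 * (Real.pi : ℂ) * Complex.I * (n * s.1 + r * s.2) =
    ((2 * Real.pi * (n * s.1 + r * s.2) : ℝ) : ℂ) * Complex.I by push_cast; ring]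
  exact Complex.norm_exp_ofReal_mul_I _

theorem conj_torusExp (n r : ℤ) (s : ℝ × ℝ) : conj (torusExp n r s) = torusExp (-n) (-r) s := by
  rw [torusExp, ← Complex.exp_conj, torusExp]
  congr 1
  simp only [map_mul, map_add, Complex.conj_I, Complex.conj_ofReal, map_ofNat, map_intCast]
  push_cast
  ring

theorem torusExp_mul (n r n' r' : ℤ) (s : ℝ × ℝ) :
    torusExp n r s * torusExp n' r' s = torusExp (n + n') (r + r') s := by
  rw [torusExp, torusExp, torusExp, ← Complex.exp_add]
  congr 1
  push_cast
  ring

theorem torusExp_eq_mul (n r : ℤ) (s : ℝ × ℝ) :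
    torusExp n r s = Complex.exp (2 * Real.pi * Complex.I * n * s.1) *
      Complex.exp (2 * Real.pi * Complex.I * r * s.2) := by
  rw [torusExp, ← Complex.exp_add]
  congr 1
  ring

theorem integral_exp_two_pi_int (n : ℤ) :
    ∫ u : ℝ in Set.Ioc (0 : ℝ) 1, Complex.exp (2 * Real.pi * Complex.I * n * u) =
      if n = 0 then 1 else 0 := by
  rw [← intervalIntegral.integral_of_le zero_le_one]
  split_ifs with hn
  · simp [hn]
  · have hc : (2 * Real.pi * Complex.I * n : ℂ) ≠ 0 :=
      mul_ne_zero Complex.two_pi_I_ne_zero (by exact_mod_cast hn)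
    rw [integral_exp_mul_complex hc]
    have : Complex.exp (2 * Real.pi * Complex.I * n * (1 : ℝ)) = 1 := by
      rw [Complex.exp_eq_one_iff]
      exact ⟨n, by push_cast; ring⟩
    rw [this]
    simp

theorem integral_torusExp (n r : ℤ) :
    ∫ s, torusExp n r s ∂unitSquare = if n = 0 ∧ r = 0 then 1 else 0 := by
  simp only [torusExp_eq_mul, unitSquare]
  rw [integral_prod_mul (fun u : ℝ => Complex.exp (2 * Real.pi * Complex.I * n * u))
    (fun u : ℝ => Complex.exp (2 * Real.pi * Complex.I * r * u)), integral_exp_two_pi_int,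
    integral_exp_two_pi_int]
  by_cases hn : n = 0 <;> by_cases hr : r = 0 <;> simp [hn, hr]

/-- Fourier coefficients of an absolutely convergent trigonometric series. -/
theorem integral_mul_conj_torusExp {a : ℤ × ℤ → ℂ} {f : ℝ × ℝ → ℂ} (ha : Summable fun i => ‖a i‖)
    (hf : ∀ s, HasSum (fun i : ℤ × ℤ => a i * torusExp i.1 i.2 s) (f s)) (n r : ℤ) :
    ∫ s, f s * conj (torusExp n r s) ∂unitSquare = a (n, r) := by
  have h1 : ∀ s, HasSum (fun i : ℤ × ℤ => a i * torusExp (i.1 - n) (i.2 - r) s)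
      (f s * conj (torusExp n r s)) := by
    intro s
    refine ((hf s).mul_right _).congr_fun fun i => ?_
    rw [conj_torusExp, mul_assoc, torusExp_mul, sub_eq_add_neg, sub_eq_add_neg]
  have h2 := hasSum_integral_of_summable_integral_norm (μ := unitSquare)
    (F := fun (i : ℤ × ℤ) s => a i * torusExp (i.1 - n) (i.2 - r) s)
    (fun i => (continuous_const.mul (continuous_torusExp _ _)).integrable_unitSquare)
    (by simpa [norm_torusExp] using ha)
  simp only [(h1 _).tsum_eq] at h2
  refine h2.unique ?_
  have h3 : ∀ i : ℤ × ℤ, ∫ s, a i * torusExp (i.1 - n) (i.2 - r) s ∂unitSquare =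
      if i = (n, r) then a (n, r) else 0 := by
    rintro ⟨i, j⟩
    rw [integral_const_mul, integral_torusExp]
    by_cases h : i = n ∧ j = r
    · simp [h.1, h.2]
    · have h' : ¬ (i - n = 0 ∧ j - r = 0) := by rwa [sub_eq_zero, sub_eq_zero]
      rw [if_neg h', if_neg (by simpa using h), mul_zero]
  simp only [h3]
  exact hasSum_ite_eq (n, r) (a (n, r))

/-- Parseval's identity for absolutely convergent trigonometric series. -/
theorem hasSum_integral_mul_conj {a b : ℤ × ℤ → ℂ} {f g : ℝ × ℝ → ℂ}
    (ha : Summable fun i => ‖a i‖) (hb : Summable fun i => ‖b i‖)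
    (hf : ∀ s, HasSum (fun i : ℤ × ℤ => a i * torusExp i.1 i.2 s) (f s))
    (hg : ∀ s, HasSum (fun i : ℤ × ℤ => b i * torusExp i.1 i.2 s) (g s))
    (hfc : Continuous f) :
    HasSum (fun i => a i * conj (b i)) (∫ s, f s * conj (g s) ∂unitSquare) := by
  have hfb : ∀ s, ‖f s‖ ≤ ∑' i, ‖a i‖ := fun s => by
    rw [← (hf s).tsum_eq]
    refine (norm_tsum_le_tsum_norm ?_).trans_eq ?_ <;> simp [norm_torusExp, ha]
  have h1 : ∀ s, HasSum (fun i : ℤ × ℤ => conj (b i) * (f s * conj (torusExp i.1 i.2 s)))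
      (f s * conj (g s)) := by
    intro s
    refine (((Complex.hasSum_conj'.mpr (hg s))).mul_left (f s)).congr_fun fun i => ?_
    rw [map_mul]
    ring
  have h2 := hasSum_integral_of_summable_integral_norm (μ := unitSquare)
    (F := fun (i : ℤ × ℤ) s => conj (b i) * (f s * conj (torusExp i.1 i.2 s)))
    (fun i => (continuous_const.mul (hfc.mul
      (Complex.continuous_conj.comp (continuous_torusExp _ _)))).integrable_unitSquare) ?_
  · simp only [(h1 _).tsum_eq] at h2
    refine h2.congr_fun fun i => ?_
    rw [integral_const_mul, integral_mul_conj_torusExp ha hf, mul_comm]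
  · refine Summable.of_nonneg_of_le (fun i => integral_nonneg fun s => norm_nonneg _)
      (fun i => ?_) (hb.mul_right (∑' i, ‖a i‖))
    have : ∀ s, ‖conj (b i) * (f s * conj (torusExp i.1 i.2 s))‖ ≤ ‖b i‖ * ∑' i, ‖a i‖ := by
      intro s
      rw [norm_mul, norm_mul, RCLike.norm_conj, RCLike.norm_conj, norm_torusExp, mul_one]
      exact mul_le_mul_of_nonneg_left (hfb s) (norm_nonneg _)
    refine (integral_mono_of_nonneg (Filter.Eventually.of_forall fun s => norm_nonneg _)
      (integrable_const (‖b i‖ * ∑' i, ‖a i‖)) (Filter.Eventually.of_forall this)).trans_eq ?_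
    simp

/-- A continuous periodic function with summable Fourier coefficients is the sum of its Fourier
series. -/
theorem hasSum_fourier_of_summable {f : ℝ → ℂ} (hf : Continuous f) (hper : Function.Periodic f 1)
    (hs : Summable fun n : ℤ => ∫ u in Set.Ioc (0 : ℝ) 1,
      f u * Complex.exp (-(2 * Real.pi * Complex.I * n * u))) (u : ℝ) :
    HasSum (fun n : ℤ => (∫ u in Set.Ioc (0 : ℝ) 1,
      f u * Complex.exp (-(2 * Real.pi * Complex.I * n * u))) *
        Complex.exp (2 * Real.pi * Complex.I * n * u)) (f u) := by
  have : Fact ((0 : ℝ) < 1) := ⟨zero_lt_one⟩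
  let F : C(AddCircle (1 : ℝ), ℂ) := ⟨hper.lift, continuous_coinduced_dom.mpr hf⟩
  have hF : ∀ u : ℝ, F (u : AddCircle (1 : ℝ)) = f u := fun u => rfl
  have hc : ∀ n : ℤ, fourierCoeff F n = ∫ u in Set.Ioc (0 : ℝ) 1,
      f u * Complex.exp (-(2 * Real.pi * Complex.I * n * u)) := by
    intro n
    rw [fourierCoeff_eq_intervalIntegral _ n 0, zero_add, one_div, inv_one, one_smul,
      intervalIntegral.integral_of_le zero_le_one]
    refine integral_congr_ae (Filter.Eventually.of_forall fun u => ?_)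
    simp only [hF, fourier_coe_apply, smul_eq_mul]
    rw [mul_comm]
    congr 2
    push_cast
    ring
  have h := has_pointwise_sum_fourier_series_of_summable (f := F)
    (hs.congr fun n => (hc n).symm) (u : AddCircle (1 : ℝ))
  rw [hF] at h
  refine h.congr_fun fun n => ?_
  rw [hc, smul_eq_mul, fourier_coe_apply]
  congr 2
  push_cast
  ring

/-- A continuous doubly periodic function with summable Fourier coefficients is the sum of its
Fourier series. -/
theorem hasSum_torus_of_summable {f : ℝ × ℝ → ℂ} (hf : Continuous f)
    (hper1 : ∀ u x, f (u + 1, x) = f (u, x)) (hper2 : ∀ u x, f (u, x + 1) = f (u, x))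
    (hs : Summable fun i : ℤ × ℤ => ∫ s, f s * conj (torusExp i.1 i.2 s) ∂unitSquare)
    (s : ℝ × ℝ) :
    HasSum (fun i : ℤ × ℤ => (∫ s, f s * conj (torusExp i.1 i.2 s) ∂unitSquare) *
      torusExp i.1 i.2 s) (f s) := by
  set a : ℤ → ℤ → ℂ := fun n r => ∫ s, f s * conj (torusExp n r s) ∂unitSquare with ha
  set A : ℤ → ℝ → ℂ := fun r u => ∫ x in Set.Ioc (0 : ℝ) 1,
    f (u, x) * Complex.exp (-(2 * Real.pi * Complex.I * r * x)) with hA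
  have hsn : Summable fun i : ℤ × ℤ => ‖a i.1 i.2‖ := hs.norm
  have hAc : ∀ r, Continuous (A r) := by
    intro r
    have : A r = fun u => ∫ x in (0 : ℝ)..1,
        f (u, x) * Complex.exp (-(2 * Real.pi * Complex.I * r * x)) := by
      ext u
      rw [intervalIntegral.integral_of_le zero_le_one]
    rw [this]
    exact intervalIntegral.continuous_parametric_intervalIntegral_of_continuous' (by fun_prop) 0 1
  have hAp : ∀ r, Function.Periodic (A r) 1 := fun r u => by simp only [hA, hper1]
  have hAa : ∀ n r : ℤ, ∫ u in Set.Ioc (0 : ℝ) 1,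
      A r u * Complex.exp (-(2 * Real.pi * Complex.I * n * u)) = a n r := by
    intro n r
    have hi := (hf.mul (Complex.continuous_conj.comp
      (continuous_torusExp n r))).integrable_unitSquare
    rw [unitSquare] at hi
    rw [ha]
    simp only [unitSquare]
    have := integral_prod _ hi
    simp only [Pi.mul_apply, Function.comp] at this
    rw [this]
    refine integral_congr_ae (Filter.Eventually.of_forall fun u => ?_)
    simp only [hA]
    rw [← integral_mul_const]
    refine integral_congr_ae (Filter.Eventually.of_forall fun x => ?_)
    simp only [conj_torusExp]
    rw [torusExp_eq_mul, mul_assoc, mul_comm (Complex.exp _)]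
    congr 3 <;> push_cast <;> ring
  have hswap : Summable fun i : ℤ × ℤ => ‖a i.2 i.1‖ :=
    (Equiv.prodComm ℤ ℤ).summable_iff.mpr hsn
  have hAs : ∀ (r : ℤ) (u : ℝ), HasSum
      (fun n : ℤ => a n r * Complex.exp (2 * Real.pi * Complex.I * n * u)) (A r u) := by
    intro r u
    have := hasSum_fourier_of_summable (hAc r) (hAp r)
      (by simpa only [hAa] using (hswap.prod_factor r).of_norm) u
    simpa only [hAa] using this
  have hnorm : ∀ (n : ℤ) (u : ℝ), ‖Complex.exp (2 * Real.pi * Complex.I * n * u)‖ = 1 := by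
    intro n u
    simpa [torusExp, mul_assoc] using norm_torusExp n 0 (u, 0)
  obtain ⟨u, x⟩ := s
  have hAsum : Summable fun r : ℤ => A r u := by
    refine Summable.of_norm_bounded hswap.prod fun r => ?_
    rw [← (hAs r u).tsum_eq]
    refine (norm_tsum_le_tsum_norm ?_).trans_eq ?_
    · simpa [hnorm] using hswap.prod_factor r
    · simp [hnorm]
  have h1 := hasSum_fourier_of_summable (f := fun x => f (u, x)) (by fun_prop)
    (fun x => hper2 u x) hAsum x
  have h2 : Summable fun i : ℤ × ℤ => a i.1 i.2 * torusExp i.1 i.2 (u, x) :=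
    Summable.of_norm (by simpa [norm_torusExp] using hsn)
  have h3 := (Equiv.prodComm ℤ ℤ).hasSum_iff.mpr h2.hasSum
  have h4 := h3.prod_fiberwise (g := fun r => A r u *
    Complex.exp (2 * Real.pi * Complex.I * r * x)) (by
      intro r
      refine ((hAs r u).mul_right _).congr_fun fun n => ?_
      simp only [Function.comp, Equiv.prodComm_apply, Prod.swap_prod_mk, torusExp_eq_mul]
      ring)
  rw [h1.unique h4]
  exact h2.hasSum

/-- Horizontal shift of the contour for a periodic holomorphic function. -/
theorem integral_horizontal_eq {f : ℂ → ℂ} {a b : ℝ}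
    (hf : DifferentiableOn ℂ f {z | z.im ∈ Set.uIcc a b})
    (hper : ∀ z, z.im ∈ Set.uIcc a b → f (z + 1) = f z) :
    ∫ x : ℝ in Set.Ioc (0 : ℝ) 1, f (x + a * Complex.I) =
      ∫ x : ℝ in Set.Ioc (0 : ℝ) 1, f (x + b * Complex.I) := by
  have h := Complex.integral_boundary_rect_eq_zero_of_differentiableOn f (a * Complex.I)
    (1 + b * Complex.I) (hf.mono fun z hz => by
      have := hz.2
      simpa using this)
  have h2 : ∫ y : ℝ in a..b, f (1 + y * Complex.I) = ∫ y : ℝ in a..b, f (y * Complex.I) := by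
    refine intervalIntegral.integral_congr fun y hy => ?_
    rw [add_comm]
    exact hper _ (by simpa using hy)
  simp at h
  rw [h2, add_sub_cancel_right, sub_eq_zero] at h
  rw [← intervalIntegral.integral_of_le zero_le_one, ← intervalIntegral.integral_of_le zero_le_one]
  exact h

/-! ### Fourier coefficients of Jacobi forms -/

/-- The point `(u + i v, x + i y)`, where `s = (u, x)`; meaningful for `v > 0`. -/
def jacobiPt (v y : ℝ) (s : ℝ × ℝ) : ℍ × ℂ :=
  (ofComplex (s.1 + v * Complex.I), s.2 + y * Complex.I)

section
variable {v : ℝ} (hv : 0 < v) (y : ℝ)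
include hv

theorem coe_jacobiPt_fst (s : ℝ × ℝ) : ((jacobiPt v y s).1 : ℂ) = s.1 + v * Complex.I := by
  rw [jacobiPt, ofComplex_apply_of_im_pos (by simpa using hv)]

theorem jacobiPt_im (s : ℝ × ℝ) : (jacobiPt v y s).1.im = v := by
  rw [← UpperHalfPlane.coe_im, coe_jacobiPt_fst hv]
  simp

omit hv in
theorem jacobiPt_snd_im (s : ℝ × ℝ) : (jacobiPt v y s).2.im = y := by
  simp [jacobiPt]

theorem jacobiAlpha_jacobiPt (s : ℝ × ℝ) : jacobiAlpha (jacobiPt v y s) = y / v := by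
  rw [jacobiAlpha, jacobiPt_im hv, jacobiPt_snd_im]

theorem jacobiExp_jacobiPt (n r : ℤ) (s : ℝ × ℝ) : jacobiExp n r (jacobiPt v y s) =
    (Real.exp (-2 * Real.pi * (n * v + r * y)) : ℂ) * torusExp n r s := by
  rw [jacobiExp, coe_jacobiPt_fst hv, torusExp, Complex.ofReal_exp, ← Complex.exp_add]
  congr 1
  simp only [jacobiPt]
  push_cast
  linear_combination (2 * Real.pi * (n * v + r * y) : ℂ) * Complex.I_sq

theorem continuous_jacobiPt : Continuous (jacobiPt v y) := by
  have h1 : Continuous fun s : ℝ × ℝ => (s.1 + v * Complex.I : ℂ) := by fun_prop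
  have h2 : Continuous fun s : ℝ × ℝ => ofComplex (s.1 + v * Complex.I) := by
    rw [continuous_iff_continuousAt]
    intro s
    have h := (contMDiffAt_ofComplex (n := 0) (z := s.1 + v * Complex.I)
      (by simpa using hv)).continuousAt
    exact ContinuousAt.comp (f := fun s : ℝ × ℝ => (s.1 + v * Complex.I : ℂ)) h h1.continuousAt
  unfold jacobiPt
  fun_prop

end

theorem eq_jacobiPt (p : ℍ × ℂ) : p = jacobiPt p.1.im p.2.im (p.1.re, p.2.re) := by
  refine Prod.ext (UpperHalfPlane.ext ?_) (Complex.re_add_im _).symm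
  rw [coe_jacobiPt_fst p.1.im_pos]
  exact (Complex.re_add_im _).symm

namespace HasJacobiFourierExpansion

variable {φ : ℍ × ℂ → ℂ} {c : ℤ → ℤ → ℂ}

theorem hasSum_jacobiPt (h : HasJacobiFourierExpansion φ c) {v : ℝ} (hv : 0 < v) (y : ℝ)
    (s : ℝ × ℝ) :
    HasSum (fun i : ℤ × ℤ => c i.1 i.2 *
      (Real.exp (-2 * Real.pi * (i.1 * v + i.2 * y)) : ℂ) * torusExp i.1 i.2 s)
      (φ (jacobiPt v y s)) := by
  refine (hasJacobiFourierExpansion_iff.mp h _).congr_fun fun i => ?_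
  rw [jacobiExp_jacobiPt hv, mul_assoc]

theorem summable_norm' (h : HasJacobiFourierExpansion φ c) {v : ℝ} (hv : 0 < v) (y : ℝ) :
    Summable fun i : ℤ × ℤ => ‖c i.1 i.2 *
      (Real.exp (-2 * Real.pi * (i.1 * v + i.2 * y)) : ℂ)‖ := by
  refine (h.summable_norm hv y).congr fun i => ?_
  rw [norm_mul, Complex.norm_real, Real.norm_of_nonneg (Real.exp_pos _).le]

theorem coeff_eq_integral (h : HasJacobiFourierExpansion φ c) {v : ℝ} (hv : 0 < v) (y : ℝ)
    (n r : ℤ) :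
    c n r * (Real.exp (-2 * Real.pi * (n * v + r * y)) : ℂ) =
      ∫ s, φ (jacobiPt v y s) * conj (torusExp n r s) ∂unitSquare :=
  (integral_mul_conj_torusExp (h.summable_norm' hv y) (h.hasSum_jacobiPt hv y) n r).symm

theorem unique {c' : ℤ → ℤ → ℂ} (h : HasJacobiFourierExpansion φ c)
    (h' : HasJacobiFourierExpansion φ c') : c = c' := by
  ext n r
  have h1 := h.coeff_eq_integral one_pos 0 n r
  rw [← h'.coeff_eq_integral one_pos 0 n r] at h1
  exact mul_right_cancel₀ (by exact_mod_cast (Real.exp_pos _).ne') h1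

theorem norm_coeff_le (h : HasJacobiFourierExpansion φ c) {v : ℝ} (hv : 0 < v) (y : ℝ) {B : ℝ}
    (hB : ∀ s ∈ Set.Ioc (0 : ℝ) 1 ×ˢ Set.Ioc (0 : ℝ) 1, ‖φ (jacobiPt v y s)‖ ≤ B) (n r : ℤ) :
    ‖c n r‖ ≤ B * Real.exp (2 * Real.pi * (n * v + r * y)) := by
  have h1 := norm_integral_le_of_norm_le_const (μ := unitSquare)
    (f := fun s => φ (jacobiPt v y s) * conj (torusExp n r s)) (C := B) (by
      filter_upwards [ae_unitSquare_mem] with s hs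
      rw [norm_mul, RCLike.norm_conj, norm_torusExp, mul_one]
      exact hB s hs)
  rw [← h.coeff_eq_integral hv, norm_mul, Complex.norm_real,
    Real.norm_of_nonneg (Real.exp_pos _).le, probReal_univ, mul_one,
    show -2 * Real.pi * (n * v + r * y) = -(2 * Real.pi * (n * v + r * y)) by ring,
    Real.exp_neg, ← div_eq_mul_inv, div_le_iff₀ (Real.exp_pos _)] at h1
  exact h1

end HasJacobiFourierExpansion

/-- The Fourier coefficients of a periodic holomorphic function, normalized so as not to depend
on `v` and `y`. -/
theorem JacobiHolomorphic.integral_independent {φ : ℍ × ℂ → ℂ} (hφ : JacobiHolomorphic φ)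
    (h1 : ∀ (τ : ℍ) z, φ ((1 : ℝ) +ᵥ τ, z) = φ (τ, z)) (h2 : ∀ (τ : ℍ) z, φ (τ, z + 1) = φ (τ, z))
    {v v' : ℝ} (hv : 0 < v) (hv' : 0 < v') (y y' : ℝ) (n r : ℤ) :
    (∫ s, φ (jacobiPt v y s) * conj (torusExp n r s) ∂unitSquare) *
        (Real.exp (2 * Real.pi * (n * v + r * y)) : ℂ) =
      (∫ s, φ (jacobiPt v' y' s) * conj (torusExp n r s) ∂unitSquare) *
        (Real.exp (2 * Real.pi * (n * v' + r * y')) : ℂ) := by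
  set ψ : ℍ × ℂ → ℂ := fun p => φ p * jacobiExp (-n) (-r) p with hψ
  have hψh : JacobiHolomorphic ψ :=
    DifferentiableOn.fun_mul hφ (jacobiHolomorphic_jacobiExp (-n) (-r))
  have hexp1 : ∀ (τ : ℍ) z, jacobiExp (-n) (-r) ((1 : ℝ) +ᵥ τ, z) = jacobiExp (-n) (-r) (τ, z) := by
    intro τ z
    rw [jacobiExp, jacobiExp, Complex.exp_eq_exp_iff_exists_int]
    exact ⟨-n, by simp; ring⟩
  have hexp2 : ∀ (τ : ℍ) z, jacobiExp (-n) (-r) (τ, z + 1) = jacobiExp (-n) (-r) (τ, z) := by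
    intro τ z
    rw [jacobiExp, jacobiExp, Complex.exp_eq_exp_iff_exists_int]
    exact ⟨-r, by push_cast; ring⟩
  have hψ1 : ∀ (τ : ℍ) z, ψ ((1 : ℝ) +ᵥ τ, z) = ψ (τ, z) := fun τ z => by
    simp only [hψ, h1, hexp1]
  have hψ2 : ∀ (τ : ℍ) z, ψ (τ, z + 1) = ψ (τ, z) := fun τ z => by
    simp only [hψ, h2, hexp2]
  have key : ∀ {v : ℝ} (_ : 0 < v) (y : ℝ),
      (∫ s, φ (jacobiPt v y s) * conj (torusExp n r s) ∂unitSquare) *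
        (Real.exp (2 * Real.pi * (n * v + r * y)) : ℂ) =
      ∫ s, ψ (jacobiPt v y s) ∂unitSquare := by
    intro v hv y
    rw [← integral_mul_const]
    refine integral_congr_ae (Filter.Eventually.of_forall fun s => ?_)
    simp only [hψ, jacobiExp_jacobiPt hv, conj_torusExp]
    push_cast
    rw [show (-2 * Real.pi * (-n * v + -r * y) : ℂ) = 2 * Real.pi * (n * v + r * y) by ring]
    ring
  rw [key hv, key hv']
  have hint : ∀ {v : ℝ} (_ : 0 < v) (y : ℝ), Integrable (fun s => ψ (jacobiPt v y s))
      ((volume.restrict (Set.Ioc (0 : ℝ) 1)).prod (volume.restrict (Set.Ioc (0 : ℝ) 1))) :=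
    fun hv y => (hψh.continuous.comp (continuous_jacobiPt hv y)).integrable_unitSquare
  -- shift in `z`, then shift in `τ`
  have sz : ∫ s, ψ (jacobiPt v y s) ∂unitSquare = ∫ s, ψ (jacobiPt v y' s) ∂unitSquare := by
    rw [unitSquare, integral_prod _ (hint hv y), integral_prod _ (hint hv y')]
    refine integral_congr_ae (Filter.Eventually.of_forall fun u => ?_)
    exact integral_horizontal_eq (f := fun z => ψ (ofComplex (u + v * Complex.I), z))
      (hψh.differentiable_snd _).differentiableOn (fun z _ => hψ2 _ z)
  have st : ∫ s, ψ (jacobiPt v y' s) ∂unitSquare = ∫ s, ψ (jacobiPt v' y' s) ∂unitSquare := by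
    rw [unitSquare, integral_prod_symm _ (hint hv y'), integral_prod_symm _ (hint hv' y')]
    refine integral_congr_ae (Filter.Eventually.of_forall fun x => ?_)
    have hpos : ∀ z : ℂ, z.im ∈ Set.uIcc v v' → 0 < z.im := fun z hz =>
      (lt_min hv hv').trans_le hz.1
    refine integral_horizontal_eq (f := fun t => ψ (ofComplex t, x + y' * Complex.I)) ?_ ?_
    · intro t ht
      have h3 := DifferentiableOn.differentiableAt hψh
        (isOpen_im_fst_pos.mem_nhds (x := ((t, x + y' * Complex.I) : ℂ × ℂ)) (hpos t ht))
      have h4 : DifferentiableAt ℂ (fun t : ℂ => ((t, x + y' * Complex.I) : ℂ × ℂ)) t := by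
        fun_prop
      exact (DifferentiableAt.comp (f := fun t : ℂ => ((t, x + y' * Complex.I) : ℂ × ℂ)) t h3
        h4).differentiableWithinAt
    · intro t ht
      have h0 := hpos t ht
      refine Eq.trans ?_ (hψ1 _ _)
      congr 2
      apply UpperHalfPlane.ext
      rw [ofComplex_apply_of_im_pos (by simpa using h0), UpperHalfPlane.coe_vadd,
        ofComplex_apply_of_im_pos h0]
      change t + 1 = ((1 : ℝ) : ℂ) + t
      push_cast
      ring
  rw [sz, st]

/-- A holomorphic function on `ℍ × ℂ` that is periodic in `τ` and `z` has a Fourier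
expansion. -/
theorem JacobiHolomorphic.exists_fourierExpansion {φ : ℍ × ℂ → ℂ} (hφ : JacobiHolomorphic φ)
    (h1 : ∀ (τ : ℍ) z, φ ((1 : ℝ) +ᵥ τ, z) = φ (τ, z))
    (h2 : ∀ (τ : ℍ) z, φ (τ, z + 1) = φ (τ, z)) :
    ∃ c, HasJacobiFourierExpansion φ c := by
  set c : ℤ → ℤ → ℂ := fun n r =>
    (∫ s, φ (jacobiPt 1 0 s) * conj (torusExp n r s) ∂unitSquare) *
        (Real.exp (2 * Real.pi * (n * (1 : ℝ) + r * (0 : ℝ))) : ℂ) with hc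
  have hcoef : ∀ {v : ℝ} (_ : 0 < v) (y : ℝ) (n r : ℤ),
      ∫ s, φ (jacobiPt v y s) * conj (torusExp n r s) ∂unitSquare =
        c n r * (Real.exp (-2 * Real.pi * (n * v + r * y)) : ℂ) := by
    intro v hv y n r
    rw [hc]
    simp only
    rw [← hφ.integral_independent h1 h2 hv one_pos y 0 n r, mul_assoc, ← Complex.ofReal_mul,
      ← Real.exp_add]
    simp
  have hbound : ∀ {v : ℝ} (_ : 0 < v) (y : ℝ), ∃ B : ℝ, ∀ n r : ℤ,
      ‖c n r‖ * Real.exp (-(2 * Real.pi * n * v + 2 * Real.pi * r * y)) ≤ B := by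
    intro v hv y
    obtain ⟨B, hB⟩ := (isCompact_Icc.prod isCompact_Icc :
      IsCompact (Set.Icc (0 : ℝ) 1 ×ˢ Set.Icc (0 : ℝ) 1)).exists_bound_of_continuousOn
      (hφ.continuous.comp (continuous_jacobiPt hv y)).continuousOn
    refine ⟨B, fun n r => ?_⟩
    have h3 := norm_integral_le_of_norm_le_const (μ := unitSquare)
      (f := fun s => φ (jacobiPt v y s) * conj (torusExp n r s)) (C := B) (by
        filter_upwards [ae_unitSquare_mem] with s hs
        rw [norm_mul, RCLike.norm_conj, norm_torusExp, mul_one]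
        exact hB s (Set.prod_mono Set.Ioc_subset_Icc_self Set.Ioc_subset_Icc_self hs))
    rw [hcoef hv, norm_mul, Complex.norm_real, Real.norm_of_nonneg (Real.exp_pos _).le,
      probReal_univ, mul_one] at h3
    refine le_trans (le_of_eq ?_) h3
    congr 2
    ring
  refine ⟨c, hasJacobiFourierExpansion_iff.mpr fun p => ?_⟩
  have hv := p.1.im_pos
  have hsum : Summable fun i : ℤ × ℤ => c i.1 i.2 *
      (Real.exp (-2 * Real.pi * (i.1 * p.1.im + i.2 * p.2.im)) : ℂ) := by
    set δ := p.1.im / 2 with hδ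
    have hδ0 : 0 < δ := by positivity
    obtain ⟨B1, hB1⟩ := hbound (v := p.1.im - δ) (by linarith) (p.2.im - δ)
    obtain ⟨B2, hB2⟩ := hbound (v := p.1.im - δ) (by linarith) (p.2.im + δ)
    obtain ⟨B3, hB3⟩ := hbound (v := p.1.im + δ) (by linarith) (p.2.im - δ)
    obtain ⟨B4, hB4⟩ := hbound (v := p.1.im + δ) (by linarith) (p.2.im + δ)
    have hg : Summable fun n : ℤ => Real.exp (-(2 * Real.pi * δ)) ^ n.natAbs := by
      have := summable_geometric_of_lt_one (Real.exp_pos _).le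
        ((Real.exp_lt_one_iff (x := -(2 * Real.pi * δ))).mpr (by
          have := Real.pi_pos
          have := mul_pos this hδ0
          linarith))
      exact Summable.of_nat_of_neg (by simpa using this) (by simpa using this)
    have hgg := (hg.mul_of_nonneg hg (fun _ => by positivity) (fun _ => by positivity)).mul_left
      (B1 + B2 + (B3 + B4))
    refine Summable.of_norm_bounded hgg ?_
    rintro ⟨n, r⟩
    -- shifting the height by `± δ` according to the signs of `n` and `r` gains `e^{-2πδ(|n|+|r|)}`
    have hsign : ∀ n : ℤ, ∃ e : ℝ, (e = δ ∨ e = -δ) ∧ (n : ℝ) * e = -(δ * n.natAbs) := by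
      intro n
      rcases le_total 0 n with hn | hn
      · refine ⟨-δ, Or.inr rfl, ?_⟩
        rw [Nat.cast_natAbs, abs_of_nonneg hn]
        ring
      · refine ⟨δ, Or.inl rfl, ?_⟩
        rw [Nat.cast_natAbs, abs_of_nonpos hn]
        push_cast
        ring
    obtain ⟨e, he, hne⟩ := hsign n
    obtain ⟨e', he', hre⟩ := hsign r
    have hBnn : ∀ {v y B : ℝ}, (∀ n r : ℤ,
        ‖c n r‖ * Real.exp (-(2 * Real.pi * n * v + 2 * Real.pi * r * y)) ≤ B) → 0 ≤ B :=
      fun h => le_trans (by positivity) (h 0 0)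
    have h1' := hBnn hB1
    have h2' := hBnn hB2
    have h3' := hBnn hB3
    have h4' := hBnn hB4
    have hmain : ‖c n r‖ * Real.exp (-(2 * Real.pi * n * (p.1.im + e) +
        2 * Real.pi * r * (p.2.im + e'))) ≤ B1 + B2 + (B3 + B4) := by
      rcases he with rfl | rfl <;> rcases he' with rfl | rfl
      · linarith [hB4 n r]
      · rw [← sub_eq_add_neg]
        linarith [hB3 n r]
      · rw [← sub_eq_add_neg]
        linarith [hB2 n r]
      · rw [← sub_eq_add_neg, ← sub_eq_add_neg]
        linarith [hB1 n r]
    rw [norm_mul, Complex.norm_real, Real.norm_of_nonneg (Real.exp_pos _).le]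
    have hexp : Real.exp (-2 * Real.pi * (n * p.1.im + r * p.2.im)) =
        Real.exp (-(2 * Real.pi * n * (p.1.im + e) + 2 * Real.pi * r * (p.2.im + e'))) *
        (Real.exp (-(2 * Real.pi * δ)) ^ n.natAbs * Real.exp (-(2 * Real.pi * δ)) ^ r.natAbs) := by
      rw [← Real.exp_nat_mul, ← Real.exp_nat_mul, ← Real.exp_add, ← Real.exp_add]
      congr 1
      linear_combination (2 * Real.pi) * hne + (2 * Real.pi) * hre
    simp only
    rw [hexp, ← mul_assoc]
    gcongr
  have h5 := hasSum_torus_of_summable (f := fun s => φ (jacobiPt p.1.im p.2.im s))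
    (hφ.continuous.comp (continuous_jacobiPt hv _)) ?_ ?_
    (by simpa only [hcoef hv] using hsum) (p.1.re, p.2.re)
  · rw [← eq_jacobiPt p] at h5
    refine h5.congr_fun fun i => ?_
    conv_lhs => rw [eq_jacobiPt p]
    rw [jacobiExp_jacobiPt hv, hcoef hv]
    ring
  · intro u x
    rw [jacobiPt, jacobiPt]
    refine Eq.trans ?_ (h1 _ _)
    congr 2
    apply UpperHalfPlane.ext
    rw [ofComplex_apply_of_im_pos (by simpa using hv), UpperHalfPlane.coe_vadd,
      ofComplex_apply_of_im_pos (by simpa using hv)]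
    push_cast
    ring
  · intro u x
    rw [jacobiPt, jacobiPt]
    refine Eq.trans ?_ (h2 _ _)
    congr 2
    push_cast
    ring

/-! ### The invariant measure -/

instance : Countable JacobiGroup := by
  have h1 : Countable (SL(2, ℤ)) := by
    unfold Matrix.SpecialLinearGroup Matrix
    infer_instance
  refine Function.Injective.countable (f := fun g : JacobiGroup => (g.mat, g.lam, g.mu)) ?_
  intro g h hgh
  simp only [Prod.mk.injEq] at hgh
  exact JacobiGroup.ext hgh.1 hgh.2.1 hgh.2.2

theorem JacobiGroup.continuous_den (g : JacobiGroup) : Continuous g.den := by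
  unfold JacobiGroup.den
  fun_prop

theorem JacobiGroup.continuous_smul_fst (g : JacobiGroup) :
    Continuous fun τ : ℍ => g.mat • τ := by
  rw [UpperHalfPlane.isEmbedding_coe.continuous_iff]
  have : (UpperHalfPlane.coe ∘ fun τ : ℍ => g.mat • τ) =
      fun τ : ℍ => ((g.mat 0 0 : ℂ) * τ + (g.mat 0 1 : ℂ)) / g.den τ :=
    funext fun τ => JacobiGroup.coe_mat_smul g τ
  rw [this]
  exact Continuous.div (by fun_prop) g.continuous_den (JacobiGroup.den_ne_zero g)

theorem JacobiGroup.continuous_smul (g : JacobiGroup) :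
    Continuous fun p : ℍ × ℂ => g • p := by
  refine Continuous.prodMk (g.continuous_smul_fst.comp continuous_fst) ?_
  exact Continuous.div (by fun_prop) (g.continuous_den.comp continuous_fst)
    fun p => JacobiGroup.den_ne_zero g p.1

instance : MeasurableConstSMul JacobiGroup (ℍ × ℂ) :=
  ⟨fun g => g.continuous_smul.measurable⟩

theorem lintegral_comp_add_div (f : ℂ → ENNReal) {δ : ℂ} (hδ : δ ≠ 0) (b : ℂ)
    (hf : Measurable f) :
    ∫⁻ z, f ((z + b) / δ) = ENNReal.ofReal (‖δ‖ ^ 2) * ∫⁻ z, f z := by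
  rw [lintegral_add_right_eq_self (fun z => f (z / δ))]
  have hdet : LinearMap.det (Algebra.lmul ℝ ℂ δ⁻¹) = Complex.normSq δ⁻¹ :=
    Algebra.norm_complex_apply δ⁻¹
  have hdet0 : LinearMap.det (Algebra.lmul ℝ ℂ δ⁻¹) ≠ 0 := by
    rw [hdet]
    simpa using hδ
  have h := Measure.map_linearMap_addHaar_eq_smul_addHaar (volume : Measure ℂ) hdet0
  have hm : Measurable (Algebra.lmul ℝ ℂ δ⁻¹) := by
    change Measurable fun z : ℂ => δ⁻¹ * z
    fun_prop
  have h2 := lintegral_map (μ := (volume : Measure ℂ)) hf hm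
  rw [h, lintegral_smul_measure, hdet] at h2
  have e : ∀ z : ℂ, z / δ = Algebra.lmul ℝ ℂ δ⁻¹ z := fun z => by
    rw [div_eq_inv_mul]; rfl
  simp only [e, ← h2, smul_eq_mul]
  congr 2
  rw [map_inv₀, inv_inv, Complex.normSq_eq_norm_sq, abs_of_nonneg (by positivity)]

theorem lintegral_jacobiMeasure {f : ℍ × ℂ → ENNReal} (hf : Measurable f) :
    ∫⁻ p, f p ∂jacobiMeasure = ∫⁻ τ : ℍ, ENNReal.ofReal (1 / τ.im) * ∫⁻ z : ℂ, f (τ, z) := by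
  have hw : Measurable fun p : ℍ × ℂ => ENNReal.ofReal (1 / p.1.im) := by
    have := UpperHalfPlane.continuous_im.measurable
    fun_prop
  rw [jacobiMeasure, lintegral_withDensity_eq_lintegral_mul _ hw hf,
    lintegral_prod _ (hw.mul hf).aemeasurable]
  refine lintegral_congr fun τ => ?_
  simp only [Pi.mul_apply]
  rw [lintegral_const_mul _ (by fun_prop)]

theorem lintegral_mat_smul (g : JacobiGroup) (f : ℍ → ENNReal) (hf : Measurable f) :
    ∫⁻ τ : ℍ, f (g.mat • τ) = ∫⁻ τ : ℍ, f τ := by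
  have h := measurePreserving_smul (Matrix.SpecialLinearGroup.toGL
    ((Matrix.SpecialLinearGroup.map (Int.castRingHom ℝ)) g.mat)) (volume : Measure ℍ)
  exact h.lintegral_comp hf

instance : SMulInvariantMeasure JacobiGroup (ℍ × ℂ) jacobiMeasure := by
  refine ((smulInvariantMeasure_tfae JacobiGroup jacobiMeasure).out 5 0).mp fun g => ?_
  refine Measure.ext_of_lintegral _ fun f hf => ?_
  rw [lintegral_map hf (measurable_const_smul g), lintegral_jacobiMeasure hf,
    lintegral_jacobiMeasure (f := fun p => f (g • p)) (hf.comp (measurable_const_smul g))]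
  refine Eq.trans ?_ (lintegral_mat_smul g (fun τ => ENNReal.ofReal (1 / τ.im) *
    ∫⁻ z : ℂ, f (τ, z)) ?_)
  · refine lintegral_congr fun τ => ?_
    have h0 := JacobiGroup.den_ne_zero g τ
    have h1 : ∀ z : ℂ, g • (τ, z) = (g.mat • τ, (z + (g.lam * (τ : ℂ) + g.mu)) / g.den τ) :=
      fun z => by rw [JacobiGroup.smul_def, add_assoc]
    simp only [h1]
    rw [lintegral_comp_add_div (fun z => f (g.mat • τ, z)) h0 _ (by fun_prop), ← mul_assoc,
      ← ENNReal.ofReal_mul (by have := τ.im_pos; positivity)]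
    have him := JacobiGroup.im_smul g (τ, 0)
    rw [JacobiGroup.smul_fst] at him
    simp only at him
    rw [him]
    congr 2
    have := τ.im_pos.ne'
    have := norm_ne_zero_iff.mpr h0
    field_simp
  · have := UpperHalfPlane.continuous_im.measurable
    exact Measurable.mul (by fun_prop) hf.lintegral_prod_right'

/-! ### Integration over the strip -/

theorem lintegral_upperHalfPlane {H : ℝ × ℝ → ENNReal} (hH : Measurable H) :
    ∫⁻ τ : ℍ, H (τ.re, τ.im) =
      ∫⁻ v in Set.Ioi (0 : ℝ), ∫⁻ u, ENNReal.ofReal (1 / v ^ 2) * H (u, v) := by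
  have hmi : Measurable UpperHalfPlane.im := UpperHalfPlane.continuous_im.measurable
  have hmr : Measurable UpperHalfPlane.re := UpperHalfPlane.continuous_re.measurable
  have hw : Measurable fun z : ℍ =>
      ((((1 / NNReal.mk z.im z.im_pos.le : NNReal) ^ 2 : NNReal)) : ENNReal) := by
    have : Measurable fun z : ℍ => NNReal.mk z.im z.im_pos.le := hmi.subtype_mk
    fun_prop
  rw [UpperHalfPlane.volume_def, lintegral_withDensity_eq_lintegral_mul _ hw (by fun_prop)]
  set K : ℂ → ENNReal := fun t => ENNReal.ofReal (1 / t.im ^ 2) * H (t.re, t.im) with hK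
  have hmp : MeasurePreserving UpperHalfPlane.coe (volume.comap UpperHalfPlane.coe)
      ((volume : Measure ℂ).restrict (Set.range UpperHalfPlane.coe)) :=
    ⟨measurable_coe, by rw [measurableEmbedding_coe.map_comap]⟩
  have h1 : ∀ τ : ℍ, ((fun z : ℍ => ((((1 / NNReal.mk z.im z.im_pos.le : NNReal) ^ 2 : NNReal)) :
      ENNReal)) * fun τ : ℍ => H (τ.re, τ.im)) τ = K τ := by
    intro τ
    simp only [Pi.mul_apply, hK, UpperHalfPlane.coe_re, UpperHalfPlane.coe_im]
    congr 1
    rw [ENNReal.ofReal]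
    congr 1
    ext
    rw [Real.coe_toNNReal _ (by positivity)]
    push_cast
    rw [one_div, one_div, inv_pow]
  rw [lintegral_congr h1, hmp.lintegral_comp_emb measurableEmbedding_coe K]
  have hr : Set.range UpperHalfPlane.coe = Complex.measurableEquivRealProd ⁻¹'
      (Set.univ ×ˢ Set.Ioi (0 : ℝ)) := by
    ext t
    constructor
    · rintro ⟨τ, rfl⟩
      simpa using τ.im_pos
    · intro ht
      have ht' : 0 < t.im := by simpa using ht
      exact ⟨⟨t, ht'⟩, rfl⟩
  have hmeas : MeasurableSet (Set.univ ×ˢ Set.Ioi (0 : ℝ) : Set (ℝ × ℝ)) :=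
    MeasurableSet.univ.prod measurableSet_Ioi
  have h2 := Complex.volume_preserving_equiv_real_prod.restrict_preimage hmeas
  rw [hr]
  have h3 := h2.lintegral_comp_emb Complex.measurableEquivRealProd.measurableEmbedding
    (fun w => ENNReal.ofReal (1 / w.2 ^ 2) * H w)
  refine Eq.trans (lintegral_congr fun t => ?_) (h3.trans ?_)
  · rfl
  · rw [Measure.volume_eq_prod, ← Measure.prod_restrict, Measure.restrict_univ,
      lintegral_prod_symm _ (by fun_prop)]

/-- The strip `0 < u ≤ 1`, `0 < x ≤ 1`, a strict fundamental domain for the translations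
`(τ, z) ↦ (τ + n, z + μ)`. -/
def jacobiStrip : Set (ℍ × ℂ) :=
  {p | p.1.re ∈ Set.Ioc (0 : ℝ) 1 ∧ p.2.re ∈ Set.Ioc (0 : ℝ) 1}

theorem measurable_jacobiCoord :
    Measurable fun p : ℍ × ℂ => ((p.1.im, p.2.im), (p.1.re, p.2.re)) := by
  have h1 := UpperHalfPlane.continuous_im
  have h2 := UpperHalfPlane.continuous_re
  have h3 := Complex.continuous_im
  have h4 := Complex.continuous_re
  exact Continuous.measurable (by fun_prop)

theorem measurableSet_jacobiStrip : MeasurableSet jacobiStrip :=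
  (measurable_jacobiCoord.snd.fst measurableSet_Ioc).inter
    (measurable_jacobiCoord.snd.snd measurableSet_Ioc)

/-- The measure `dv dy / v ^ 3` on `(0, ∞) × ℝ`. -/
def jacobiHeightMeasure : Measure (ℝ × ℝ) :=
  ((volume.restrict (Set.Ioi (0 : ℝ))).prod volume).withDensity
    fun w => ENNReal.ofReal (1 / w.1 ^ 3)

instance : SFinite jacobiHeightMeasure := by
  unfold jacobiHeightMeasure
  infer_instance

theorem ae_jacobiHeightMeasure_pos : ∀ᵐ w ∂jacobiHeightMeasure, 0 < w.1 := by
  refine (withDensity_absolutelyContinuous _ _).ae_le ?_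
  have h : ∀ᵐ v ∂(volume.restrict (Set.Ioi (0 : ℝ))), 0 < v := ae_restrict_mem measurableSet_Ioi
  exact Measure.quasiMeasurePreserving_fst.ae h

theorem lintegral_jacobiHeightMeasure {f : ℝ × ℝ → ENNReal} (hf : Measurable f) :
    ∫⁻ w, f w ∂jacobiHeightMeasure =
      ∫⁻ v in Set.Ioi (0 : ℝ), ∫⁻ y, ENNReal.ofReal (1 / v ^ 3) * f (v, y) := by
  rw [jacobiHeightMeasure, lintegral_withDensity_eq_lintegral_mul _ (by fun_prop) hf,
    lintegral_prod _ (by fun_prop)]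
  rfl

/-- On the strip the invariant measure is the product of `dv dy / v ^ 3` and `du dx`. -/
theorem measurePreserving_jacobiCoord :
    MeasurePreserving (fun p : ℍ × ℂ => ((p.1.im, p.2.im), (p.1.re, p.2.re)))
      (jacobiMeasure.restrict jacobiStrip) (jacobiHeightMeasure.prod unitSquare) := by
  refine ⟨measurable_jacobiCoord, Measure.ext_of_lintegral _ fun f hf => ?_⟩
  rw [lintegral_map hf measurable_jacobiCoord, ← lintegral_indicator measurableSet_jacobiStrip,
    lintegral_jacobiMeasure (f := jacobiStrip.indicator fun p : ℍ × ℂ =>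
      f ((p.1.im, p.2.im), (p.1.re, p.2.re))) ((hf.comp measurable_jacobiCoord).indicator
      measurableSet_jacobiStrip), lintegral_prod _ hf.aemeasurable,
    lintegral_jacobiHeightMeasure hf.lintegral_prod_right']
  set H : ℝ × ℝ → ENNReal := fun w => ENNReal.ofReal (1 / w.2) *
    ((Set.Ioc (0 : ℝ) 1).indicator (fun u => ∫⁻ y, ∫⁻ x in Set.Ioc (0 : ℝ) 1,
      f ((w.2, y), (u, x))) w.1) with hH
  have hHm : Measurable H := by
    have h1 : Measurable fun w : ℝ × ℝ => ∫⁻ y, ∫⁻ x in Set.Ioc (0 : ℝ) 1,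
        f ((w.2, y), (w.1, x)) := by
      refine Measurable.lintegral_prod_right (f := fun (w : ℝ × ℝ) y =>
        ∫⁻ x in Set.Ioc (0 : ℝ) 1, f ((w.2, y), (w.1, x))) ?_
      exact Measurable.lintegral_prod_right (f := fun (w : (ℝ × ℝ) × ℝ) x =>
        f ((w.1.2, w.2), (w.1.1, x))) (by fun_prop)
    have h2 : H = fun w => ENNReal.ofReal (1 / w.2) *
        ((Set.Ioc (0 : ℝ) 1 ×ˢ Set.univ).indicator (fun w : ℝ × ℝ => ∫⁻ y,
          ∫⁻ x in Set.Ioc (0 : ℝ) 1, f ((w.2, y), (w.1, x))) w) := by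
      ext w
      simp only [hH]
      by_cases hw : w.1 ∈ Set.Ioc (0 : ℝ) 1
      · rw [Set.indicator_of_mem hw, Set.indicator_of_mem (by exact ⟨hw, trivial⟩)]
      · rw [Set.indicator_of_notMem hw, Set.indicator_of_notMem (fun h => hw h.1)]
    rw [h2]
    exact Measurable.mul (by fun_prop) (h1.indicator (measurableSet_Ioc.prod MeasurableSet.univ))
  have hL : ∀ τ : ℍ, ENNReal.ofReal (1 / τ.im) * ∫⁻ z : ℂ, jacobiStrip.indicator
      (fun p : ℍ × ℂ => f ((p.1.im, p.2.im), (p.1.re, p.2.re))) (τ, z) = H (τ.re, τ.im) := by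
    intro τ
    simp only [hH]
    congr 1
    by_cases hu : τ.re ∈ Set.Ioc (0 : ℝ) 1
    · rw [Set.indicator_of_mem hu]
      have h1 := Complex.volume_preserving_equiv_real_prod.lintegral_comp_emb
        Complex.measurableEquivRealProd.measurableEmbedding
        (fun w : ℝ × ℝ => (Set.Ioc (0 : ℝ) 1 ×ˢ Set.univ).indicator
          (fun w : ℝ × ℝ => f ((τ.im, w.2), (τ.re, w.1))) w)
      refine Eq.trans (lintegral_congr fun z => ?_) (h1.trans ?_)
      · by_cases hx : z.re ∈ Set.Ioc (0 : ℝ) 1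
        · rw [Set.indicator_of_mem (show (τ, z) ∈ jacobiStrip from ⟨hu, hx⟩),
            Set.indicator_of_mem (by simpa using hx)]
          rfl
        · rw [Set.indicator_of_notMem (fun h => hx h.2),
            Set.indicator_of_notMem (by simpa using hx)]
      · rw [lintegral_indicator (measurableSet_Ioc.prod MeasurableSet.univ),
          Measure.volume_eq_prod, ← Measure.prod_restrict, Measure.restrict_univ,
          lintegral_prod_symm _ (by fun_prop)]
    · rw [Set.indicator_of_notMem hu]
      have h0 : ∀ z : ℂ, jacobiStrip.indicator
          (fun p : ℍ × ℂ => f ((p.1.im, p.2.im), (p.1.re, p.2.re))) (τ, z) = 0 :=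
        fun z => Set.indicator_of_notMem (fun h => hu h.1) _
      simp only [h0, lintegral_zero]
  rw [lintegral_congr hL, lintegral_upperHalfPlane hHm]
  refine setLIntegral_congr_fun measurableSet_Ioi fun v hv => ?_
  have hv0 : (0 : ℝ) < v := hv
  have hfy : Measurable fun y : ℝ => ∫⁻ s, f ((v, y), s) ∂unitSquare :=
    Measurable.lintegral_prod_right (f := fun (y : ℝ) s => f ((v, y), s)) (by fun_prop)
  have hs : ∀ y, ∫⁻ s, f ((v, y), s) ∂unitSquare = ∫⁻ u in Set.Ioc (0 : ℝ) 1,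
      ∫⁻ x in Set.Ioc (0 : ℝ) 1, f ((v, y), (u, x)) := by
    intro y
    rw [unitSquare, lintegral_prod _ (by fun_prop)]
  have hm2 : Measurable fun w : ℝ × ℝ => ∫⁻ x in Set.Ioc (0 : ℝ) 1, f ((v, w.2), (w.1, x)) :=
    Measurable.lintegral_prod_right (f := fun (w : ℝ × ℝ) x => f ((v, w.2), (w.1, x)))
      (by fun_prop)
  simp only [hH]
  rw [lintegral_const_mul _ hfy]
  simp only [hs, ← mul_assoc]
  rw [lintegral_const_mul, lintegral_indicator measurableSet_Ioc,
    ← ENNReal.ofReal_mul (by positivity)]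
  · congr 1
    · congr 1
      field_simp
    · exact lintegral_lintegral_swap hm2.aemeasurable
  · exact (hm2.lintegral_prod_right').indicator measurableSet_Ioc

theorem measurableEmbedding_jacobiCoord :
    MeasurableEmbedding fun p : ℍ × ℂ => ((p.1.im, p.2.im), (p.1.re, p.2.re)) := by
  let e1 : ℍ × ℂ → ℂ × ℂ := Prod.map UpperHalfPlane.coe id
  have he1 : MeasurableEmbedding e1 :=
    (UpperHalfPlane.isOpenEmbedding_coe.prodMap Topology.IsOpenEmbedding.id).measurableEmbedding
  let e2 : ℂ × ℂ ≃ᵐ (ℝ × ℝ) × (ℝ × ℝ) :=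
    { toFun := fun p => ((p.1.im, p.2.im), (p.1.re, p.2.re))
      invFun := fun w => (⟨w.2.1, w.1.1⟩, ⟨w.2.2, w.1.2⟩)
      left_inv := fun p => rfl
      right_inv := fun w => rfl
      measurable_toFun := by
        have h3 := Complex.measurable_im
        have h4 := Complex.measurable_re
        exact Measurable.prodMk (by fun_prop) (by fun_prop)
      measurable_invFun := by
        have h : ∀ a b : (ℝ × ℝ) × (ℝ × ℝ) → ℝ, Measurable a → Measurable b →
            Measurable fun w => (⟨a w, b w⟩ : ℂ) := fun a b ha hb =>
          Complex.measurableEquivRealProd.symm.measurable.comp (ha.prodMk hb)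
        exact (h _ _ (by fun_prop) (by fun_prop)).prodMk (h _ _ (by fun_prop) (by fun_prop)) }
  exact e2.measurableEmbedding.comp he1

theorem integral_jacobiStrip (f : ℍ × ℂ → ℂ) :
    ∫ p in jacobiStrip, f p ∂jacobiMeasure =
      ∫ x, f (jacobiPt x.1.1 x.1.2 x.2) ∂(jacobiHeightMeasure.prod unitSquare) := by
  rw [← measurePreserving_jacobiCoord.integral_comp measurableEmbedding_jacobiCoord]
  exact integral_congr_ae (Filter.Eventually.of_forall fun p => congrArg f (eq_jacobiPt p))

theorem integrableOn_jacobiStrip_iff {E : Type*} [NormedAddCommGroup E] (f : ℍ × ℂ → E) :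
    IntegrableOn f jacobiStrip jacobiMeasure ↔
      Integrable (fun x : (ℝ × ℝ) × (ℝ × ℝ) => f (jacobiPt x.1.1 x.1.2 x.2))
        (jacobiHeightMeasure.prod unitSquare) := by
  rw [← measurePreserving_jacobiCoord.integrable_comp_emb measurableEmbedding_jacobiCoord]
  refine integrable_congr (Filter.Eventually.of_forall fun p => congrArg f (eq_jacobiPt p))

/-! ### Cosets of the translations and unfolding -/

namespace JacobiGroup

/-- The coordinates `(c, d, λ d - μ c)`, which classify the cosets of `{(T ^ n, (0, μ))}`. -/
def key (g : JacobiGroup) : ℤ × ℤ × ℤ :=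
  (g.mat 1 0, g.mat 1 1, g.lam * g.mat 1 1 - g.mu * g.mat 1 0)

/-- The translation `(τ, z) ↦ (τ + n, z + μ)`. -/
def trans (n mu : ℤ) : JacobiGroup := ⟨ModularGroup.T ^ n, 0, mu⟩

theorem trans_mat (n mu : ℤ) : (trans n mu).mat.1 = !![1, n; 0, 1] := ModularGroup.coe_T_zpow n

theorem den_trans (n mu : ℤ) (τ : ℍ) : (trans n mu).den τ = 1 := by
  simp [den, trans_mat]

theorem trans_smul (n mu : ℤ) (p : ℍ × ℂ) :
    trans n mu • p = (((n : ℝ) +ᵥ p.1 : ℍ), p.2 + mu) := by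
  rw [smul_def, den_trans]
  refine Prod.ext (UpperHalfPlane.modular_T_zpow_smul p.1 n) ?_
  simp [trans]

theorem autoFactor_trans (k m : ℕ) (n mu : ℤ) (p : ℍ × ℂ) :
    autoFactor k m (trans n mu) p = 1 := by
  rw [autoFactor, den_trans, expo]
  simp [trans_mat]
  simp [trans]

theorem jacobiSlash_trans (k m : ℕ) (φ : ℍ × ℂ → ℂ) (n mu : ℤ) (p : ℍ × ℂ) :
    jacobiSlash k m φ (trans n mu) p = φ (trans n mu • p) := by
  rw [jacobiSlash_apply, autoFactor_trans, one_mul]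

theorem mul_mat_apply (g h : JacobiGroup) (i j : Fin 2) :
    (g * h).mat i j = g.mat i 0 * h.mat 0 j + g.mat i 1 * h.mat 1 j := by
  simp [Matrix.mul_apply, Fin.sum_univ_two]

/-- The coordinates of `g * h` depend on `g` only through its own coordinates. -/
theorem key_mul (g h : JacobiGroup) : (g * h).key =
    (g.key.1 * h.mat 0 0 + g.key.2.1 * h.mat 1 0, g.key.1 * h.mat 0 1 + g.key.2.1 * h.mat 1 1,
      g.key.2.2 + h.lam * (g.key.1 * h.mat 0 1 + g.key.2.1 * h.mat 1 1)
        - h.mu * (g.key.1 * h.mat 0 0 + g.key.2.1 * h.mat 1 0)) := by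
  have hd := h.det_eq
  simp only [key, mul_mat_apply, mul_lam, mul_mu, Prod.mk.injEq, true_and]
  linear_combination (g.lam * g.mat 1 1 - g.mu * g.mat 1 0) * hd

theorem key_trans_mul (n mu : ℤ) (g : JacobiGroup) : (trans n mu * g).key = g.key := by
  rw [key_mul]
  simp [key, trans_mat]
  simp [trans]

theorem key_mul_congr {g g' : JacobiGroup} (hg : g.key = g'.key) (h : JacobiGroup) :
    (g * h).key = (g' * h).key := by
  rw [key_mul, key_mul, hg]

theorem exists_trans_of_key_eq {g g' : JacobiGroup} (h : g.key = g'.key) :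
    ∃ n mu : ℤ, g' = trans n mu * g := by
  have hd := g.det_eq
  have hd' := g'.det_eq
  simp only [key, Prod.mk.injEq] at h
  obtain ⟨hc, hdd, hk⟩ := h
  rw [← hc, ← hdd] at hd' hk
  refine ⟨-g'.mat 0 0 * g.mat 0 1 + g'.mat 0 1 * g.mat 0 0,
    -(g'.lam - g.lam) * g.mat 0 1 + (g'.mu - g.mu) * g.mat 0 0, ?_⟩
  refine JacobiGroup.ext (Matrix.SpecialLinearGroup.ext _ _ fun i j => ?_) ?_ ?_
  · rw [mul_mat_apply]
    fin_cases i <;> fin_cases j <;> simp [trans_mat, hc, hdd]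
    · rw [← hc]
      linear_combination -(g'.mat 0 0) * hd + g.mat 0 0 * hd'
    · rw [← hdd]
      linear_combination -(g'.mat 0 1) * hd + g.mat 0 1 * hd'
  · simp only [mul_lam, trans]
    linear_combination (-(g'.lam - g.lam)) * hd - (g.mat 0 0) * hk
  · simp only [mul_mu, trans]
    linear_combination (-(g'.mu - g.mu)) * hd - (g.mat 0 1) * hk

theorem existsUnique_trans_mem_strip (p : ℍ × ℂ) :
    ∃ n mu : ℤ, trans n mu • p ∈ jacobiStrip ∧
      ∀ n' mu' : ℤ, trans n' mu' • p ∈ jacobiStrip → n' = n ∧ mu' = mu := by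
  obtain ⟨n, hn, hn'⟩ := existsUnique_add_zsmul_mem_Ioc (zero_lt_one (α := ℝ)) p.1.re 0
  obtain ⟨mu, hm, hm'⟩ := existsUnique_add_zsmul_mem_Ioc (zero_lt_one (α := ℝ)) p.2.re 0
  have h : ∀ n' mu' : ℤ, trans n' mu' • p ∈ jacobiStrip ↔
      (p.1.re + n' • (1 : ℝ) ∈ Set.Ioc (0 : ℝ) (0 + 1) ∧
        p.2.re + mu' • (1 : ℝ) ∈ Set.Ioc (0 : ℝ) (0 + 1)) := by
    intro n' mu'
    rw [trans_smul, jacobiStrip, Set.mem_ofPred_eq, zero_add, UpperHalfPlane.vadd_re, add_comm]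
    simp
  exact ⟨n, mu, (h _ _).mpr ⟨hn, hm⟩, fun n' mu' h' =>
    ⟨hn' n' ((h _ _).mp h').1, hm' mu' ((h _ _).mp h').2⟩⟩

end JacobiGroup

/-- The cosets of the translation subgroup `{(T ^ n, (0, μ))}` in the Jacobi group. -/
abbrev JacobiCoset : Type := Set.range JacobiGroup.key

namespace JacobiCoset

/-- A representative of a coset. -/
def rep (q : JacobiCoset) : JacobiGroup := q.2.choose

theorem key_rep (q : JacobiCoset) : q.rep.key = q := q.2.choose_spec

/-- The right translation action of the Jacobi group on the cosets. -/
def mulRight (h : JacobiGroup) : JacobiCoset ≃ JacobiCoset where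
  toFun q := ⟨(q.rep * h).key, Set.mem_range_self _⟩
  invFun q := ⟨(q.rep * h⁻¹).key, Set.mem_range_self _⟩
  left_inv q := by
    refine Subtype.ext ((JacobiGroup.key_mul_congr (key_rep _) h⁻¹).trans ?_)
    rw [mul_assoc, mul_inv_cancel, mul_one, key_rep]
  right_inv q := by
    refine Subtype.ext ((JacobiGroup.key_mul_congr (key_rep _) h).trans ?_)
    rw [mul_assoc, inv_mul_cancel, mul_one, key_rep]

theorem key_rep_mulRight (h : JacobiGroup) (q : JacobiCoset) :
    (mulRight h q).rep.key = (q.rep * h).key := key_rep _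

/-- Along the orbit of a point, each coset contains exactly one element that leads to the strip. -/
theorem exists_mem_strip (q : JacobiCoset) (p : ℍ × ℂ) :
    ∃ g : JacobiGroup, g.key = q ∧ g • p ∈ jacobiStrip ∧
      (∃ n mu : ℤ, g = JacobiGroup.trans n mu * q.rep) ∧
      ∀ g' : JacobiGroup, g'.key = q → g' • p ∈ jacobiStrip → g' = g := by
  obtain ⟨n, mu, h, hu⟩ := JacobiGroup.existsUnique_trans_mem_strip (q.rep • p)
  refine ⟨JacobiGroup.trans n mu * q.rep, ?_, ?_, ⟨n, mu, rfl⟩, fun g' hg' hs => ?_⟩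
  · rw [JacobiGroup.key_trans_mul, key_rep]
  · rwa [mul_smul]
  · obtain ⟨n', mu', rfl⟩ := JacobiGroup.exists_trans_of_key_eq ((key_rep q).trans hg'.symm)
    rw [mul_smul] at hs
    obtain ⟨rfl, rfl⟩ := hu n' mu' hs
    rfl

end JacobiCoset

/-- Unfolding: the integral over a fundamental domain of a sum over cosets of the translations is
an integral over the strip. -/
theorem integral_fundamentalDomain_eq_strip {F : Set (ℍ × ℂ)}
    (hF : IsFundamentalDomain JacobiGroup F jacobiMeasure) {G S : ℍ × ℂ → ℂ}
    (hG : ∀ (n mu : ℤ) p, G (JacobiGroup.trans n mu • p) = G p)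
    (hint : IntegrableOn G jacobiStrip jacobiMeasure)
    (hS : ∀ p, HasSum (fun q : JacobiCoset => G (q.rep • p)) (S p)) :
    ∫ p in F, S p ∂jacobiMeasure = ∫ p in jacobiStrip, G p ∂jacobiMeasure := by
  set H := jacobiStrip.indicator G with hH
  have hHi : Integrable H jacobiMeasure := hint.integrable_indicator measurableSet_jacobiStrip
  -- each coset meets the strip exactly once along the orbit of `p`
  have hsum : ∀ p, HasSum (fun g : JacobiGroup => H (g • p)) (S p) := by
    intro p
    choose s hs1 hs2 hs3 hs4 using fun q : JacobiCoset => q.exists_mem_strip p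
    have hinj : Function.Injective s := fun q q' hqq => by
      apply Subtype.ext
      rw [← hs1 q, ← hs1 q', hqq]
    refine (hinj.hasSum_iff fun g hg => ?_).mp ((hS p).congr_fun fun q => ?_)
    · refine Set.indicator_of_notMem (fun hgp => hg ?_) _
      exact ⟨⟨g.key, Set.mem_range_self _⟩, (hs4 ⟨g.key, Set.mem_range_self _⟩ g rfl hgp).symm⟩
    · obtain ⟨n, mu, h⟩ := hs3 q
      rw [Function.comp, hH, Set.indicator_of_mem (hs2 q), h, mul_smul, hG]
  have hgi : ∀ g : JacobiGroup, Integrable (fun p => H (g • p)) (jacobiMeasure.restrict F) :=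
    fun g => ((measurePreserving_smul g jacobiMeasure).integrable_comp_of_integrable
      hHi).integrableOn
  have hlint := hF.lintegral_eq_tsum'' fun p => ‖H p‖ₑ
  have hsumm : Summable fun g : JacobiGroup => ∫ p in F, ‖H (g • p)‖ ∂jacobiMeasure := by
    have h1 : ∀ g : JacobiGroup, ∫ p in F, ‖H (g • p)‖ ∂jacobiMeasure =
        (∫⁻ p in F, ‖H (g • p)‖ₑ ∂jacobiMeasure).toReal :=
      fun g => integral_norm_eq_lintegral_enorm (hgi g).aestronglyMeasurable
    simp only [h1]
    refine ENNReal.summable_toReal ?_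
    rw [← hlint]
    exact hHi.hasFiniteIntegral.ne
  have h2 := hasSum_integral_of_summable_integral_norm hgi hsumm
  simp only [(hsum _).tsum_eq] at h2
  rw [← integral_indicator measurableSet_jacobiStrip, hF.integral_eq_tsum'' H hHi]
  exact h2.tsum_eq.symm

/-! ### A Siegel set of finite volume -/

/-- A Siegel set: `v ≥ 1/2`, `0 ≤ α ≤ 1` in the strip. -/
def jacobiSiegelSet : Set (ℍ × ℂ) :=
  {p | p ∈ jacobiStrip ∧ 1 / 2 ≤ p.1.im ∧ 0 ≤ p.2.im ∧ p.2.im ≤ p.1.im}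

/-- Translations preserve the height `v` and move a point to the strip with `0 ≤ α ≤ 1`. -/
theorem exists_smul_mem_strip_of_im (p : ℍ × ℂ) : ∃ g : JacobiGroup, (g • p).1.im = p.1.im ∧
    g • p ∈ jacobiStrip ∧ 0 ≤ (g • p).2.im ∧ (g • p).2.im ≤ (g • p).1.im := by
  set g2 : JacobiGroup := ⟨1, -⌊jacobiAlpha p⌋, 0⟩
  set p2 := g2 • p with hp2
  have him2 : p2.1 = p.1 := by
    rw [hp2, JacobiGroup.smul_fst]
    simp [g2]
  have hal2 : jacobiAlpha p2 = Int.fract (jacobiAlpha p) := by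
    rw [hp2, (JacobiGroup.alpha_beta_smul g2 p).1]
    rw [← Int.self_sub_floor]
    simp [g2, ← sub_eq_add_neg]
  obtain ⟨n, mu, h, -⟩ := JacobiGroup.existsUnique_trans_mem_strip p2
  refine ⟨JacobiGroup.trans n mu * g2, ?_⟩
  rw [mul_smul, ← hp2]
  have him3 : (JacobiGroup.trans n mu • p2).1.im = p2.1.im := by
    rw [JacobiGroup.trans_smul]; simp
  have him4 : (JacobiGroup.trans n mu • p2).2.im = p2.2.im := by
    rw [JacobiGroup.trans_smul]; simp
  have hy := jacobiAlpha_mul_im p2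
  rw [hal2] at hy
  have hv := p2.1.im_pos
  refine ⟨by rw [him3, him2], h, ?_, ?_⟩
  · rw [him4, ← hy]
    exact mul_nonneg (Int.fract_nonneg _) hv.le
  · rw [him4, him3, ← hy]
    exact mul_le_of_le_one_left hv.le (Int.fract_lt_one _).le

theorem exists_smul_mem_siegelSet (p : ℍ × ℂ) : ∃ g : JacobiGroup, g • p ∈ jacobiSiegelSet := by
  obtain ⟨M, hM⟩ := ModularGroup.exists_smul_mem_fd p.1
  set g1 : JacobiGroup := ⟨M, 0, 0⟩
  have him : 1 / 2 ≤ (g1 • p).1.im := by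
    have h := ModularGroup.three_le_four_mul_im_sq_of_mem_fd hM
    have h2 : (g1 • p).1 = M • p.1 := rfl
    rw [h2]
    have := (M • p.1).im_pos
    nlinarith
  obtain ⟨g2, h1, h2, h3⟩ := exists_smul_mem_strip_of_im (g1 • p)
  refine ⟨g2 * g1, ?_⟩
  rw [mul_smul]
  exact ⟨h2, him.trans_eq h1.symm, h3⟩

theorem jacobiMeasure_siegelSet_lt_top : jacobiMeasure jacobiSiegelSet < ⊤ := by
  set A : Set (ℝ × ℝ) := {w | 1 / 2 ≤ w.1 ∧ 0 ≤ w.2 ∧ w.2 ≤ w.1} with hA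
  have hAm : MeasurableSet A := by
    refine (measurableSet_le measurable_const measurable_fst).inter
      ((measurableSet_le measurable_const measurable_snd).inter
        (measurableSet_le measurable_snd measurable_fst))
  have h1 : jacobiMeasure jacobiSiegelSet = jacobiHeightMeasure A := by
    have h2 : jacobiSiegelSet = (fun p : ℍ × ℂ => ((p.1.im, p.2.im), (p.1.re, p.2.re))) ⁻¹'
        (A ×ˢ Set.univ) ∩ jacobiStrip := by
      ext p
      simp only [jacobiSiegelSet, Set.mem_ofPred_eq, hA, Set.mem_inter_iff, Set.mem_preimage,
        Set.mem_prod, Set.mem_univ, and_true]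
      tauto
    have h3 := measurePreserving_jacobiCoord.measure_preimage
      (hAm.prod MeasurableSet.univ).nullMeasurableSet
    rw [Measure.restrict_apply (measurable_jacobiCoord (hAm.prod MeasurableSet.univ)), ← h2,
      Measure.prod_prod, measure_univ, mul_one] at h3
    exact h3
  rw [h1, ← lintegral_indicator_one hAm,
    lintegral_jacobiHeightMeasure (measurable_one.indicator hAm)]
  have h4 : ∀ v ∈ Set.Ioi (0 : ℝ), ∫⁻ y, ENNReal.ofReal (1 / v ^ 3) * A.indicator 1 (v, y) ≤
      (Set.Ioi (1 / 4 : ℝ)).indicator (fun v => ENNReal.ofReal (v ^ (-2 : ℝ))) v := by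
    intro v hv
    have hv0 : (0 : ℝ) < v := hv
    by_cases hv2 : 1 / 2 ≤ v
    · rw [Set.indicator_of_mem (show v ∈ Set.Ioi (1 / 4 : ℝ) from by
        rw [Set.mem_Ioi]; linarith)]
      have h5 : ∀ y, A.indicator (1 : ℝ × ℝ → ENNReal) (v, y) =
          (Set.Icc 0 v).indicator 1 y := by
        intro y
        by_cases hy : y ∈ Set.Icc 0 v
        · rw [Set.indicator_of_mem hy,
            Set.indicator_of_mem (show (v, y) ∈ A from ⟨hv2, hy.1, hy.2⟩)]
          rfl
        · rw [Set.indicator_of_notMem hy, Set.indicator_of_notMem (fun h => hy ⟨h.2.1, h.2.2⟩)]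
      simp only [h5]
      rw [lintegral_const_mul _ (measurable_one.indicator measurableSet_Icc),
        lintegral_indicator_one measurableSet_Icc, Real.volume_Icc, sub_zero,
        ← ENNReal.ofReal_mul (by positivity)]
      refine ENNReal.ofReal_le_ofReal (le_of_eq ?_)
      rw [Real.rpow_neg hv0.le, Real.rpow_two]
      field_simp
    · have h5 : ∀ y, A.indicator (1 : ℝ × ℝ → ENNReal) (v, y) = 0 :=
        fun y => Set.indicator_of_notMem (fun h => hv2 h.1) _
      simp [h5]
  refine (setLIntegral_mono' measurableSet_Ioi h4).trans_lt ?_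
  refine (setLIntegral_le_lintegral _ _).trans_lt ?_
  rw [lintegral_indicator measurableSet_Ioi]
  have h6 := integrableOn_Ioi_rpow_of_lt (a := -2) (by norm_num) (c := 1 / 4) (by norm_num)
  exact h6.lintegral_lt_top

/-- A fundamental domain is covered by the translates of a Siegel set, so its volume is at most that
of the Siegel set. -/
theorem jacobiMeasure_fundamentalDomain_lt_top {F : Set (ℍ × ℂ)}
    (hF : IsFundamentalDomain JacobiGroup F jacobiMeasure) : jacobiMeasure F < ⊤ := by
  refine lt_of_le_of_lt ?_ jacobiMeasure_siegelSet_lt_top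
  rw [hF.measure_eq_tsum jacobiSiegelSet]
  calc jacobiMeasure F ≤ jacobiMeasure (⋃ g : JacobiGroup, g • jacobiSiegelSet ∩ F) := by
        refine measure_mono fun p hp => ?_
        obtain ⟨g, hg⟩ := exists_smul_mem_siegelSet p
        exact Set.mem_iUnion.mpr ⟨g⁻¹, Set.mem_inv_smul_set_iff.mpr hg, hp⟩
    _ ≤ _ := measure_iUnion_le _

/-! ### Boundedness of cusp forms -/

theorem summable_exp_neg_abs_int {a : ℝ} (ha : 0 < a) :
    Summable fun n : ℤ => Real.exp (-a * |(n : ℝ)|) := by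
  have h : Summable fun n : ℕ => Real.exp (n * -a) :=
    Real.summable_exp_nat_mul_iff.mpr (neg_lt_zero.mpr ha)
  refine Summable.of_nat_of_neg (h.congr fun n => ?_) (h.congr fun n => ?_)
  · simp [mul_comm]
  · simp [mul_comm]

/-- Completing the square in the size of a monomial. -/
theorem norm_jacobiExp_mul_weight {m : ℕ} (hm : 0 < m) (k : ℕ) (n r : ℤ) (p : ℍ × ℂ) :
    ‖jacobiExp n r p‖ * jacobiWeight k m p = p.1.im ^ ((k : ℝ) / 2) *
      Real.exp (-(Real.pi * jacobiDisc m n r / (2 * m) * p.1.im)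
        - 2 * Real.pi * m * (jacobiAlpha p + r / (2 * m)) ^ 2 * p.1.im) := by
  have hm' : (m : ℝ) ≠ 0 := by positivity
  rw [norm_jacobiExp, jacobiWeight, mul_left_comm, ← Real.exp_add, ← jacobiAlpha_mul_im,
    jacobiDisc]
  congr 2
  field_simp
  ring

namespace HasJacobiFourierExpansion

variable {φ : ℍ × ℂ → ℂ} {c : ℤ → ℤ → ℂ} {k m : ℕ}

/-- A coefficient is bounded by the invariant norm on a single horizontal torus. -/
theorem norm_coeff_le_of_jacobiNorm_le (h : HasJacobiFourierExpansion φ c) (hm : 0 < m)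
    {v B : ℝ} (hv : 0 < v) (n r : ℤ) (hB : ∀ s ∈ Set.Ioc (0 : ℝ) 1 ×ˢ Set.Ioc (0 : ℝ) 1,
      jacobiNorm k m φ (jacobiPt v (-(r * v / (2 * m))) s) ≤ B) :
    ‖c n r‖ ≤ B * v ^ (-((k : ℝ) / 2)) * Real.exp (Real.pi * jacobiDisc m n r / (2 * m) * v) := by
  have hm' : (m : ℝ) ≠ 0 := by positivity
  -- the height `y` at which the weight times `ζ ^ r` is largest
  set y : ℝ := -(r * v / (2 * m)) with hy
  have h1 : ∀ s ∈ Set.Ioc (0 : ℝ) 1 ×ˢ Set.Ioc (0 : ℝ) 1, ‖φ (jacobiPt v y s)‖ ≤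
      B * v ^ (-((k : ℝ) / 2)) * Real.exp (2 * Real.pi * m * (y ^ 2 / v)) := by
    intro s hs
    have h2 := hB s hs
    rw [jacobiNorm, jacobiWeight, jacobiPt_im hv, jacobiAlpha_jacobiPt hv,
      show (y / v) ^ 2 * v = y ^ 2 / v by field_simp] at h2
    have h3 : -2 * Real.pi * m * (y ^ 2 / v) = -(2 * Real.pi * m * (y ^ 2 / v)) := by ring
    rw [h3, Real.exp_neg] at h2
    rw [Real.rpow_neg hv.le, ← div_eq_mul_inv]
    have h4 := Real.rpow_pos_of_pos hv ((k : ℝ) / 2)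
    have h5 := Real.exp_pos (2 * Real.pi * m * (y ^ 2 / v))
    have h6 : ‖φ (jacobiPt v y s)‖ = ‖φ (jacobiPt v y s)‖ * (v ^ ((k : ℝ) / 2) *
        (Real.exp (2 * Real.pi * m * (y ^ 2 / v)))⁻¹) / v ^ ((k : ℝ) / 2) *
          Real.exp (2 * Real.pi * m * (y ^ 2 / v)) := by field_simp
    rw [h6]
    gcongr
  refine (h.norm_coeff_le hv y h1 n r).trans (le_of_eq ?_)
  rw [mul_assoc _ (Real.exp _), ← Real.exp_add, jacobiDisc, hy]
  congr 2
  field_simp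
  ring

/-- The form is bounded at each height, by the triangle inequality in its expansion. -/
theorem exists_norm_le_of_height (h : HasJacobiFourierExpansion φ c) {v : ℝ} (hv : 0 < v) :
    ∃ B : ℝ, ∀ p : ℍ × ℂ, p.1.im = v → 0 ≤ p.2.im → p.2.im ≤ v → ‖φ p‖ ≤ B := by
  have s0 := h.summable_norm hv 0
  have s1 := h.summable_norm hv v
  refine ⟨∑' i : ℤ × ℤ, (‖c i.1 i.2‖ * Real.exp (-2 * Real.pi * (i.1 * v + i.2 * 0)) +
      ‖c i.1 i.2‖ * Real.exp (-2 * Real.pi * (i.1 * v + i.2 * v))), fun p hp h0 h1 => ?_⟩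
  have hs := hasJacobiFourierExpansion_iff.mp h p
  rw [← hs.tsum_eq]
  refine tsum_of_norm_bounded (s0.add s1).hasSum fun i => ?_
  rw [norm_mul, norm_jacobiExp, hp, ← mul_add]
  refine mul_le_mul_of_nonneg_left ?_ (norm_nonneg _)
  have e0 := Real.exp_pos (-2 * Real.pi * (i.1 * v + i.2 * 0))
  have e1 := Real.exp_pos (-2 * Real.pi * (i.1 * v + i.2 * v))
  have hpi := Real.pi_pos
  rcases le_total (0 : ℝ) i.2 with hr | hr
  · have : Real.exp (-2 * Real.pi * (i.1 * v + i.2 * p.2.im)) ≤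
        Real.exp (-2 * Real.pi * (i.1 * v + i.2 * 0)) := by
      apply Real.exp_le_exp.mpr
      nlinarith [mul_nonneg hr h0]
    linarith
  · have : Real.exp (-2 * Real.pi * (i.1 * v + i.2 * p.2.im)) ≤
        Real.exp (-2 * Real.pi * (i.1 * v + i.2 * v)) := by
      apply Real.exp_le_exp.mpr
      have h2 : (i.2 : ℝ) * v ≤ i.2 * p.2.im := mul_le_mul_of_nonpos_left h1 hr
      nlinarith
    linarith

end HasJacobiFourierExpansion

/-- The theta-like majorant of the expansion of a cusp form in a Siegel set. -/
def siegelTerm (m : ℕ) (i : ℤ × ℤ) : ℝ :=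
  Real.exp (Real.pi * m) * (Real.exp (-(Real.pi / 4) * |(i.1 : ℝ)|) *
    Real.exp (-(Real.pi / (16 * m)) * |(i.2 : ℝ)|))

theorem summable_siegelTerm {m : ℕ} (hm : 0 < m) : Summable (siegelTerm m) := by
  have hpi := Real.pi_pos
  have hm' : (0 : ℝ) < m := by positivity
  have h := (summable_exp_neg_abs_int (a := Real.pi / 4) (by positivity)).mul_of_nonneg
    (summable_exp_neg_abs_int (a := Real.pi / (16 * m)) (by positivity))
    (fun _ => (Real.exp_pos _).le) (fun _ => (Real.exp_pos _).le)
  exact h.mul_left _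

theorem tsum_siegelTerm_pos {m : ℕ} (hm : 0 < m) : 0 < ∑' i, siegelTerm m i :=
  (summable_siegelTerm hm).tsum_pos
    (fun _ => by unfold siegelTerm; positivity) (0, 0) (by unfold siegelTerm; positivity)

/-- Decay of a cusp form in a Siegel set, if the coefficients with small discriminant vanish. -/
theorem HasJacobiFourierExpansion.jacobiNorm_le {φ : ℍ × ℂ → ℂ} {c : ℤ → ℤ → ℂ} {k m : ℕ}
    (h : HasJacobiFourierExpansion φ c) (hm : 0 < m) {A v₁ N : ℝ} (hN : 0 < N)
    (hA : ∀ n r, ‖c n r‖ ≤ A * Real.exp (Real.pi * jacobiDisc m n r / (2 * m) * v₁))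
    (hc : ∀ n r, c n r ≠ 0 → N ≤ jacobiDisc m n r) {p : ℍ × ℂ} (hv : 1 / 2 ≤ p.1.im)
    (hv₁ : v₁ ≤ p.1.im / 2) (h0 : 0 ≤ p.2.im) (h1 : p.2.im ≤ p.1.im) :
    jacobiNorm k m φ p ≤ A * p.1.im ^ ((k : ℝ) / 2) *
      Real.exp (-(Real.pi * N / (8 * m)) * p.1.im) * ∑' i, siegelTerm m i := by
  have hpi := Real.pi_pos
  have hm' : (0 : ℝ) < m := by positivity
  have hvpos := p.1.im_pos
  have hA0 : 0 ≤ A := nonneg_of_mul_nonneg_left ((norm_nonneg _).trans (hA 0 0)) (Real.exp_pos _)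
  have ha0 : 0 ≤ jacobiAlpha p := div_nonneg h0 hvpos.le
  have ha1 : jacobiAlpha p ≤ 1 := (div_le_one hvpos).mpr h1
  have hs := (hasJacobiFourierExpansion_iff.mp h p).mul_right ((jacobiWeight k m p : ℝ) : ℂ)
  have hn : jacobiNorm k m φ p = ‖φ p * ((jacobiWeight k m p : ℝ) : ℂ)‖ := by
    rw [norm_mul, Complex.norm_real, Real.norm_of_nonneg (jacobiWeight_pos k m p).le, jacobiNorm]
  rw [hn, ← hs.tsum_eq]
  refine tsum_of_norm_bounded ((summable_siegelTerm hm).hasSum.mul_left _) fun i => ?_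
  rw [norm_mul, norm_mul, Complex.norm_real, Real.norm_of_nonneg (jacobiWeight_pos k m p).le,
    mul_assoc, norm_jacobiExp_mul_weight hm]
  by_cases hci : c i.1 i.2 = 0
  · rw [hci, norm_zero, zero_mul]
    unfold siegelTerm
    positivity
  set D := jacobiDisc m i.1 i.2 with hD
  have hND := hc _ _ hci
  have hi1 : (0 : ℝ) ≤ i.1 := by
    by_contra hneg
    push Not at hneg
    have : D ≤ 0 := by
      rw [hD, jacobiDisc]
      nlinarith [sq_nonneg (i.2 : ℝ), mul_pos hm' (neg_pos.mpr hneg)]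
    linarith
  set x : ℝ := (i.2 : ℝ) / (2 * m) with hx
  have hr : |(i.2 : ℝ)| ≤ (i.2 : ℝ) ^ 2 := by
    have : |i.2| ≤ i.2 ^ 2 := by
      rw [← sq_abs]; nlinarith [Int.natCast_nonneg i.2.natAbs, abs_nonneg i.2,
        show |i.2| = 0 ∨ 1 ≤ |i.2| by have := abs_nonneg i.2; omega]
    exact_mod_cast this
  -- half of `D v` pays for `v₁`; the rest is shared between the decay in `v` and the convergence
  -- of the majorant, the latter with the help of the Gaussian factor in `r`
  have key : Real.pi * D / (2 * m) * v₁ + (-(Real.pi * D / (2 * m) * p.1.im)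
      - 2 * Real.pi * m * (jacobiAlpha p + x) ^ 2 * p.1.im) ≤
      -(Real.pi * N / (8 * m)) * p.1.im + (Real.pi * m + (-(Real.pi / 4) * |(i.1 : ℝ)| +
        -(Real.pi / (16 * m)) * |(i.2 : ℝ)|)) := by
    have e1 : Real.pi * D / (2 * m) * v₁ ≤ Real.pi * D / (2 * m) * (p.1.im / 2) := by
      have : 0 ≤ D := by linarith
      gcongr
    have e2 : Real.pi * N / (8 * m) * p.1.im ≤ Real.pi * D / (8 * m) * p.1.im := by
      gcongr
    have e3 : Real.pi * D / (8 * m) * (1 / 2) ≤ Real.pi * D / (8 * m) * p.1.im := by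
      have : 0 ≤ D := by linarith
      gcongr
    have e4 : 2 * Real.pi * m * (jacobiAlpha p + x) ^ 2 * (1 / 2) ≤
      2 * Real.pi * m * (jacobiAlpha p + x) ^ 2 * p.1.im := by gcongr
    have e5 : x ^ 2 / 2 - 1 ≤ (jacobiAlpha p + x) ^ 2 := by
      nlinarith [sq_nonneg (2 * jacobiAlpha p + x)]
    have e6 : Real.pi * m * (x ^ 2 / 2 - 1) ≤ Real.pi * m * (jacobiAlpha p + x) ^ 2 := by gcongr
    have e7 : Real.pi * m * (x ^ 2 / 2) = Real.pi / (8 * m) * (i.2 : ℝ) ^ 2 := by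
      rw [hx]; field_simp; ring
    have e8 : Real.pi * D / (8 * m) * (1 / 2) =
        Real.pi / 4 * i.1 - Real.pi / (16 * m) * (i.2 : ℝ) ^ 2 := by
      rw [hD, jacobiDisc]; field_simp; ring
    have e9 : Real.pi / (16 * m) * |(i.2 : ℝ)| ≤ Real.pi / (16 * m) * (i.2 : ℝ) ^ 2 := by gcongr
    have e10 : Real.pi / (8 * m) * (i.2 : ℝ) ^ 2 = 2 * (Real.pi / (16 * m) * (i.2 : ℝ) ^ 2) := by
      field_simp; ring
    have e11 : Real.pi * D / (2 * m) * p.1.im = 4 * (Real.pi * D / (8 * m) * p.1.im) := by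
      field_simp; ring
    have e12 : Real.pi * D / (2 * m) * (p.1.im / 2) = 2 * (Real.pi * D / (8 * m) * p.1.im) := by
      field_simp; ring
    rw [abs_of_nonneg hi1]
    linarith
  calc ‖c i.1 i.2‖ * (p.1.im ^ ((k : ℝ) / 2) * Real.exp (-(Real.pi * D / (2 * m) * p.1.im)
          - 2 * Real.pi * m * (jacobiAlpha p + x) ^ 2 * p.1.im))
      ≤ (A * Real.exp (Real.pi * D / (2 * m) * v₁)) * (p.1.im ^ ((k : ℝ) / 2) *
          Real.exp (-(Real.pi * D / (2 * m) * p.1.im)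
            - 2 * Real.pi * m * (jacobiAlpha p + x) ^ 2 * p.1.im)) := by
        gcongr
        exact hA _ _
    _ = A * p.1.im ^ ((k : ℝ) / 2) * Real.exp (Real.pi * D / (2 * m) * v₁ +
          (-(Real.pi * D / (2 * m) * p.1.im)
            - 2 * Real.pi * m * (jacobiAlpha p + x) ^ 2 * p.1.im)) := by
        rw [Real.exp_add]; ring
    _ ≤ A * p.1.im ^ ((k : ℝ) / 2) * Real.exp (-(Real.pi * N / (8 * m)) * p.1.im +
          (Real.pi * m + (-(Real.pi / 4) * |(i.1 : ℝ)| +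
            -(Real.pi / (16 * m)) * |(i.2 : ℝ)|))) := by
        gcongr
    _ = _ := by
        rw [Real.exp_add, Real.exp_add, Real.exp_add, siegelTerm]; ring

namespace IsJacobiCuspForm

variable {φ : ℍ × ℂ → ℂ} {k m : ℕ}

theorem jacobiHolomorphic (h : IsJacobiCuspForm k m φ) : JacobiHolomorphic φ := h.holo

theorem exists_jacobiNorm_le_of_height (h : IsJacobiCuspForm k m φ) {v : ℝ} (hv : 0 < v) :
    ∃ B : ℝ, ∀ p : ℍ × ℂ, p.1.im = v → jacobiNorm k m φ p ≤ B := by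
  obtain ⟨c, hc, -⟩ := h.cusp
  obtain ⟨B, hB⟩ := hc.exists_norm_le_of_height hv
  refine ⟨B * v ^ ((k : ℝ) / 2), fun p hp => ?_⟩
  obtain ⟨g, hg, -, h0, h1⟩ := exists_smul_mem_strip_of_im p
  rw [← jacobiNorm_smul h.slash_eq g p, jacobiNorm, jacobiWeight]
  have h2 := hB _ (hg.trans hp) h0 (h1.trans_eq (hg.trans hp))
  rw [hg, hp] at *
  refine mul_le_mul h2 ?_ (by positivity) ((norm_nonneg _).trans h2)
  refine mul_le_of_le_one_right (by positivity) (Real.exp_le_one_iff.mpr ?_)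
  have : 0 ≤ 2 * Real.pi * m * (jacobiAlpha (g • p) ^ 2 * v) := by positivity
  linarith

theorem exists_coeff_le (h : IsJacobiCuspForm k m φ) (hm : 0 < m) {c : ℤ → ℤ → ℂ}
    (hc : HasJacobiFourierExpansion φ c) {v : ℝ} (hv : 0 < v) :
    ∃ A, ∀ n r, ‖c n r‖ ≤ A * Real.exp (Real.pi * jacobiDisc m n r / (2 * m) * v) := by
  obtain ⟨B, hB⟩ := h.exists_jacobiNorm_le_of_height hv
  exact ⟨_, fun n r => hc.norm_coeff_le_of_jacobiNorm_le hm hv n r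
    fun s _ => hB _ (jacobiPt_im hv _ s)⟩

end IsJacobiCuspForm

theorem exists_rpow_mul_exp_neg_le (s : ℝ) {a : ℝ} (ha : 0 < a) :
    ∃ C, 0 < C ∧ ∀ v : ℝ, 1 / 2 ≤ v → v ^ s * Real.exp (-a * v) ≤ C := by
  have h := tendsto_rpow_mul_exp_neg_mul_atTop_nhds_zero s a ha
  have h1 : ContinuousOn (fun v : ℝ => v ^ s * Real.exp (-a * v)) (Set.Ici (1 / 2)) := by
    refine ContinuousOn.mul (fun v hv => ?_) (by fun_prop)
    have : (1 / 2 : ℝ) ≤ v := hv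
    exact (Real.continuousAt_rpow_const _ _ (Or.inl (by linarith))).continuousWithinAt
  obtain ⟨R, hR⟩ := Filter.eventually_atTop.mp (h.eventually (gt_mem_nhds one_pos))
  obtain ⟨C, hC⟩ := (isCompact_Icc (a := (1 / 2 : ℝ)) (b := R)).bddAbove_image
    (h1.mono Set.Icc_subset_Ici_self)
  refine ⟨max C 1, by positivity, fun v hv => ?_⟩
  rcases le_total R v with hRv | hRv
  · exact (hR v hRv).le.trans (le_max_right _ _)
  · exact (hC ⟨v, ⟨hv, hRv⟩, rfl⟩).trans (le_max_left _ _)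

/-- A bound on the Siegel set is a bound everywhere. -/
theorem jacobiNorm_le_of_siegelSet {φ : ℍ × ℂ → ℂ} {k m : ℕ}
    (hφ : ∀ g, jacobiSlash k m φ g = φ) {M : ℝ}
    (hM : ∀ p ∈ jacobiSiegelSet, jacobiNorm k m φ p ≤ M) (p : ℍ × ℂ) :
    jacobiNorm k m φ p ≤ M := by
  obtain ⟨g, hg⟩ := exists_smul_mem_siegelSet p
  rw [← jacobiNorm_smul hφ g]
  exact hM _ hg

/-- A cusp form is bounded in the invariant norm: it decays exponentially in a Siegel set. -/
theorem IsJacobiCuspForm.exists_jacobiNorm_le {φ : ℍ × ℂ → ℂ} {k m : ℕ}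
    (h : IsJacobiCuspForm k m φ) (hm : 0 < m) : ∃ M, ∀ p, jacobiNorm k m φ p ≤ M := by
  obtain ⟨c, hc, hc0⟩ := h.cusp
  obtain ⟨A, hA⟩ := h.exists_coeff_le hm hc (v := 1 / 4) (by norm_num)
  have hA0 : 0 ≤ A := nonneg_of_mul_nonneg_left ((norm_nonneg _).trans (hA 0 0)) (Real.exp_pos _)
  have hpi := Real.pi_pos
  obtain ⟨C, hC0, hC⟩ := exists_rpow_mul_exp_neg_le ((k : ℝ) / 2) (a := Real.pi * 1 / (8 * m))
    (by positivity)
  have hN : ∀ n r, c n r ≠ 0 → (1 : ℝ) ≤ jacobiDisc m n r := by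
    intro n r hnr
    rw [jacobiDisc]
    exact_mod_cast Int.add_one_le_iff.mpr (hc0 n r hnr)
  refine ⟨A * C * ∑' i, siegelTerm m i, jacobiNorm_le_of_siegelSet h.slash_eq
    fun p hp => (hc.jacobiNorm_le hm one_pos hA hN hp.2.1 ?_ hp.2.2.1 hp.2.2.2).trans ?_⟩
  · linarith [hp.2.1]
  · refine mul_le_mul_of_nonneg_right ?_ (tsum_siegelTerm_pos hm).le
    rw [mul_assoc]
    exact mul_le_mul_of_nonneg_left (hC _ hp.2.1) hA0

/-! ### Finite dimension -/

/-- A cusp form whose Fourier coefficients vanish up to a certain discriminant, which depends only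
on the weight and the index, is zero: its supremum norm is at most half of itself. -/
theorem exists_forall_eq_zero_of_coeff_eq_zero (k : ℕ) {m : ℕ} (hm : 0 < m) :
    ∃ N : ℝ, ∀ (φ : ℍ × ℂ → ℂ) (c : ℤ → ℤ → ℂ), IsJacobiCuspForm k m φ →
      HasJacobiFourierExpansion φ c → (∀ n r, c n r ≠ 0 → N ≤ jacobiDisc m n r) → φ = 0 := by
  have hpi := Real.pi_pos
  have hm' : (0 : ℝ) < m := by positivity
  set K := ∑' i, siegelTerm m i with hK
  have hK0 : 0 < K := tsum_siegelTerm_pos hm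
  -- the decay that turns the bound `M` into `M / 2`
  set ε : ℝ := (2 * ((2 : ℝ) ^ ((k : ℝ) / 2) * K))⁻¹ with hε
  have hε0 : 0 < ε := by positivity
  refine ⟨max 1 (16 * m / Real.pi * (-Real.log ε)), fun φ c h hc hN => ?_⟩
  set N := max 1 (16 * m / Real.pi * (-Real.log ε)) with hNdef
  have hN0 : 0 < N := lt_of_lt_of_le one_pos (le_max_left _ _)
  have hexp : Real.exp (-(Real.pi * N / (8 * m)) * (1 / 2)) ≤ ε := by
    rw [← Real.le_log_iff_exp_le hε0]
    have : 16 * m / Real.pi * (-Real.log ε) ≤ N := le_max_right _ _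
    rw [div_mul_eq_mul_div, div_le_iff₀ hpi] at this
    have h2 : -(Real.pi * N / (8 * m)) * (1 / 2) = -(N * Real.pi / (16 * m)) := by
      field_simp; ring
    rw [h2, neg_le, le_div_iff₀ (by positivity)]
    linarith
  obtain ⟨M₀, hM₀⟩ := h.exists_jacobiNorm_le hm
  have hhalf : ∀ M : ℝ, (∀ p, jacobiNorm k m φ p ≤ M) → ∀ p, jacobiNorm k m φ p ≤ M / 2 := by
    intro M hM
    have hM0 : 0 ≤ M := (jacobiNorm_nonneg k m φ (⟨Complex.I, by simp⟩, 0)).trans (hM _)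
    refine jacobiNorm_le_of_siegelSet h.slash_eq fun p hp => ?_
    have hv := p.1.im_pos
    have hA := fun n r => hc.norm_coeff_le_of_jacobiNorm_le (k := k) hm (half_pos hv) n r (B := M)
      fun s _ => hM _
    refine (hc.jacobiNorm_le hm hN0 hA hN hp.2.1 le_rfl hp.2.2.1 hp.2.2.2).trans ?_
    have h1 : (p.1.im / 2) ^ (-((k : ℝ) / 2)) * p.1.im ^ ((k : ℝ) / 2) = 2 ^ ((k : ℝ) / 2) := by
      rw [Real.rpow_neg (by positivity), Real.div_rpow hv.le (by norm_num)]
      have := Real.rpow_pos_of_pos hv ((k : ℝ) / 2)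
      field_simp
    have h2 : Real.exp (-(Real.pi * N / (8 * m)) * p.1.im) ≤ ε := by
      refine le_trans (Real.exp_le_exp.mpr ?_) hexp
      have : Real.pi * N / (8 * m) * (1 / 2) ≤ Real.pi * N / (8 * m) * p.1.im := by
        have := hp.2.1
        gcongr
      linarith
    calc M * (p.1.im / 2) ^ (-((k : ℝ) / 2)) * p.1.im ^ ((k : ℝ) / 2) *
          Real.exp (-(Real.pi * N / (8 * m)) * p.1.im) * K
        = M * 2 ^ ((k : ℝ) / 2) * Real.exp (-(Real.pi * N / (8 * m)) * p.1.im) * K := by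
          rw [mul_assoc M, h1]
      _ ≤ M * 2 ^ ((k : ℝ) / 2) * ε * K := by gcongr
      _ = M / 2 := by rw [hε]; field_simp
  have hpow : ∀ j : ℕ, ∀ p, jacobiNorm k m φ p ≤ M₀ / 2 ^ j := by
    intro j
    induction j with
    | zero => simpa using hM₀
    | succ j ih =>
      intro p
      have := hhalf _ ih p
      rwa [div_div, ← pow_succ] at this
  ext p
  have hlim : Filter.Tendsto (fun j : ℕ => M₀ / 2 ^ j) Filter.atTop (nhds 0) := by
    have := (tendsto_pow_atTop_nhds_zero_of_lt_one (r := (1 / 2 : ℝ)) (by norm_num)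
      (by norm_num)).const_mul M₀
    simpa [div_eq_mul_inv] using this
  have h0 : jacobiNorm k m φ p ≤ 0 := ge_of_tendsto' hlim fun j => hpow j p
  have h1 : jacobiNorm k m φ p = 0 := le_antisymm h0 (jacobiNorm_nonneg _ _ _ _)
  rw [jacobiNorm, mul_eq_zero, norm_eq_zero] at h1
  exact h1.resolve_right (jacobiWeight_pos k m p).ne'

/-- The Fourier coefficients `c(n, r)` depend only on `4 n m - r ^ 2` and `r` modulo `2 m`. -/
theorem HasJacobiFourierExpansion.coeff_add {φ : ℍ × ℂ → ℂ} {c : ℤ → ℤ → ℂ} {k m : ℕ}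
    (h : HasJacobiFourierExpansion φ c) (hφ : ∀ g, jacobiSlash k m φ g = φ) (lam n r : ℤ) :
    c (n + lam * r + m * lam ^ 2) (r + 2 * m * lam) = c n r := by
  let e : ℤ × ℤ ≃ ℤ × ℤ :=
    { toFun := fun i => (i.1 + lam * i.2 + m * lam ^ 2, i.2 + 2 * m * lam)
      invFun := fun i => (i.1 - lam * (i.2 - 2 * m * lam) - m * lam ^ 2, i.2 - 2 * m * lam)
      left_inv := fun i => Prod.ext (by simp; ring) (by simp)
      right_inv := fun i => Prod.ext (by simp; ring) (by simp) }
  have h' : HasJacobiFourierExpansion φ fun n r => c (e.symm (n, r)).1 (e.symm (n, r)).2 := by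
    rw [hasJacobiFourierExpansion_iff] at h ⊢
    intro p
    rw [← e.hasSum_iff]
    have h1 := (h ((⟨1, lam, 0⟩ : JacobiGroup) • p)).mul_left
      (JacobiGroup.autoFactor k m ⟨1, lam, 0⟩ p)
    rw [← JacobiGroup.jacobiSlash_apply, hφ] at h1
    refine h1.congr_fun fun i => ?_
    have h2 : (e i).1 = i.1 + lam * i.2 + m * lam ^ 2 := rfl
    have h3 : (e i).2 = i.2 + 2 * m * lam := rfl
    simp only [Function.comp, Prod.mk.eta, Equiv.symm_apply_apply]
    rw [mul_left_comm]
    congr 1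
    rw [jacobiExp, jacobiExp, JacobiGroup.autoFactor, h2, h3, JacobiGroup.smul_snd,
      JacobiGroup.smul_fst]
    simp only [JacobiGroup.den, JacobiGroup.expo]
    simp only [one_smul]
    simp only [Matrix.SpecialLinearGroup.coe_one, Matrix.one_apply_eq, Int.cast_one,
      Matrix.one_apply_ne (show (1 : Fin 2) ≠ 0 by decide), Int.cast_zero, zero_mul, zero_add,
      one_zpow, one_mul, div_one, add_zero, neg_zero]
    rw [← Complex.exp_add]
    congr 1
    push_cast
    ring
  have h2 := congrFun (congrFun (h.unique h') (e (n, r)).1) (e (n, r)).2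
  simp only [Prod.mk.eta, Equiv.symm_apply_apply] at h2
  exact h2

namespace JacobiCuspForms

variable {k m : ℕ}

theorem isJacobiCuspForm (φ : JacobiCuspForms k m) : IsJacobiCuspForm k m φ := φ.2

/-- The Fourier coefficients of a Jacobi cusp form. -/
def coeff (φ : JacobiCuspForms k m) : ℤ → ℤ → ℂ := (isJacobiCuspForm φ).cusp.choose

theorem hasJacobiFourierExpansion (φ : JacobiCuspForms k m) :
    HasJacobiFourierExpansion φ (coeff φ) := (isJacobiCuspForm φ).cusp.choose_spec.1

theorem disc_pos_of_coeff_ne_zero (φ : JacobiCuspForms k m) (n r : ℤ) (h : coeff φ n r ≠ 0) :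
    0 < 4 * n * m - r ^ 2 := (isJacobiCuspForm φ).cusp.choose_spec.2 n r h

/-- A Fourier coefficient as a linear functional. -/
def coeffLinear (n r : ℤ) : JacobiCuspForms k m →ₗ[ℂ] ℂ where
  toFun φ := coeff φ n r
  map_add' φ ψ := by
    have h : HasJacobiFourierExpansion (φ + ψ : JacobiCuspForms k m)
        fun n r => coeff φ n r + coeff ψ n r := by
      intro τ z
      simpa [add_mul] using
        (hasJacobiFourierExpansion φ τ z).add (hasJacobiFourierExpansion ψ τ z)
    rw [(hasJacobiFourierExpansion _).unique h]
  map_smul' a φ := by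
    have h : HasJacobiFourierExpansion (a • φ : JacobiCuspForms k m)
        fun n r => a * coeff φ n r := by
      intro τ z
      simpa [mul_assoc] using (hasJacobiFourierExpansion φ τ z).mul_left a
    rw [(hasJacobiFourierExpansion _).unique h]
    rfl

/-- Only finitely many pairs `(n, r)` with `r` reduced modulo `2 m` have small discriminant, and the
coefficients at these pairs determine the form. -/
theorem finiteDimensional (k : ℕ) {m : ℕ} (hm : 0 < m) :
    FiniteDimensional ℂ (JacobiCuspForms k m) := by
  obtain ⟨N, hN⟩ := exists_forall_eq_zero_of_coeff_eq_zero k hm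
  set A : ℕ := ⌈N + 4 * m ^ 2⌉₊ with hA
  let f : JacobiCuspForms k m →ₗ[ℂ] (Fin A × Fin (2 * m) → ℂ) :=
    LinearMap.pi fun i => coeffLinear i.1 i.2
  have hf : Function.Injective f := by
    rw [← LinearMap.ker_eq_bot, LinearMap.ker_eq_bot']
    intro φ hφ
    refine Subtype.ext (hN φ (coeff φ) (isJacobiCuspForm φ) (hasJacobiFourierExpansion φ)
      fun n r hnr => ?_)
    by_contra hlt
    push Not at hlt
    -- move `r` to its residue modulo `2 m`
    set lam : ℤ := -(r / (2 * m)) with hlam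
    have hm2 : (0 : ℤ) < 2 * m := by omega
    have hr : r + 2 * m * lam = r % (2 * m) := by
      have := Int.emod_add_mul_ediv r (2 * m)
      rw [hlam]; linear_combination -this
    have hc := (hasJacobiFourierExpansion φ).coeff_add (isJacobiCuspForm φ).slash_eq lam n r
    rw [hr] at hc
    set n' := n + lam * r + m * lam ^ 2 with hn'
    have h0 := Int.emod_nonneg r hm2.ne'
    have h1 := Int.emod_lt_of_pos r hm2
    have hdisc : 4 * n' * m - (r % (2 * m)) ^ 2 = 4 * n * m - r ^ 2 := by
      rw [← hr, hn']; ring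
    have hpos := disc_pos_of_coeff_ne_zero φ n r hnr
    have hn0 : 0 < n' := by
      have : 0 < n' * (4 * m) := by nlinarith [sq_nonneg (r % (2 * m))]
      exact pos_of_mul_pos_left this (by positivity)
    have hnA : n' < A := by
      have h2 : ((4 * n' * m - (r % (2 * m)) ^ 2 : ℤ) : ℝ) < N := by
        rw [hdisc]
        refine lt_of_eq_of_lt ?_ hlt
        rw [jacobiDisc]; push_cast; ring
      have h3 : ((r % (2 * m) : ℤ) : ℝ) ≤ 2 * m := by exact_mod_cast h1.le
      have h4 : (0 : ℝ) ≤ ((r % (2 * m) : ℤ) : ℝ) := by exact_mod_cast h0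
      have h5 : (1 : ℝ) ≤ m := by exact_mod_cast hm
      have h6 : (0 : ℝ) < n' := by exact_mod_cast hn0
      have h7 : (n' : ℝ) < A := by
        refine lt_of_lt_of_le ?_ (Nat.le_ceil _)
        push_cast at h2
        nlinarith
      exact_mod_cast h7
    have hz := congrFun hφ (⟨n'.toNat, by omega⟩, ⟨(r % (2 * m)).toNat, by omega⟩)
    have hz' : (coeff φ) (n'.toNat : ℤ) ((r % (2 * m)).toNat : ℤ) = 0 := hz
    rw [Int.toNat_of_nonneg hn0.le, Int.toNat_of_nonneg h0, hc] at hz'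
    exact hnr hz'
  exact Module.Finite.of_injective f hf

end JacobiCuspForms

/-! ### The Petersson scalar product -/

theorem continuous_jacobiPeterssonIntegrand (k m : ℕ) {φ ψ : ℍ × ℂ → ℂ} (hφ : Continuous φ)
    (hψ : Continuous ψ) : Continuous (jacobiPeterssonIntegrand k m φ ψ) := by
  have h1 : Continuous fun p : ℍ × ℂ => p.1.im := UpperHalfPlane.continuous_im.comp continuous_fst
  have h2 : Continuous fun p : ℍ × ℂ => p.2.im := Complex.continuous_im.comp continuous_snd
  refine (hφ.mul (Complex.continuous_conj.comp hψ)).mul (Complex.continuous_ofReal.comp ?_)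
  exact (h1.pow k).mul (Real.continuous_exp.comp
    ((continuous_const.mul (h2.pow 2)).div h1 fun p => p.1.im_pos.ne'))

theorem IsJacobiCuspForm.integrableOn_petersson {k m : ℕ} (hm : 0 < m) {φ ψ : ℍ × ℂ → ℂ}
    (hφ : IsJacobiCuspForm k m φ) (hψ : IsJacobiCuspForm k m ψ) {F : Set (ℍ × ℂ)}
    (hF : IsFundamentalDomain JacobiGroup F jacobiMeasure) :
    IntegrableOn (jacobiPeterssonIntegrand k m φ ψ) F jacobiMeasure := by
  obtain ⟨M, hM⟩ := hφ.exists_jacobiNorm_le hm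
  obtain ⟨M', hM'⟩ := hψ.exists_jacobiNorm_le hm
  have hc := continuous_jacobiPeterssonIntegrand k m hφ.jacobiHolomorphic.continuous
    hψ.jacobiHolomorphic.continuous
  refine Measure.integrableOn_of_bounded (M := M * M')
    (jacobiMeasure_fundamentalDomain_lt_top hF).ne hc.aestronglyMeasurable
    (Filter.Eventually.of_forall fun p => ?_)
  rw [norm_jacobiPeterssonIntegrand]
  exact mul_le_mul (hM p) (hM' p) (jacobiNorm_nonneg _ _ _ _)
    ((jacobiNorm_nonneg _ _ _ p).trans (hM p))

theorem jacobiHeightMeasure_ne_zero : jacobiHeightMeasure ≠ 0 := by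
  intro h
  have h1 := lintegral_jacobiHeightMeasure (f := fun _ => 1) measurable_const
  have h2 : ∀ v ∈ Set.Ioi (0 : ℝ), ∫⁻ _ : ℝ, ENNReal.ofReal (1 / v ^ 3) * 1 = ⊤ := by
    intro v hv
    have hv' : (0 : ℝ) < v := hv
    rw [mul_one, lintegral_const, Real.volume_univ, ENNReal.mul_top]
    exact (ENNReal.ofReal_pos.mpr (by positivity)).ne'
  rw [h, lintegral_zero_measure, setLIntegral_congr_fun measurableSet_Ioi h2] at h1
  simp at h1

/-- A form with a Fourier expansion that vanishes almost everywhere vanishes. -/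
theorem HasJacobiFourierExpansion.eq_zero_of_ae {φ : ℍ × ℂ → ℂ} {c : ℤ → ℤ → ℂ}
    (h : HasJacobiFourierExpansion φ c) (h0 : ∀ᵐ p ∂jacobiMeasure, φ p = 0) : φ = 0 := by
  have h1 : ∀ᵐ x ∂(jacobiHeightMeasure.prod unitSquare),
      φ (jacobiPt x.1.1 x.1.2 x.2) = 0 := by
    rw [← measurePreserving_jacobiCoord.map_eq, measurableEmbedding_jacobiCoord.ae_map_iff]
    filter_upwards [ae_restrict_of_ae h0] with p hp
    rw [← hp]
    exact congrArg φ (eq_jacobiPt p).symm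
  have h2 := Measure.ae_ae_of_ae_prod h1
  have : (ae jacobiHeightMeasure).NeBot := ae_neBot.mpr jacobiHeightMeasure_ne_zero
  obtain ⟨w, hw, hw0⟩ := (h2.and ae_jacobiHeightMeasure_pos).exists
  have hc : ∀ n r, c n r = 0 := by
    intro n r
    have h3 := h.coeff_eq_integral hw0 w.2 n r
    rw [integral_eq_zero_of_ae (by filter_upwards [hw] with s hs; simp [hs])] at h3
    refine (mul_eq_zero.mp h3).resolve_right ?_
    exact Complex.ofReal_ne_zero.mpr (Real.exp_pos _).ne'
  ext p
  have h4 := hasJacobiFourierExpansion_iff.mp h p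
  simp only [hc, zero_mul] at h4
  exact h4.unique hasSum_zero

theorem jacobiPeterssonIntegrand_self (k m : ℕ) (φ : ℍ × ℂ → ℂ) (p : ℍ × ℂ) :
    jacobiPeterssonIntegrand k m φ φ p = ((jacobiNorm k m φ p ^ 2 : ℝ) : ℂ) := by
  rw [jacobiPeterssonIntegrand_eq, Complex.mul_conj', jacobiNorm]
  push_cast
  ring

theorem jacobiPetersson_self (k m : ℕ) (F : Set (ℍ × ℂ)) (φ : ℍ × ℂ → ℂ) :
    jacobiPetersson k m F φ φ = ((∫ p in F, jacobiNorm k m φ p ^ 2 ∂jacobiMeasure : ℝ) : ℂ) := by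
  rw [jacobiPetersson, ← integral_complex_ofReal]
  exact integral_congr_ae (Filter.Eventually.of_forall fun p => jacobiPeterssonIntegrand_self ..)

theorem conj_jacobiPetersson (k m : ℕ) (F : Set (ℍ × ℂ)) (φ ψ : ℍ × ℂ → ℂ) :
    conj (jacobiPetersson k m F φ ψ) = jacobiPetersson k m F ψ φ := by
  rw [jacobiPetersson, ← integral_conj, jacobiPetersson]
  congr 1
  ext p
  rw [jacobiPeterssonIntegrand_eq, jacobiPeterssonIntegrand_eq]
  simp only [map_mul, Complex.conj_conj, Complex.conj_ofReal]
  ring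

/-- The Petersson scalar product as an inner product; the first argument of an inner product is the
conjugate linear one. -/
@[reducible]
def jacobiCore (k : ℕ) {m : ℕ} (hm : 0 < m) {F : Set (ℍ × ℂ)}
    (hF : IsFundamentalDomain JacobiGroup F jacobiMeasure) :
    InnerProductSpace.Core ℂ (JacobiCuspForms k m) where
  inner φ ψ := jacobiPetersson k m F ψ φ
  conj_inner_symm φ ψ := conj_jacobiPetersson k m F φ ψ
  re_inner_nonneg φ := by
    rw [jacobiPetersson_self]
    exact integral_nonneg fun p => sq_nonneg (jacobiNorm k m φ p)
  add_left φ ψ χ := by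
    simp only [jacobiPetersson]
    rw [← integral_add
      ((JacobiCuspForms.isJacobiCuspForm χ).integrableOn_petersson hm
        (JacobiCuspForms.isJacobiCuspForm φ) hF)
      ((JacobiCuspForms.isJacobiCuspForm χ).integrableOn_petersson hm
        (JacobiCuspForms.isJacobiCuspForm ψ) hF)]
    congr 1
    ext p
    simp only [jacobiPeterssonIntegrand, Submodule.coe_add, Pi.add_apply, map_add]
    ring
  smul_left φ ψ a := by
    simp only [jacobiPetersson]
    rw [← integral_const_mul]
    congr 1
    ext p
    simp only [jacobiPeterssonIntegrand, Submodule.coe_smul, Pi.smul_apply, smul_eq_mul, map_mul]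
    ring
  definite φ h := by
    have h' : ∫ p in F, jacobiNorm k m φ p ^ 2 ∂jacobiMeasure = 0 := by
      rw [jacobiPetersson_self] at h
      exact_mod_cast h
    have hi : IntegrableOn (fun p => jacobiNorm k m φ p ^ 2) F jacobiMeasure := by
      have := ((JacobiCuspForms.isJacobiCuspForm φ).integrableOn_petersson hm
        (JacobiCuspForms.isJacobiCuspForm φ) hF).norm
      refine this.congr (Filter.Eventually.of_forall fun p => ?_)
      change ‖jacobiPeterssonIntegrand k m φ φ p‖ = _
      rw [norm_jacobiPeterssonIntegrand, ← sq]
    rw [integral_eq_zero_iff_of_nonneg (fun p => sq_nonneg _) hi] at h'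
    have hz : ∀ p, jacobiNorm k m φ p ^ 2 = 0 ↔ (φ : ℍ × ℂ → ℂ) p = 0 := by
      intro p
      rw [sq_eq_zero_iff, jacobiNorm, mul_eq_zero, norm_eq_zero]
      exact or_iff_left (jacobiWeight_pos k m p).ne'
    have hS : jacobiMeasure ({p | (φ : ℍ × ℂ → ℂ) p ≠ 0} ∩ F) = 0 := by
      have hm : MeasurableSet {p | (φ : ℍ × ℂ → ℂ) p ≠ 0} :=
        (isOpen_ne_fun (JacobiCuspForms.isJacobiCuspForm φ).jacobiHolomorphic.continuous
          continuous_const).measurableSet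
      rw [← Measure.restrict_apply hm]
      refine measure_mono_null (fun p hp => ?_) (ae_iff.mp h')
      exact fun h0 => hp ((hz p).mp h0)
    have hinv : ∀ (g : JacobiGroup) p, (φ : ℍ × ℂ → ℂ) (g • p) = 0 ↔ (φ : ℍ × ℂ → ℂ) p = 0 := by
      intro g p
      rw [← hz, ← hz, jacobiNorm_smul (JacobiCuspForms.isJacobiCuspForm φ).slash_eq]
    have hnull := hF.measure_zero_of_invariant {p | (φ : ℍ × ℂ → ℂ) p ≠ 0} (fun g => by
      ext p
      rw [Set.mem_smul_set_iff_inv_smul_mem]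
      exact not_congr (hinv g⁻¹ p)) hS
    refine Subtype.ext ((JacobiCuspForms.hasJacobiFourierExpansion φ).eq_zero_of_ae (ae_iff.mpr ?_))
    exact hnull

/-- The adjoint of a linear map between finite-dimensional spaces, for inner products that are given
as explicit data. -/
theorem exists_adjoint_of_core {V W : Type*} [AddCommGroup V] [Module ℂ V] [FiniteDimensional ℂ V]
    [AddCommGroup W] [Module ℂ W] [FiniteDimensional ℂ W] (cV : InnerProductSpace.Core ℂ V)
    (cW : InnerProductSpace.Core ℂ W) (L : V →ₗ[ℂ] W) :
    ∃ T : W →ₗ[ℂ] V, ∀ φ f, cV.inner f (T φ) = cW.inner (L f) φ := by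
  let _ := cV.toNormedAddCommGroup
  let _ := InnerProductSpace.ofCore cV.toCore
  let _ := cW.toNormedAddCommGroup
  let _ := InnerProductSpace.ofCore cW.toCore
  exact ⟨LinearMap.adjoint L, fun φ f => LinearMap.adjoint_inner_right L f φ⟩

theorem isPeterssonAdjoint_unique {k m : ℕ} (hm : 0 < m) {F : Set (ℍ × ℂ)}
    (hF : IsFundamentalDomain JacobiGroup F jacobiMeasure)
    {L : JacobiCuspForms k m →ₗ[ℂ] JacobiCuspForms (k + 2) m}
    {T T' : JacobiCuspForms (k + 2) m →ₗ[ℂ] JacobiCuspForms k m}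
    (hT : IsPeterssonAdjoint k m F L T) (hT' : IsPeterssonAdjoint k m F L T') : T' = T := by
  let _ := (jacobiCore k hm hF).toNormedAddCommGroup
  let _ := InnerProductSpace.ofCore (jacobiCore k hm hF).toCore
  refine LinearMap.ext fun φ => ext_inner_left ℂ fun f => ?_
  exact (hT' φ f).trans (hT φ f).symm

/-! ### Convergence of the Poincaré series -/

/-- A summable majorant, on the classifying triples `(c, d, κ)` of the cosets of translations. The
sums over `(c, d)` and over `κ` converge because `5 / 2 > 2` and `3 / 2 > 1`, and a term of weight
at least `4` is dominated because `5 / 2 + 3 / 2 = 4`. -/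
def cosetMajorant (x : ℤ × ℤ × ℤ) : ℝ :=
  ‖((x.1, x.2.1) : ℤ × ℤ)‖ ^ (-(5 / 2) : ℝ) * (1 + (x.2.2 : ℝ) ^ 2) ^ (-(3 / 4) : ℝ)

theorem cosetMajorant_nonneg (x : ℤ × ℤ × ℤ) : 0 ≤ cosetMajorant x := by
  unfold cosetMajorant; positivity

theorem summable_cosetMajorant : Summable cosetMajorant := by
  have h1 : Summable fun x : ℤ × ℤ => ‖x‖ ^ (-(5 / 2) : ℝ) := by
    have h := EisensteinSeries.summable_one_div_norm_rpow (k := 5 / 2) (by norm_num)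
    rw [← (finTwoArrowEquiv ℤ).symm.summable_iff] at h
    refine h.congr fun x => ?_
    have h3 : ‖(finTwoArrowEquiv ℤ).symm x‖ = ‖x‖ := by
      refine le_antisymm ((pi_norm_le_iff_of_nonneg (norm_nonneg x)).mpr fun i => ?_)
        (max_le (norm_le_pi_norm ((finTwoArrowEquiv ℤ).symm x) 0)
          (norm_le_pi_norm ((finTwoArrowEquiv ℤ).symm x) 1))
      fin_cases i
      · exact norm_fst_le x
      · exact norm_snd_le x
    rw [Function.comp, h3]
  have h2 : Summable fun x : ℤ => (1 + (x : ℝ) ^ 2) ^ (-(3 / 4) : ℝ) := by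
    have h := Real.summable_abs_int_rpow (b := 3 / 2) (by norm_num)
    refine h.of_norm_bounded_eventually ?_
    filter_upwards [(Set.finite_singleton (0 : ℤ)).compl_mem_cofinite] with n hn
    have hn0 : (0 : ℝ) < |(n : ℝ)| := abs_pos.mpr (Int.cast_ne_zero.mpr hn)
    rw [Real.norm_of_nonneg (by positivity),
      show (-(3 / 2) : ℝ) = (2 : ℕ) * (-(3 / 4) : ℝ) by norm_num, Real.rpow_mul (abs_nonneg _),
      Real.rpow_natCast, sq_abs]
    refine Real.rpow_le_rpow_of_nonpos (by rw [← sq_abs]; positivity) ?_ (by norm_num)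
    linarith
  have h := h1.mul_of_nonneg h2 (fun _ => by positivity) (fun _ => by positivity)
  rw [← (Equiv.prodAssoc ℤ ℤ ℤ).symm.summable_iff] at h
  exact h

/-- The Gaussian decay in `κ` has width `N`, so that a power of `κ` is traded for a power of `N`. -/
theorem exp_neg_le_majorant {X κ θ N B ε δ : ℝ} (hN : 1 ≤ N) (hε : 0 < ε)
    (h1 : ε * (1 + 2 * B ^ 2) ≤ 1) (h2 : 2 * ε ≤ δ) (hθ : |θ| ≤ B * N)
    (hX : δ * (κ + θ) ^ 2 / N ^ 2 ≤ X) :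
    Real.exp (-X) ≤ ε ^ (-(3 / 4) : ℝ) * (N ^ (3 / 2 : ℝ) * (1 + κ ^ 2) ^ (-(3 / 4) : ℝ)) := by
  have hN0 : 0 < N := by linarith
  have hX0 : 0 ≤ X := le_trans (by have : 0 ≤ δ := by linarith
                                   positivity) hX
  set Y := ε⁻¹ * (N ^ 2 * (1 + κ ^ 2)⁻¹) with hY
  have hY0 : 0 < Y := by positivity
  have hθ2 : θ ^ 2 ≤ B ^ 2 * N ^ 2 := by
    rw [← sq_abs, ← mul_pow]; gcongr
  have hκ : κ ^ 2 ≤ 2 * (κ + θ) ^ 2 + 2 * θ ^ 2 := by nlinarith [sq_nonneg (κ + 2 * θ)]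
  have h3 : ε * (1 + κ ^ 2) ≤ N ^ 2 * (1 + X) := by
    rw [div_le_iff₀ (by positivity)] at hX
    have e1 : ε * κ ^ 2 ≤ ε * (2 * (κ + θ) ^ 2 + 2 * (B ^ 2 * N ^ 2)) := by gcongr; linarith
    have e2 : 2 * ε * (κ + θ) ^ 2 ≤ δ * (κ + θ) ^ 2 := by gcongr
    have e3 : ε * (1 + 2 * B ^ 2) * N ^ 2 ≤ 1 * N ^ 2 := by gcongr
    have e4 : ε * 1 ≤ ε * N ^ 2 := by
      gcongr; nlinarith
    nlinarith
  have h4 : Real.exp (-X) ≤ Y := by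
    rw [Real.exp_neg]
    have h5 : Y⁻¹ ≤ Real.exp X := by
      have h6 : Y⁻¹ ≤ 1 + X := by
        rw [hY, mul_inv, inv_inv, mul_inv, inv_inv, mul_comm (N ^ 2)⁻¹, ← mul_assoc,
          ← div_eq_mul_inv, div_le_iff₀ (by positivity)]
        linarith
      linarith [Real.add_one_le_exp X]
    exact inv_le_of_inv_le₀ hY0 h5
  have h7 : Real.exp (-X) ≤ 1 := Real.exp_le_one_iff.mpr (by linarith)
  calc Real.exp (-X) ≤ Real.exp (-X) ^ (3 / 4 : ℝ) :=
        Real.self_le_rpow_of_le_one (Real.exp_pos _).le h7 (by norm_num)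
    _ ≤ Y ^ (3 / 4 : ℝ) := Real.rpow_le_rpow (Real.exp_pos _).le h4 (by norm_num)
    _ = _ := by
        rw [hY, Real.mul_rpow (by positivity) (by positivity), Real.mul_rpow (by positivity)
          (by positivity), Real.inv_rpow hε.le, Real.inv_rpow (by positivity),
          Real.rpow_neg hε.le, Real.rpow_neg (by positivity), ← Real.rpow_natCast N,
          ← Real.rpow_mul hN0.le]
        norm_num

namespace JacobiGroup

/-- The maximum norm of the lower row of the matrix. -/
def rowNorm (g : JacobiGroup) : ℝ := ‖((g.mat 1 0, g.mat 1 1) : ℤ × ℤ)‖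

theorem abs_le_rowNorm (g : JacobiGroup) :
    |(g.mat 1 0 : ℝ)| ≤ g.rowNorm ∧ |(g.mat 1 1 : ℝ)| ≤ g.rowNorm := by
  rw [rowNorm, Prod.norm_def]
  exact ⟨(Int.norm_eq_abs _).symm.le.trans (le_max_left _ _),
    (Int.norm_eq_abs _).symm.le.trans (le_max_right _ _)⟩

theorem one_le_rowNorm (g : JacobiGroup) : 1 ≤ g.rowNorm := by
  have h : g.mat 1 0 ≠ 0 ∨ g.mat 1 1 ≠ 0 := by
    by_contra! h
    have hd := g.det_eq
    rw [h.1, h.2] at hd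
    simp at hd
  have h1 : ∀ n : ℤ, n ≠ 0 → (1 : ℝ) ≤ |(n : ℝ)| := fun n hn => by
    exact_mod_cast Int.one_le_abs hn
  rcases h with h | h
  · exact (h1 _ h).trans g.abs_le_rowNorm.1
  · exact (h1 _ h).trans g.abs_le_rowNorm.2

theorem norm_den_le (g : JacobiGroup) (τ : ℍ) : ‖g.den τ‖ ≤ (‖(τ : ℂ)‖ + 1) * g.rowNorm := by
  obtain ⟨h1, h2⟩ := g.abs_le_rowNorm
  refine (norm_add_le _ _).trans ?_
  rw [norm_mul, Complex.norm_intCast, Complex.norm_intCast, add_mul, one_mul, mul_comm]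
  gcongr

theorem abs_mul_im_le_norm_den (g : JacobiGroup) (τ : ℍ) :
    |(g.mat 1 0 : ℝ)| * τ.im ≤ ‖g.den τ‖ := by
  have h : (g.den τ).im = g.mat 1 0 * τ.im := by simp [den]
  rw [← abs_of_pos τ.im_pos, ← abs_mul, ← h]
  exact Complex.abs_im_le_norm _

/-- `max (|c|, |d|)` is bounded by `|c τ + d|`, locally uniformly in `τ`. -/
theorem rowNorm_le (g : JacobiGroup) (τ : ℍ) :
    g.rowNorm ≤ (1 + (‖(τ : ℂ)‖ + 1) / τ.im) * ‖g.den τ‖ := by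
  have hv := τ.im_pos
  have h1 : |(g.mat 1 0 : ℝ)| ≤ ‖g.den τ‖ / τ.im :=
    (le_div_iff₀ hv).mpr (g.abs_mul_im_le_norm_den τ)
  have h2 : |(g.mat 1 1 : ℝ)| ≤ ‖g.den τ‖ + |(g.mat 1 0 : ℝ)| * ‖(τ : ℂ)‖ := by
    have : ((g.mat 1 1 : ℤ) : ℂ) = g.den τ - (g.mat 1 0 : ℂ) * τ := by simp [den]
    rw [← Complex.norm_intCast, this]
    refine (norm_sub_le _ _).trans_eq ?_
    rw [norm_mul, Complex.norm_intCast]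
  have h3 : |(g.mat 1 0 : ℝ)| * ‖(τ : ℂ)‖ ≤ ‖g.den τ‖ / τ.im * ‖(τ : ℂ)‖ := by gcongr
  have h4 : 0 ≤ ‖g.den τ‖ / τ.im := by positivity
  have h5 : 0 ≤ ‖g.den τ‖ / τ.im * ‖(τ : ℂ)‖ := by positivity
  have h6 : (1 + (‖(τ : ℂ)‖ + 1) / τ.im) * ‖g.den τ‖ =
      ‖g.den τ‖ + ‖g.den τ‖ / τ.im * ‖(τ : ℂ)‖ + ‖g.den τ‖ / τ.im := by field_simp; ring
  rw [h6, rowNorm, Prod.norm_def]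
  refine max_le ?_ ?_
  · refine (Int.norm_eq_abs _).le.trans ?_
    linarith [norm_nonneg (g.den τ)]
  · refine (Int.norm_eq_abs _).le.trans ?_
    linarith

end JacobiGroup

/-- The size of a term of a Poincaré series; `ε` has to be small in terms of `p`. -/
theorem jacobiNorm_slash_jacobiExp_le {k m : ℕ} (hm : 0 < m) (n r : ℤ) (g : JacobiGroup)
    (p : ℍ × ℂ) {ε : ℝ} (hε : 0 < ε)
    (h1 : ε * (1 + 2 * (|jacobiAlpha p| + |jacobiBeta p| + |(r : ℝ) / (2 * m)|) ^ 2) ≤ 1)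
    (h2 : 2 * ε ≤ 2 * Real.pi * m * p.1.im / (‖(p.1 : ℂ)‖ + 1) ^ 2) :
    jacobiNorm k m (jacobiSlash k m (jacobiExp n r) g) p ≤ p.1.im ^ ((k : ℝ) / 2) *
      (‖g.den p.1‖ ^ k)⁻¹ *
      Real.exp (-(Real.pi * jacobiDisc m n r / (2 * m) * (p.1.im / ‖g.den p.1‖ ^ 2))) *
      (ε ^ (-(3 / 4) : ℝ) * (g.rowNorm ^ (3 / 2 : ℝ) *
        (1 + (g.key.2.2 : ℝ) ^ 2) ^ (-(3 / 4) : ℝ))) := by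
  have hm' : (0 : ℝ) < m := by positivity
  have hv := p.1.im_pos
  have hpi := Real.pi_pos
  have hden : 0 < ‖g.den p.1‖ := norm_pos_iff.mpr (JacobiGroup.den_ne_zero g p.1)
  have hN := g.one_le_rowNorm
  rw [jacobiNorm_slash, jacobiNorm, norm_jacobiExp_mul_weight hm, JacobiGroup.im_smul,
    sub_eq_add_neg, Real.exp_add, Real.div_rpow hv.le (by positivity), ← mul_assoc]
  have h3 : (‖g.den p.1‖ ^ 2) ^ ((k : ℝ) / 2) = ‖g.den p.1‖ ^ k := by
    rw [← Real.rpow_natCast, ← Real.rpow_mul hden.le, ← Real.rpow_natCast]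
    congr 1; push_cast; ring
  rw [h3, div_eq_mul_inv (p.1.im ^ ((k : ℝ) / 2))]
  refine mul_le_mul_of_nonneg_left ?_ (by positivity)
  set θ : ℝ := jacobiAlpha p * g.mat 1 1 - jacobiBeta p * g.mat 1 0 + (r : ℝ) / (2 * m) with hθ
  have hal : jacobiAlpha (g • p) + (r : ℝ) / (2 * m) = (g.key.2.2 : ℝ) + θ := by
    rw [(JacobiGroup.alpha_beta_smul g p).1, hθ, JacobiGroup.key]
    push_cast; ring
  refine exp_neg_le_majorant (θ := θ) hN hε h1 h2 ?_ ?_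
  · obtain ⟨hc, hd⟩ := g.abs_le_rowNorm
    calc |θ| ≤ |jacobiAlpha p * g.mat 1 1| + |jacobiBeta p * g.mat 1 0| + |(r : ℝ) / (2 * m)| :=
          (abs_add_le _ _).trans (by gcongr; exact abs_sub _ _)
      _ ≤ |jacobiAlpha p| * g.rowNorm + |jacobiBeta p| * g.rowNorm +
          |(r : ℝ) / (2 * m)| * g.rowNorm := by
          rw [abs_mul, abs_mul]
          gcongr
          exact le_mul_of_one_le_right (abs_nonneg _) hN
      _ = _ := by ring
  · rw [hal]
    have h4 := JacobiGroup.norm_den_le g p.1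
    have h5 : 2 * Real.pi * m * p.1.im / (‖(p.1 : ℂ)‖ + 1) ^ 2 * ((g.key.2.2 : ℝ) + θ) ^ 2 /
        g.rowNorm ^ 2 = 2 * Real.pi * m * ((g.key.2.2 : ℝ) + θ) ^ 2 *
          (p.1.im / ((‖(p.1 : ℂ)‖ + 1) * g.rowNorm) ^ 2) := by
      rw [mul_pow]; field_simp
    rw [h5]
    gcongr

theorem continuous_jacobiAlpha : Continuous jacobiAlpha :=
  (Complex.continuous_im.comp continuous_snd).div (UpperHalfPlane.continuous_im.comp continuous_fst)
    fun p => p.1.im_pos.ne'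

theorem continuous_jacobiBeta : Continuous jacobiBeta :=
  (Complex.continuous_re.comp continuous_snd).sub
    (continuous_jacobiAlpha.mul (UpperHalfPlane.continuous_re.comp continuous_fst))

theorem continuous_jacobiWeight (k m : ℕ) : Continuous (jacobiWeight k m) := by
  have h1 : Continuous fun p : ℍ × ℂ => p.1.im := UpperHalfPlane.continuous_im.comp continuous_fst
  refine (h1.rpow_const fun p => Or.inl p.1.im_pos.ne').mul (Real.continuous_exp.comp
    (continuous_const.mul ((continuous_jacobiAlpha.pow 2).mul h1)))

theorem rowNorm_rpow_mul (g : JacobiGroup) :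
    (g.rowNorm ^ 4)⁻¹ * (g.rowNorm ^ (3 / 2 : ℝ) *
      (1 + (g.key.2.2 : ℝ) ^ 2) ^ (-(3 / 4) : ℝ)) = cosetMajorant g.key := by
  have h0 : 0 < g.rowNorm := by linarith [g.one_le_rowNorm]
  rw [← mul_assoc, cosetMajorant]
  congr 1
  change _ = g.rowNorm ^ (-(5 / 2) : ℝ)
  rw [← Real.rpow_natCast, ← Real.rpow_neg h0.le, ← Real.rpow_add h0]
  norm_num

/-- The terms of a Poincaré series are majorized locally uniformly. -/
theorem exists_continuous_norm_slash_le {k m : ℕ} (hk : 4 ≤ k) (hm : 0 < m) {n r : ℤ}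
    (hD : 0 ≤ jacobiDisc m n r) :
    ∃ Φ : ℍ × ℂ → ℝ, Continuous Φ ∧ ∀ (g : JacobiGroup) (p : ℍ × ℂ),
      ‖jacobiSlash k m (jacobiExp n r) g p‖ ≤ Φ p * cosetMajorant g.key := by
  have hm' : (0 : ℝ) < m := by positivity
  have hpi := Real.pi_pos
  set B : ℍ × ℂ → ℝ := fun p => |jacobiAlpha p| + |jacobiBeta p| + |(r : ℝ) / (2 * m)| with hB
  set A : ℍ × ℂ → ℝ := fun p => 1 + (‖(p.1 : ℂ)‖ + 1) / p.1.im with hA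
  set ε : ℍ × ℂ → ℝ := fun p => min (1 + 2 * B p ^ 2)⁻¹
    (Real.pi * m * p.1.im / (‖(p.1 : ℂ)‖ + 1) ^ 2) with hεd
  have hε : ∀ p, 0 < ε p := fun p => by
    have := p.1.im_pos
    exact lt_min (by positivity) (by positivity)
  have c1 : Continuous fun p : ℍ × ℂ => p.1.im := UpperHalfPlane.continuous_im.comp continuous_fst
  have c2 : Continuous fun p : ℍ × ℂ => ‖(p.1 : ℂ)‖ + 1 :=
    (UpperHalfPlane.continuous_coe.comp continuous_fst).norm.add continuous_const
  have cB : Continuous B :=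
    (continuous_jacobiAlpha.abs.add continuous_jacobiBeta.abs).add continuous_const
  have cA : Continuous A := continuous_const.add (c2.div c1 fun p => p.1.im_pos.ne')
  have cε : Continuous ε := by
    refine Continuous.min ?_ ?_
    · exact (continuous_const.add (continuous_const.mul (cB.pow 2))).inv₀ fun p =>
        (by positivity : 1 + 2 * B p ^ 2 ≠ 0)
    · exact (continuous_const.mul c1).div (c2.pow 2) fun p =>
        (by positivity : (‖(p.1 : ℂ)‖ + 1) ^ 2 ≠ 0)
  refine ⟨fun p => (jacobiWeight k m p)⁻¹ * (p.1.im ^ ((k : ℝ) / 2) * A p ^ k *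
    ε p ^ (-(3 / 4) : ℝ)), ?_, fun g p => ?_⟩
  · refine ((continuous_jacobiWeight k m).inv₀ fun p => (jacobiWeight_pos k m p).ne').mul ?_
    exact ((c1.rpow_const fun p => Or.inl p.1.im_pos.ne').mul (cA.pow k)).mul
      (cε.rpow_const fun p => Or.inl (hε p).ne')
  · have hv := p.1.im_pos
    have hW := jacobiWeight_pos k m p
    have hN := g.one_le_rowNorm
    have hden : 0 < ‖g.den p.1‖ := norm_pos_iff.mpr (JacobiGroup.den_ne_zero g p.1)
    have hA0 : 0 < A p := by positivity
    have h1 : ε p * (1 + 2 * B p ^ 2) ≤ 1 := by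
      refine (mul_le_mul_of_nonneg_right (min_le_left _ _) (by positivity)).trans_eq ?_
      exact inv_mul_cancel₀ (by positivity)
    have h2 : 2 * ε p ≤ 2 * Real.pi * m * p.1.im / (‖(p.1 : ℂ)‖ + 1) ^ 2 := by
      refine (mul_le_mul_of_nonneg_left (min_le_right _ _) (by norm_num)).trans_eq ?_
      ring
    have h3 := jacobiNorm_slash_jacobiExp_le (k := k) hm n r g p (hε p) h1 h2
    have h4 : (‖g.den p.1‖ ^ k)⁻¹ ≤ A p ^ k * (g.rowNorm ^ 4)⁻¹ := by
      have h5 : g.rowNorm ^ k ≤ A p ^ k * ‖g.den p.1‖ ^ k := by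
        rw [← mul_pow]
        exact pow_le_pow_left₀ (by linarith) (JacobiGroup.rowNorm_le g p.1) k
      have h6 : g.rowNorm ^ 4 ≤ g.rowNorm ^ k := pow_le_pow_right₀ hN hk
      have h7 : 0 < g.rowNorm ^ 4 := by positivity
      rw [← div_eq_mul_inv, le_div_iff₀ h7, inv_mul_le_iff₀ (by positivity)]
      linarith
    have h8 : Real.exp (-(Real.pi * jacobiDisc m n r / (2 * m) *
        (p.1.im / ‖g.den p.1‖ ^ 2))) ≤ 1 := by
      apply Real.exp_le_one_iff.mpr
      have : 0 ≤ Real.pi * jacobiDisc m n r / (2 * m) * (p.1.im / ‖g.den p.1‖ ^ 2) := by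
        positivity
      linarith
    rw [mul_assoc, ← div_eq_inv_mul, le_div_iff₀ hW]
    refine h3.trans ?_
    rw [← rowNorm_rpow_mul]
    have hε34 : 0 < ε p ^ (-(3 / 4) : ℝ) := Real.rpow_pos_of_pos (hε p) _
    set R := g.rowNorm ^ (3 / 2 : ℝ) * (1 + (g.key.2.2 : ℝ) ^ 2) ^ (-(3 / 4) : ℝ) with hR
    have hR0 : 0 ≤ R := by positivity
    calc _ ≤ p.1.im ^ ((k : ℝ) / 2) * (A p ^ k * (g.rowNorm ^ 4)⁻¹) * 1 *
          (ε p ^ (-(3 / 4) : ℝ) * R) := by gcongr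
      _ = _ := by ring

/-! ### Poincaré series -/

theorem jacobiExp_trans_smul (n r : ℤ) (a b : ℤ) (p : ℍ × ℂ) :
    jacobiExp n r (JacobiGroup.trans a b • p) = jacobiExp n r p := by
  rw [JacobiGroup.trans_smul, jacobiExp, jacobiExp, Complex.exp_eq_exp_iff_exists_int]
  refine ⟨n * a + r * b, ?_⟩
  simp only [UpperHalfPlane.coe_vadd]
  push_cast
  ring

/-- The slash of a translation invariant function depends only on the coset. -/
theorem jacobiSlash_eq_of_key_eq (k m : ℕ) {G : ℍ × ℂ → ℂ}
    (hG : ∀ (a b : ℤ) p, G (JacobiGroup.trans a b • p) = G p) {g g' : JacobiGroup}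
    (h : g.key = g'.key) : jacobiSlash k m G g = jacobiSlash k m G g' := by
  obtain ⟨a, b, rfl⟩ := JacobiGroup.exists_trans_of_key_eq h
  rw [JacobiGroup.jacobiSlash_mul]
  congr 1
  ext p
  rw [JacobiGroup.jacobiSlash_trans, hG]

/-- The Poincaré series of `q ^ n ζ ^ r`, the sum of its slashes over the cosets of the
translations. -/
def jacobiPoincare (k m : ℕ) (n r : ℤ) (p : ℍ × ℂ) : ℂ :=
  ∑' q : JacobiCoset, jacobiSlash k m (jacobiExp n r) q.rep p

theorem summable_cosetMajorant_rep : Summable fun q : JacobiCoset => cosetMajorant q.rep.key := by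
  simp only [JacobiCoset.key_rep]
  exact summable_cosetMajorant.subtype _

section
variable {k m : ℕ} (hk : 4 ≤ k) (hm : 0 < m) {n r : ℤ} (hD : 0 ≤ jacobiDisc m n r)
include hk hm hD

theorem locallySummable_poincare :
    LocallySummable fun q : JacobiCoset => jacobiSlash k m (jacobiExp n r) q.rep := by
  obtain ⟨Φ, hΦ, h⟩ := exists_continuous_norm_slash_le hk hm hD
  intro p
  refine ⟨{x | Φ x < Φ p + 1}, (isOpen_lt hΦ continuous_const).mem_nhds (lt_add_one (Φ p)),
    fun q => (Φ p + 1) * cosetMajorant q.rep.key, summable_cosetMajorant_rep.mul_left _,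
    fun q x hx => (h q.rep x).trans ?_⟩
  exact mul_le_mul_of_nonneg_right (le_of_lt hx) (cosetMajorant_nonneg _)

theorem hasSum_poincare (p : ℍ × ℂ) :
    HasSum (fun q : JacobiCoset => jacobiSlash k m (jacobiExp n r) q.rep p)
      (jacobiPoincare k m n r p) := by
  obtain ⟨U, hU, u, hu, h⟩ := locallySummable_poincare hk hm hD p
  exact (hu.of_norm_bounded fun q => h q p (mem_of_mem_nhds hU)).hasSum

theorem jacobiSlash_poincare (h : JacobiGroup) :
    jacobiSlash k m (jacobiPoincare k m n r) h = jacobiPoincare k m n r := by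
  ext p
  have h1 := (hasSum_poincare hk hm hD (h • p)).mul_left (h.autoFactor k m p)
  rw [← JacobiGroup.jacobiSlash_apply] at h1
  refine HasSum.unique (((JacobiCoset.mulRight h).hasSum_iff).mp (h1.congr_fun fun q => ?_))
    (hasSum_poincare hk hm hD p)
  rw [Function.comp, jacobiSlash_eq_of_key_eq k m (jacobiExp_trans_smul n r)
    (JacobiCoset.key_rep_mulRight h q), JacobiGroup.jacobiSlash_mul,
    JacobiGroup.jacobiSlash_apply k m _ h]

end

theorem jacobiHolomorphic_slash_jacobiExp (k m : ℕ) (n r : ℤ) (g : JacobiGroup) :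
    JacobiHolomorphic (jacobiSlash k m (jacobiExp n r) g) := by
  have hden : ∀ p ∈ {p : ℂ × ℂ | 0 < p.1.im}, (g.mat 1 0 : ℂ) * p.1 + (g.mat 1 1 : ℂ) ≠ 0 := by
    intro p hp
    have h := g.den_ne_zero (ofComplex p.1)
    rwa [JacobiGroup.den, ofComplex_apply_of_im_pos hp] at h
  have h : DifferentiableOn ℂ (fun p : ℂ × ℂ =>
      ((g.mat 1 0 : ℂ) * p.1 + (g.mat 1 1 : ℂ)) ^ (-(k : ℤ)) *
        Complex.exp (2 * Real.pi * Complex.I * m *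
          (-((g.mat 1 0 : ℂ) * (p.2 + g.lam * p.1 + g.mu) ^ 2 /
              ((g.mat 1 0 : ℂ) * p.1 + (g.mat 1 1 : ℂ)))
            + (g.lam : ℂ) ^ 2 * p.1 + 2 * g.lam * p.2)) *
        Complex.exp (2 * Real.pi * Complex.I *
          (n * (((g.mat 0 0 : ℂ) * p.1 + (g.mat 0 1 : ℂ)) /
              ((g.mat 1 0 : ℂ) * p.1 + (g.mat 1 1 : ℂ))) +
            r * ((p.2 + g.lam * p.1 + g.mu) / ((g.mat 1 0 : ℂ) * p.1 + (g.mat 1 1 : ℂ))))))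
      {p | 0 < p.1.im} := by
    refine ((DifferentiableOn.zpow (by fun_prop) (Or.inl hden)).mul ?_).mul ?_
    · fun_prop (disch := exact hden)
    · fun_prop (disch := exact hden)
  refine h.congr fun p hp => ?_
  simp only [jacobiSlash, jacobiExp, JacobiGroup.smul_fst, JacobiGroup.smul_snd,
    JacobiGroup.coe_mat_smul, JacobiGroup.den]
  rw [ofComplex_apply_of_im_pos hp]

theorem jacobiHolomorphic_poincare {k m : ℕ} (hk : 4 ≤ k) (hm : 0 < m) {n r : ℤ}
    (hD : 0 ≤ jacobiDisc m n r) : JacobiHolomorphic (jacobiPoincare k m n r) :=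
  jacobiHolomorphic_of_hasSum (fun _ => jacobiHolomorphic_slash_jacobiExp k m n r _)
    (locallySummable_poincare hk hm hD) (hasSum_poincare hk hm hD)

theorem hasSum_modifiedHeatOperator_poincare {k m : ℕ} (hk : 4 ≤ k) (hm : 0 < m) {n r : ℤ}
    (hD : 0 ≤ jacobiDisc m n r) (p : ℍ × ℂ) :
    HasSum (fun q : JacobiCoset =>
        jacobiSlash (k + 2) m (modifiedHeatOperator k m (jacobiExp n r)) q.rep p)
      (modifiedHeatOperator k m (jacobiPoincare k m n r) p) := by
  have h := hasSum_modifiedHeatOperator (fun _ => jacobiHolomorphic_slash_jacobiExp k m n r _)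
    (locallySummable_poincare hk hm hD) (hasSum_poincare hk hm hD) k m p
  refine h.congr_fun fun q => ?_
  rw [JacobiGroup.modifiedHeatOperator_slash (jacobiHolomorphic_jacobiExp n r)]

/-- Decay of the Poincaré series towards the cusp, along which the weight is compared with
`v ^ (k / 2)`. The cosets with `c = 0` decay exponentially, the others by a power of `v`. -/
theorem exists_jacobiNorm_poincare_le {k m : ℕ} (hk : 4 < k) (hm : 0 < m) {n r : ℤ}
    (hD : 0 < jacobiDisc m n r) (a : ℝ) :
    ∃ ψ : ℝ → ℝ, Filter.Tendsto ψ Filter.atTop (nhds 0) ∧ ∀ v : ℝ, 1 ≤ v →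
      ∀ s ∈ Set.Ioc (0 : ℝ) 1 ×ˢ Set.Ioc (0 : ℝ) 1,
        jacobiNorm k m (jacobiPoincare k m n r) (jacobiPt v (a * v) s) ≤
          v ^ ((k : ℝ) / 2) * ψ v := by
  have hm' : (0 : ℝ) < m := by positivity
  have hpi := Real.pi_pos
  set B : ℝ := |a| + (1 + |a|) + |(r : ℝ) / (2 * m)| with hB
  set ε₀ : ℝ := min (1 + 2 * B ^ 2)⁻¹ (Real.pi * m / 9) with hε₀
  have hε₀0 : 0 < ε₀ := lt_min (by positivity) (by positivity)
  set b : ℝ := Real.pi * jacobiDisc m n r / (2 * m) with hb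
  have hb0 : 0 < b := by positivity
  set U := ∑' q : JacobiCoset, cosetMajorant q.rep.key with hU
  refine ⟨fun v => (v ^ (3 / 4 : ℝ) * Real.exp (-b * v) + 256 * v ^ (-(1 / 4) : ℝ)) *
    (ε₀ ^ (-(3 / 4) : ℝ) * U), ?_, fun v hv s hs => ?_⟩
  · have h1 := (tendsto_rpow_mul_exp_neg_mul_atTop_nhds_zero (3 / 4) b hb0).add
      ((tendsto_rpow_neg_atTop (y := 1 / 4) (by norm_num)).const_mul 256)
    simpa using h1.mul_const (ε₀ ^ (-(3 / 4) : ℝ) * U)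
  have hv0 : 0 < v := by linarith
  set p := jacobiPt v (a * v) s with hp
  have him : p.1.im = v := jacobiPt_im hv0 _ s
  have hal : jacobiAlpha p = a := by
    rw [hp, jacobiAlpha_jacobiPt hv0, mul_div_cancel_right₀ _ hv0.ne']
  have hcoe : (p.1 : ℂ) = s.1 + v * Complex.I := coe_jacobiPt_fst hv0 _ s
  have hre : p.1.re = s.1 := by rw [← UpperHalfPlane.coe_re, hcoe]; simp
  have hbe : |jacobiBeta p| ≤ 1 + |a| := by
    have hx : p.2.re = s.2 := by simp [hp, jacobiPt]
    rw [jacobiBeta, hal, hre, hx]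
    refine (abs_sub _ _).trans ?_
    rw [abs_mul, abs_of_pos hs.1.1, abs_of_pos hs.2.1]
    exact add_le_add hs.2.2 (mul_le_of_le_one_right (abs_nonneg _) hs.1.2)
  have hT : ‖(p.1 : ℂ)‖ + 1 ≤ 3 * v := by
    have h1 : ‖(p.1 : ℂ)‖ ≤ s.1 + v := by
      rw [hcoe]
      refine (norm_add_le _ _).trans ?_
      rw [norm_mul, Complex.norm_I, mul_one, Complex.norm_real, Complex.norm_real,
        Real.norm_of_nonneg hs.1.1.le, Real.norm_of_nonneg hv0.le]
    linarith [hs.1.2]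
  set ε := ε₀ / v with hε
  have hε0 : 0 < ε := by positivity
  have h1 : ε * (1 + 2 * (|jacobiAlpha p| + |jacobiBeta p| + |(r : ℝ) / (2 * m)|) ^ 2) ≤ 1 := by
    rw [hal]
    calc _ ≤ (1 + 2 * B ^ 2)⁻¹ * (1 + 2 * B ^ 2) := by
          have : ε ≤ (1 + 2 * B ^ 2)⁻¹ := (div_le_self hε₀0.le hv).trans (min_le_left _ _)
          gcongr
          rw [hB]
          gcongr
      _ = 1 := inv_mul_cancel₀ (by positivity)
  have h2 : 2 * ε ≤ 2 * Real.pi * m * p.1.im / (‖(p.1 : ℂ)‖ + 1) ^ 2 := by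
    rw [him]
    calc 2 * ε ≤ 2 * (Real.pi * m / 9 / v) := by
          rw [hε]; gcongr; exact min_le_right _ _
      _ = 2 * Real.pi * m * v / (3 * v) ^ 2 := by field_simp; norm_num
      _ ≤ _ := by gcongr
  have hterm : ∀ q : JacobiCoset, jacobiNorm k m (jacobiSlash k m (jacobiExp n r) q.rep) p ≤
      v ^ ((k : ℝ) / 2) * ((v ^ (3 / 4 : ℝ) * Real.exp (-b * v) + 256 * v ^ (-(1 / 4) : ℝ)) *
        ε₀ ^ (-(3 / 4) : ℝ)) * cosetMajorant q.rep.key := by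
    intro q
    set g := q.rep
    have h3 := jacobiNorm_slash_jacobiExp_le (k := k) hm n r g p hε0 h1 h2
    rw [him, ← hb] at h3
    have hN := g.one_le_rowNorm
    have hden : 0 < ‖g.den p.1‖ := norm_pos_iff.mpr (JacobiGroup.den_ne_zero g p.1)
    -- if `c ≠ 0`, a factor `|c τ + d| ≥ v` is left over because `k > 4`
    have hkey : (‖g.den p.1‖ ^ k)⁻¹ * Real.exp (-(b * (v / ‖g.den p.1‖ ^ 2))) ≤
        (Real.exp (-b * v) + 256 * v⁻¹) * (g.rowNorm ^ 4)⁻¹ := by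
      by_cases hc : g.mat 1 0 = 0
      · have hd : |(g.mat 1 1 : ℝ)| = 1 := by
          have hdet := g.det_eq
          rw [hc, mul_zero, sub_zero] at hdet
          have h4 : |g.mat 1 1| = 1 := Int.isUnit_iff_abs_eq.mp (IsUnit.of_mul_eq_one_right _ hdet)
          exact_mod_cast h4
        have hden1 : ‖g.den p.1‖ = 1 := by
          rw [JacobiGroup.den, hc, Int.cast_zero, zero_mul, zero_add, Complex.norm_intCast, hd]
        have hN1 : g.rowNorm = 1 := by
          rw [JacobiGroup.rowNorm, Prod.norm_def, hc, norm_zero, Int.norm_eq_abs, hd]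
          norm_num
        rw [hden1, hN1]
        simp only [one_pow, inv_one, one_mul, mul_one, div_one, neg_mul]
        have : 0 < v⁻¹ := by positivity
        linarith
      · have hc1 : (1 : ℝ) ≤ |(g.mat 1 0 : ℝ)| := by exact_mod_cast Int.one_le_abs hc
        have hden1 : v ≤ ‖g.den p.1‖ := by
          refine le_trans ?_ (g.abs_mul_im_le_norm_den p.1)
          rw [him]
          exact le_mul_of_one_le_left hv0.le hc1
        have h4 : g.rowNorm ≤ 4 * ‖g.den p.1‖ := by
          refine (g.rowNorm_le p.1).trans ?_
          gcongr
          rw [him]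
          have : (‖(p.1 : ℂ)‖ + 1) / v ≤ 3 := (div_le_iff₀ hv0).mpr hT
          linarith
        have h5 : v * ‖g.den p.1‖ ^ 4 ≤ ‖g.den p.1‖ ^ k := by
          calc v * ‖g.den p.1‖ ^ 4 ≤ ‖g.den p.1‖ * ‖g.den p.1‖ ^ 4 := by gcongr
            _ = ‖g.den p.1‖ ^ 5 := by ring
            _ ≤ _ := pow_le_pow_right₀ (hv.trans hden1) hk
        have h6 : g.rowNorm ^ 4 ≤ 256 * ‖g.den p.1‖ ^ 4 := by
          calc g.rowNorm ^ 4 ≤ (4 * ‖g.den p.1‖) ^ 4 := by gcongr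
            _ = _ := by ring
        have h7 : (‖g.den p.1‖ ^ k)⁻¹ ≤ 256 * v⁻¹ * (g.rowNorm ^ 4)⁻¹ := by
          rw [mul_assoc, ← mul_inv, ← div_eq_mul_inv, inv_eq_one_div,
            div_le_div_iff₀ (by positivity) (by positivity), one_mul]
          calc v * g.rowNorm ^ 4 ≤ v * (256 * ‖g.den p.1‖ ^ 4) := by gcongr
            _ ≤ _ := by linarith
        have h8 : Real.exp (-(b * (v / ‖g.den p.1‖ ^ 2))) ≤ 1 := by
          apply Real.exp_le_one_iff.mpr
          have : 0 ≤ b * (v / ‖g.den p.1‖ ^ 2) := by positivity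
          linarith
        have h9 : 0 < Real.exp (-b * v) * (g.rowNorm ^ 4)⁻¹ := by positivity
        calc _ ≤ (256 * v⁻¹ * (g.rowNorm ^ 4)⁻¹) * 1 := by gcongr
          _ ≤ _ := by linarith
    refine h3.trans ?_
    rw [← rowNorm_rpow_mul]
    set R := g.rowNorm ^ (3 / 2 : ℝ) * (1 + (g.key.2.2 : ℝ) ^ 2) ^ (-(3 / 4) : ℝ) with hR
    have hR0 : 0 ≤ R := by positivity
    have hεe : ε ^ (-(3 / 4) : ℝ) = ε₀ ^ (-(3 / 4) : ℝ) * v ^ (3 / 4 : ℝ) := by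
      rw [hε, Real.div_rpow hε₀0.le hv0.le, Real.rpow_neg hv0.le, div_inv_eq_mul]
    have hv4 : v⁻¹ * v ^ (3 / 4 : ℝ) = v ^ (-(1 / 4) : ℝ) := by
      rw [← Real.rpow_neg_one, ← Real.rpow_add hv0]; norm_num
    rw [hεe]
    calc _ = v ^ ((k : ℝ) / 2) * ((‖g.den p.1‖ ^ k)⁻¹ *
          Real.exp (-(b * (v / ‖g.den p.1‖ ^ 2)))) *
          (ε₀ ^ (-(3 / 4) : ℝ) * v ^ (3 / 4 : ℝ) * R) := by ring
      _ ≤ v ^ ((k : ℝ) / 2) * ((Real.exp (-b * v) + 256 * v⁻¹) * (g.rowNorm ^ 4)⁻¹) *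
          (ε₀ ^ (-(3 / 4) : ℝ) * v ^ (3 / 4 : ℝ) * R) := by gcongr
      _ = _ := by rw [← hv4]; ring
  have hs2 := (hasSum_poincare hk.le hm hD.le p).mul_right ((jacobiWeight k m p : ℝ) : ℂ)
  have hn : jacobiNorm k m (jacobiPoincare k m n r) p =
      ‖jacobiPoincare k m n r p * ((jacobiWeight k m p : ℝ) : ℂ)‖ := by
    rw [norm_mul, Complex.norm_real, Real.norm_of_nonneg (jacobiWeight_pos k m p).le, jacobiNorm]
  rw [hn, ← hs2.tsum_eq]
  refine (tsum_of_norm_bounded (summable_cosetMajorant_rep.hasSum.mul_left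
    (v ^ ((k : ℝ) / 2) * ((v ^ (3 / 4 : ℝ) * Real.exp (-b * v) +
      256 * v ^ (-(1 / 4) : ℝ)) * ε₀ ^ (-(3 / 4) : ℝ)))) fun q => ?_).trans_eq ?_
  · rw [norm_mul, Complex.norm_real, Real.norm_of_nonneg (jacobiWeight_pos k m p).le]
    exact hterm q
  · rw [← hU]; ring

/-- A Poincaré series is a cusp form: a coefficient of nonpositive discriminant is bounded by the
invariant norm at any height, divided by `v ^ (k / 2)`, which tends to zero. -/
theorem isJacobiCuspForm_poincare {k m : ℕ} (hk : 4 < k) (hm : 0 < m) {n r : ℤ}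
    (hD : 0 < jacobiDisc m n r) : IsJacobiCuspForm k m (jacobiPoincare k m n r) := by
  have hhol := jacobiHolomorphic_poincare hk.le hm hD.le (n := n) (r := r)
  have hslash := fun g => jacobiSlash_poincare hk.le hm hD.le (n := n) (r := r) g
  have hper : ∀ (a b : ℤ) p, jacobiPoincare k m n r (JacobiGroup.trans a b • p) =
      jacobiPoincare k m n r p := fun a b p => by
    rw [← JacobiGroup.jacobiSlash_trans k m (jacobiPoincare k m n r), hslash]
  obtain ⟨c, hc⟩ := hhol.exists_fourierExpansion
    (fun τ z => by
      have := hper 1 0 (τ, z)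
      rw [JacobiGroup.trans_smul] at this
      simpa using this)
    (fun τ z => by
      have := hper 0 1 (τ, z)
      rw [JacobiGroup.trans_smul] at this
      simpa using this)
  have hpos : ∀ n' r' : ℤ, c n' r' ≠ 0 → 0 < 4 * n' * m - r' ^ 2 := by
    intro n' r' hne
    by_contra hle
    push Not at hle
    have hle' : jacobiDisc m n' r' ≤ 0 := by
      rw [jacobiDisc]
      exact_mod_cast hle
    obtain ⟨ψ, hψ, h⟩ := exists_jacobiNorm_poincare_le hk hm hD (-(r' / (2 * m)))
    refine hne (norm_le_zero_iff.mp (ge_of_tendsto hψ ?_))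
    filter_upwards [Filter.eventually_ge_atTop 1] with v hv
    have hv0 : 0 < v := by linarith
    have h1 := hc.norm_coeff_le_of_jacobiNorm_le (k := k) hm hv0 n' r' (fun s hs => by
      have := h v hv s hs
      rwa [neg_mul, div_mul_eq_mul_div] at this)
    rw [mul_right_comm (v ^ _), ← Real.rpow_add hv0, add_neg_cancel, Real.rpow_zero, one_mul] at h1
    have hψ0 : 0 ≤ ψ v := nonneg_of_mul_nonneg_left ((norm_nonneg _).trans h1) (Real.exp_pos _)
    refine h1.trans (mul_le_of_le_one_right hψ0 (Real.exp_le_one_iff.mpr ?_))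
    have hm' : (0 : ℝ) < m := by positivity
    refine mul_nonpos_of_nonpos_of_nonneg (div_nonpos_of_nonpos_of_nonneg ?_ (by positivity)) hv0.le
    exact mul_nonpos_of_nonneg_of_nonpos Real.pi_pos.le hle'
  exact ⟨⟨hhol, hslash, c, hc, fun n' r' h => (hpos n' r' h).le⟩, c, hc, hpos⟩

/-! ### Integrals over the heights -/

/-- `v ^ s` times a Gaussian in `y`; with `lam = 4 π` and `s = k` this is
`|q ^ n ζ ^ w| ^ 2 v ^ k exp (-4 π m y ^ 2 / v)` for `D = 4 n m - w ^ 2`, by completing the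
square. -/
def heightKernel (m : ℕ) (w s lam D : ℝ) (x : ℝ × ℝ) : ℝ :=
  x.1 ^ s * Real.exp (-(lam * (m / x.1 * (x.2 + w * x.1 / (2 * m)) ^ 2 + x.1 * D / (4 * m))))

/-- The integral of the height kernel. -/
def heightConst (m : ℕ) (s lam D : ℝ) : ℝ :=
  √(Real.pi / (lam * m)) * ((1 / (lam * D / (4 * m))) ^ (s - 3 / 2) * Real.Gamma (s - 3 / 2))

theorem heightConst_pos {m : ℕ} (hm : 0 < m) {s lam D : ℝ} (hs : 3 / 2 < s) (hl : 0 < lam)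
    (hD : 0 < D) : 0 < heightConst m s lam D := by
  have hm' : (0 : ℝ) < m := by positivity
  have hpi := Real.pi_pos
  have := Real.Gamma_pos_of_pos (show 0 < s - 3 / 2 by linarith)
  unfold heightConst
  positivity

theorem measurable_heightKernel (m : ℕ) (w s lam D : ℝ) :
    Measurable (heightKernel m w s lam D) := by
  unfold heightKernel
  fun_prop

theorem lintegral_gaussian_translate {b : ℝ} (hb : 0 < b) (c : ℝ) :
    ∫⁻ y : ℝ, ENNReal.ofReal (Real.exp (-b * (y + c) ^ 2)) = ENNReal.ofReal √(Real.pi / b) := by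
  rw [← integral_gaussian, ← integral_add_right_eq_self _ c,
    ofReal_integral_eq_lintegral_ofReal ((integrable_exp_neg_mul_sq hb).comp_add_right c)]
  exact Filter.Eventually.of_forall fun y => (Real.exp_pos _).le

theorem integrableOn_rpow_mul_exp_Ioi {s b : ℝ} (hs : -1 < s) (hb : 0 < b) :
    IntegrableOn (fun v : ℝ => v ^ s * Real.exp (-(b * v))) (Set.Ioi 0) := by
  refine (integrableOn_rpow_mul_exp_neg_mul_rpow hs one_pos hb).congr_fun (fun v _ => ?_)
    measurableSet_Ioi
  simp

theorem lintegral_heightKernel {m : ℕ} (hm : 0 < m) (w : ℝ) {s lam D : ℝ} (hs : 3 / 2 < s)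
    (hl : 0 < lam) (hD : 0 < D) :
    ∫⁻ x, ENNReal.ofReal (heightKernel m w s lam D x) ∂jacobiHeightMeasure =
      ENNReal.ofReal (heightConst m s lam D) := by
  have hm' : (0 : ℝ) < m := by positivity
  have hpi := Real.pi_pos
  rw [lintegral_jacobiHeightMeasure (measurable_heightKernel m w s lam D).ennreal_ofReal]
  have h1 : ∀ v ∈ Set.Ioi (0 : ℝ), ∫⁻ y, ENNReal.ofReal (1 / v ^ 3) *
      ENNReal.ofReal (heightKernel m w s lam D (v, y)) =
      ENNReal.ofReal (√(Real.pi / (lam * m)) *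
        (v ^ (s - 3 / 2 - 1) * Real.exp (-(lam * D / (4 * m) * v)))) := by
    intro v hv
    have hv0 : (0 : ℝ) < v := hv
    have h2 : ∀ y, ENNReal.ofReal (1 / v ^ 3) * ENNReal.ofReal (heightKernel m w s lam D (v, y)) =
        ENNReal.ofReal (1 / v ^ 3 * v ^ s * Real.exp (-(lam * D / (4 * m) * v))) *
          ENNReal.ofReal (Real.exp (-(lam * m / v) * (y + w * v / (2 * m)) ^ 2)) := by
      intro y
      rw [← ENNReal.ofReal_mul (by positivity), ← ENNReal.ofReal_mul (by positivity), heightKernel,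
        mul_assoc (1 / v ^ 3 * v ^ s), ← Real.exp_add, mul_assoc]
      congr 4
      field_simp
      ring
    simp only [h2]
    rw [lintegral_const_mul _ (by fun_prop), lintegral_gaussian_translate (by positivity),
      ← ENNReal.ofReal_mul (by positivity)]
    congr 1
    have h3 : √(Real.pi / (lam * m / v)) = √(Real.pi / (lam * m)) * v ^ (1 / 2 : ℝ) := by
      rw [← Real.sqrt_eq_rpow, ← Real.sqrt_mul (by positivity)]
      congr 1
      field_simp
    have h4 : v ^ (s - 3 / 2 - 1) = 1 / v ^ 3 * v ^ s * v ^ (1 / 2 : ℝ) := by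
      rw [one_div, ← Real.rpow_natCast, ← Real.rpow_neg hv0.le, ← Real.rpow_add hv0,
        ← Real.rpow_add hv0]
      congr 1
      push_cast
      ring
    rw [h3, h4]
    ring
  rw [setLIntegral_congr_fun measurableSet_Ioi h1, ← ofReal_integral_eq_lintegral_ofReal,
    integral_const_mul, Real.integral_rpow_mul_exp_neg_mul_Ioi (by linarith) (by positivity)]
  · rfl
  · exact (integrableOn_rpow_mul_exp_Ioi (by linarith) (by positivity)).const_mul _
  · filter_upwards [ae_restrict_mem measurableSet_Ioi] with v hv
    have hv0 : (0 : ℝ) < v := hv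
    positivity

theorem ae_heightKernel_nonneg (m : ℕ) (w s lam D : ℝ) :
    ∀ᵐ x ∂jacobiHeightMeasure, 0 ≤ heightKernel m w s lam D x := by
  filter_upwards [ae_jacobiHeightMeasure_pos] with x hx
  unfold heightKernel
  positivity

theorem integrable_heightKernel {m : ℕ} (hm : 0 < m) (w : ℝ) {s lam D : ℝ} (hs : 3 / 2 < s)
    (hl : 0 < lam) (hD : 0 < D) :
    Integrable (heightKernel m w s lam D) jacobiHeightMeasure := by
  refine ⟨(measurable_heightKernel m w s lam D).aestronglyMeasurable, ?_⟩
  rw [hasFiniteIntegral_iff_ofReal (ae_heightKernel_nonneg m w s lam D),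
    lintegral_heightKernel hm w hs hl hD]
  exact ENNReal.ofReal_lt_top

theorem integral_heightKernel {m : ℕ} (hm : 0 < m) (w : ℝ) {s lam D : ℝ} (hs : 3 / 2 < s)
    (hl : 0 < lam) (hD : 0 < D) :
    ∫ x, heightKernel m w s lam D x ∂jacobiHeightMeasure = heightConst m s lam D := by
  rw [integral_eq_lintegral_of_nonneg_ae (ae_heightKernel_nonneg m w s lam D)
    (measurable_heightKernel m w s lam D).aestronglyMeasurable,
    lintegral_heightKernel hm w hs hl hD, ENNReal.toReal_ofReal (heightConst_pos hm hs hl hD).le]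

/-! ### Divisor sums -/

/-- `σ₁(j)` is at most `j` times a harmonic number. -/
theorem sigma_one_le (j : ℕ) :
    (ArithmeticFunction.sigma 1 j : ℝ) ≤ 5 * (j : ℝ) ^ (5 / 4 : ℝ) := by
  rcases Nat.eq_zero_or_pos j with rfl | hj
  · simp
  have hj' : (1 : ℝ) ≤ j := by exact_mod_cast hj
  have h1 : (ArithmeticFunction.sigma 1 j : ℝ) ≤ j * (harmonic j : ℝ) := by
    rw [ArithmeticFunction.sigma_one_apply, ← Nat.sum_div_divisors j fun d => d]
    rw [harmonic_eq_sum_Icc]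
    push_cast
    rw [Finset.mul_sum]
    refine (Finset.sum_le_sum fun d hd => ?_).trans
      (Finset.sum_le_sum_of_subset_of_nonneg (f := fun d : ℕ => (j : ℝ) * (d : ℝ)⁻¹)
        (fun d hd => ?_) fun d _ _ => by positivity)
    · exact Nat.cast_div_le
    · exact Finset.mem_Icc.mpr ⟨Nat.pos_of_mem_divisors hd, Nat.divisor_le hd⟩
  have h2 : (harmonic j : ℝ) ≤ 5 * (j : ℝ) ^ (1 / 4 : ℝ) := by
    refine (harmonic_le_one_add_log j).trans ?_
    have h3 := Real.log_le_rpow_div (x := j) (by positivity) (ε := 1 / 4) (by norm_num)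
    have h4 : 1 ≤ (j : ℝ) ^ (1 / 4 : ℝ) := Real.one_le_rpow hj' (by norm_num)
    linarith
  calc _ ≤ (j : ℝ) * (5 * (j : ℝ) ^ (1 / 4 : ℝ)) := h1.trans (by gcongr)
    _ = 5 * ((j : ℝ) ^ (1 : ℝ) * (j : ℝ) ^ (1 / 4 : ℝ)) := by rw [Real.rpow_one]; ring
    _ = _ := by rw [← Real.rpow_add (by positivity)]; norm_num

theorem exp_neg_le_rpow {x : ℝ} (hx : 0 < x) : Real.exp (-x) ≤ 25 * x ^ (-(15 / 4) : ℝ) := by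
  rw [Real.exp_neg, Real.rpow_neg hx.le, ← div_eq_mul_inv, inv_eq_one_div,
    div_le_div_iff₀ (Real.exp_pos _) (Real.rpow_pos_of_pos hx _), one_mul]
  have h1 : x ^ (15 / 4 : ℝ) ≤ 1 + x ^ 4 := by
    rcases le_total x 1 with h | h
    · have := Real.rpow_le_one hx.le h (show (0 : ℝ) ≤ 15 / 4 by norm_num)
      have : 0 < x ^ 4 := by positivity
      linarith
    · have := Real.rpow_le_rpow_of_exponent_le h (show (15 / 4 : ℝ) ≤ (4 : ℕ) by norm_num)
      rw [Real.rpow_natCast] at this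
      linarith
  have h2 := Real.pow_div_factorial_le_exp x hx.le 4
  have h3 : (1 : ℝ) ≤ Real.exp x := Real.one_le_exp hx.le
  rw [show ((Nat.factorial 4 : ℕ) : ℝ) = 24 by norm_num [Nat.factorial]] at h2
  linarith

/-- Coefficients of polynomial growth of order `5 / 4`: the mean square of the power series on a
horizontal line. The power `-15 / 8` comes from `exp (-x) ≪ x ^ (-15 / 4)`, where `15 / 4` exceeds
`2 * (5 / 4) + 1`. -/
theorem exists_hasSum_sq_mul_exp_le {b : ℕ → ℂ} {A : ℝ}
    (hb : ∀ j, j ≠ 0 → ‖b j‖ ≤ A * (j : ℝ) ^ (5 / 4 : ℝ)) :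
    ∃ C₀ C₁ : ℝ, 0 < C₀ ∧ 0 ≤ C₁ ∧ ∀ v : ℝ, 0 < v → ∃ S,
      HasSum (fun j : ℕ => ‖b j‖ ^ 2 * Real.exp (-4 * Real.pi * (j * v))) S ∧
        S ≤ (C₀ + C₁ * v ^ (-(15 / 8) : ℝ)) ^ 2 := by
  have hpi := Real.pi_gt_three
  set Z := ∑' j : ℕ, (j : ℝ) ^ (-(5 / 4) : ℝ) with hZ
  have hZs : Summable fun j : ℕ => (j : ℝ) ^ (-(5 / 4) : ℝ) :=
    Real.summable_nat_rpow.mpr (by norm_num)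
  have hZ0 : 0 ≤ Z := tsum_nonneg fun j => by positivity
  refine ⟨‖b 0‖ + 1, √(25 * A ^ 2 * Z), by positivity, by positivity, fun v hv => ?_⟩
  have hg : HasSum (fun j : ℕ => (if j = 0 then ‖b 0‖ ^ 2 else 0) +
      25 * A ^ 2 * v ^ (-(15 / 4) : ℝ) * (j : ℝ) ^ (-(5 / 4) : ℝ))
      (‖b 0‖ ^ 2 + 25 * A ^ 2 * v ^ (-(15 / 4) : ℝ) * Z) :=
    (hasSum_ite_eq 0 _).add (hZs.hasSum.mul_left _)
  have hle : ∀ j : ℕ, ‖b j‖ ^ 2 * Real.exp (-4 * Real.pi * (j * v)) ≤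
      (if j = 0 then ‖b 0‖ ^ 2 else 0) +
        25 * A ^ 2 * v ^ (-(15 / 4) : ℝ) * (j : ℝ) ^ (-(5 / 4) : ℝ) := by
    intro j
    rcases eq_or_ne j 0 with rfl | hj
    · simp
    · have hj0 : (0 : ℝ) < j := by positivity
      rw [if_neg hj, zero_add]
      have h1 : Real.exp (-4 * Real.pi * (j * v)) ≤ Real.exp (-(j * v)) := by
        apply Real.exp_le_exp.mpr
        nlinarith [mul_pos hj0 hv]
      have h2 := h1.trans (exp_neg_le_rpow (mul_pos hj0 hv))
      calc ‖b j‖ ^ 2 * Real.exp (-4 * Real.pi * (j * v))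
          ≤ (A * (j : ℝ) ^ (5 / 4 : ℝ)) ^ 2 * (25 * (j * v) ^ (-(15 / 4) : ℝ)) := by
            gcongr
            exact hb j hj
        _ = _ := by
            rw [Real.mul_rpow hj0.le hv.le, mul_pow, ← Real.rpow_natCast ((j : ℝ) ^ _),
              ← Real.rpow_mul hj0.le]
            have : (j : ℝ) ^ (-(5 / 4) : ℝ) = (j : ℝ) ^ (5 / 4 * ((2 : ℕ) : ℝ)) *
                (j : ℝ) ^ (-(15 / 4) : ℝ) := by
              rw [← Real.rpow_add hj0]; norm_num
            rw [this]
            ring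
  have hs : Summable fun j : ℕ => ‖b j‖ ^ 2 * Real.exp (-4 * Real.pi * (j * v)) :=
    hg.summable.of_nonneg_of_le (fun j => by positivity) hle
  refine ⟨_, hs.hasSum, (hasSum_le hle hs.hasSum hg).trans ?_⟩
  have h3 : (v ^ (-(15 / 8) : ℝ)) ^ 2 = v ^ (-(15 / 4) : ℝ) := by
    rw [← Real.rpow_natCast, ← Real.rpow_mul hv.le]; norm_num
  have h4 : √(25 * A ^ 2 * Z) ^ 2 = 25 * A ^ 2 * Z := Real.sq_sqrt (by positivity)
  have h5 : 0 ≤ v ^ (-(15 / 8) : ℝ) := by positivity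
  have h6 := Real.sqrt_nonneg (25 * A ^ 2 * Z)
  rw [← h3]
  nlinarith [norm_nonneg (b 0), mul_nonneg h6 h5, mul_nonneg (norm_nonneg (b 0)) (mul_nonneg h6 h5)]

/-! ### Pairings over the strip -/

theorem jacobiDisc_add (m : ℕ) (ℓ w : ℤ) (j : ℕ) :
    jacobiDisc m (ℓ + j) w = jacobiDisc m ℓ w + 4 * m * j := by
  rw [jacobiDisc, jacobiDisc]; push_cast; ring

theorem jacobiWeight_jacobiPt (k m : ℕ) {v : ℝ} (hv : 0 < v) (y : ℝ) (s : ℝ × ℝ) :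
    jacobiWeight k m (jacobiPt v y s) =
      v ^ ((k : ℝ) / 2) * Real.exp (-2 * Real.pi * m * ((y / v) ^ 2 * v)) := by
  rw [jacobiWeight, jacobiPt_im hv, jacobiAlpha_jacobiPt hv]

theorem weight_mul_exp_eq_heightKernel {m : ℕ} (hm : 0 < m) (s : ℝ) (n w : ℤ) {v : ℝ} (hv : 0 < v)
    (y : ℝ) :
    v ^ s * Real.exp (-2 * Real.pi * m * ((y / v) ^ 2 * v)) *
      Real.exp (-2 * Real.pi * (n * v + w * y)) =
      heightKernel m w s (2 * Real.pi) (jacobiDisc m n w) (v, y) := by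
  have hm' : (m : ℝ) ≠ 0 := by positivity
  rw [heightKernel, mul_assoc, ← Real.exp_add, jacobiDisc]
  congr 2
  field_simp
  ring

theorem weight_sq_mul_exp_eq_heightKernel (k : ℕ) {m : ℕ} (hm : 0 < m) (n w : ℤ) {v : ℝ}
    (hv : 0 < v) (y : ℝ) (s : ℝ × ℝ) :
    jacobiWeight k m (jacobiPt v y s) ^ 2 * Real.exp (-4 * Real.pi * (n * v + w * y)) =
      heightKernel m w k (4 * Real.pi) (jacobiDisc m n w) (v, y) := by
  have h := weight_mul_exp_eq_heightKernel hm ((k : ℝ) / 2) n w hv y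
  have h1 : Real.exp (-4 * Real.pi * (n * v + w * y)) =
      Real.exp (-2 * Real.pi * (n * v + w * y)) ^ 2 := by
    rw [← Real.exp_nat_mul]; congr 1; push_cast; ring
  rw [jacobiWeight_jacobiPt k m hv, h1, ← mul_pow, h, heightKernel, heightKernel, mul_pow,
    ← Real.rpow_natCast, ← Real.rpow_mul hv.le, ← Real.exp_nat_mul]
  congr 2
  · push_cast; ring
  · push_cast; ring

/-- The coefficients of the series `∑ b j q ^ (ℓ + j) ζ ^ w`. -/
def rowCoeff (ℓ w : ℤ) (b : ℕ → ℂ) (n r : ℤ) : ℂ :=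
  if r = w ∧ ℓ ≤ n then b (n - ℓ).toNat else 0

theorem rowCoeff_add (ℓ w : ℤ) (b : ℕ → ℂ) (j : ℕ) : rowCoeff ℓ w b (ℓ + j) w = b j := by
  simp [rowCoeff]

theorem injective_row (ℓ w : ℤ) : Function.Injective fun j : ℕ => ((ℓ + j, w) : ℤ × ℤ) := by
  intro i j h
  simpa using h

theorem rowCoeff_eq_zero {ℓ w : ℤ} (b : ℕ → ℂ) {x : ℤ × ℤ}
    (hx : x ∉ Set.range fun j : ℕ => ((ℓ + j, w) : ℤ × ℤ)) : rowCoeff ℓ w b x.1 x.2 = 0 := by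
  refine if_neg fun h => hx ⟨(x.1 - ℓ).toNat, Prod.ext ?_ h.1.symm⟩
  have := Int.toNat_of_nonneg (sub_nonneg.mpr h.2)
  simp only [this]
  ring

/-- A series `∑ b j q ^ (ℓ + j) ζ ^ w` is a Fourier expansion. -/
theorem hasJacobiFourierExpansion_rowCoeff {ℓ w : ℤ} {b : ℕ → ℂ} {G : ℍ × ℂ → ℂ}
    (hG : ∀ p, HasSum (fun j : ℕ => b j * jacobiExp (ℓ + j) w p) (G p)) :
    HasJacobiFourierExpansion G (rowCoeff ℓ w b) := by
  rw [hasJacobiFourierExpansion_iff]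
  intro p
  refine ((injective_row ℓ w).hasSum_iff fun x hx => ?_).mp ((hG p).congr_fun fun j => ?_)
  · rw [rowCoeff_eq_zero b hx, zero_mul]
  · rw [Function.comp, rowCoeff_add]

section
variable {ℓ w : ℤ} {b : ℕ → ℂ} {G : ℍ × ℂ → ℂ}
  (hG : ∀ p, HasSum (fun j : ℕ => b j * jacobiExp (ℓ + j) w p) (G p))
include hG

theorem hasSum_integral_mul_conj_row {φ : ℍ × ℂ → ℂ} {c : ℤ → ℤ → ℂ}
    (hφ : HasJacobiFourierExpansion φ c) {v : ℝ} (hv : 0 < v) (y : ℝ) :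
    HasSum (fun j : ℕ => c (ℓ + j) w * conj (b j) *
        (Real.exp (-4 * Real.pi * ((ℓ + j : ℤ) * v + w * y)) : ℂ))
      (∫ s, φ (jacobiPt v y s) * conj (G (jacobiPt v y s)) ∂unitSquare) := by
  have hG' := hasJacobiFourierExpansion_rowCoeff hG
  have h := hasSum_integral_mul_conj (hφ.summable_norm' hv y) (hG'.summable_norm' hv y)
    (hφ.hasSum_jacobiPt hv y) (hG'.hasSum_jacobiPt hv y)
    (hφ.jacobiHolomorphic.continuous.comp (continuous_jacobiPt hv y))
  refine (((injective_row ℓ w).hasSum_iff fun x hx => ?_).mpr h).congr_fun fun j => ?_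
  · rw [rowCoeff_eq_zero b hx, zero_mul, map_zero, mul_zero]
  · have h1 : Real.exp (-4 * Real.pi * ((ℓ + j : ℤ) * v + w * y)) =
        Real.exp (-2 * Real.pi * ((ℓ + j : ℤ) * v + w * y)) *
          Real.exp (-2 * Real.pi * ((ℓ + j : ℤ) * v + w * y)) := by
      rw [← Real.exp_add]; congr 1; ring
    simp only [Function.comp, rowCoeff_add, map_mul, Complex.conj_ofReal]
    rw [h1]
    push_cast
    ring

theorem continuous_row : Continuous G :=
  (hasJacobiFourierExpansion_rowCoeff hG).jacobiHolomorphic.continuous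

/-- The mean on a horizontal torus is bounded by the quadratic mean, which is given by Parseval. -/
theorem integral_norm_row_le {v T S : ℝ} (hv : 0 < v) (y : ℝ) (hT : 0 < T)
    (hS : HasSum (fun j : ℕ => ‖b j‖ ^ 2 * Real.exp (-4 * Real.pi * (j * v))) S)
    (hST : S ≤ T ^ 2) :
    ∫ s, ‖G (jacobiPt v y s)‖ ∂unitSquare ≤ T * Real.exp (-2 * Real.pi * (ℓ * v + w * y)) := by
  have hGc := (continuous_row hG).comp (continuous_jacobiPt hv y)
  set E := Real.exp (-2 * Real.pi * (ℓ * v + w * y)) with hE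
  have hE0 : 0 < E := Real.exp_pos _
  have h1 := hasSum_integral_mul_conj_row hG (hasJacobiFourierExpansion_rowCoeff hG) hv y
  have h2 : ∫ s, ‖G (jacobiPt v y s)‖ ^ 2 ∂unitSquare = E ^ 2 * S := by
    have h3 := hS.mul_left (E ^ 2)
    have h4 := Complex.hasSum_ofReal.mpr h3
    have h5 := h4.unique (h1.congr_fun fun j => ?_)
    · have h6 : ∀ s, G (jacobiPt v y s) * conj (G (jacobiPt v y s)) =
          ((‖G (jacobiPt v y s)‖ ^ 2 : ℝ) : ℂ) := fun s => by
        rw [Complex.mul_conj']; push_cast; rfl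
      simp only [h6] at h5
      rw [integral_complex_ofReal] at h5
      exact (Complex.ofReal_injective h5).symm
    · rw [rowCoeff_add, Complex.mul_conj', hE, ← Real.exp_nat_mul, mul_left_comm, ← Real.exp_add]
      push_cast
      congr 2
      ring
  have h7 : ∀ s, ‖G (jacobiPt v y s)‖ ≤
      (2 * (T * E))⁻¹ * ‖G (jacobiPt v y s)‖ ^ 2 + T * E / 2 := by
    intro s
    have h8 : 0 < T * E := by positivity
    rw [inv_mul_eq_div, div_add' _ _ _ (by positivity), le_div_iff₀ (by positivity)]
    nlinarith [sq_nonneg (‖G (jacobiPt v y s)‖ - T * E)]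
  have i1 : Integrable (fun s => ‖G (jacobiPt v y s)‖ ^ 2) unitSquare :=
    (hGc.norm.pow 2).integrable_unitSquare
  refine (integral_mono hGc.norm.integrable_unitSquare ((i1.const_mul _).add
    (integrable_const _)) h7).trans ?_
  rw [integral_add' (i1.const_mul _) (integrable_const _), integral_const_mul, h2, integral_const]
  simp only [probReal_univ, one_smul]
  have h9 : (2 * (T * E))⁻¹ * (E ^ 2 * S) ≤ (2 * (T * E))⁻¹ * (E ^ 2 * T ^ 2) := by gcongr
  have h10 : (2 * (T * E))⁻¹ * (E ^ 2 * T ^ 2) = T * E / 2 := by field_simp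
  linarith

variable {k m : ℕ} {φ : ℍ × ℂ → ℂ} (hm : 0 < m) (hD : 0 < jacobiDisc m ℓ w)
include hm hD

/-- A cusp form pairs absolutely over the strip with a series in `q` whose quadratic mean at height
`v` grows at most like `v ^ (-a)`. -/
theorem integrableOn_strip_row (hφ : IsJacobiCuspForm k m φ) {a C₀ C₁ : ℝ} (ha : 0 ≤ a)
    (hak : a + 3 / 2 < (k : ℝ) / 2)
    (hC₀ : 0 < C₀) (hC₁ : 0 ≤ C₁)
    (hb : ∀ v : ℝ, 0 < v → ∃ S,
      HasSum (fun j : ℕ => ‖b j‖ ^ 2 * Real.exp (-4 * Real.pi * (j * v))) S ∧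
        S ≤ (C₀ + C₁ * v ^ (-a)) ^ 2) :
    IntegrableOn (jacobiPeterssonIntegrand k m φ G) jacobiStrip jacobiMeasure := by
  obtain ⟨M, hM⟩ := hφ.exists_jacobiNorm_le hm
  have hpi := Real.pi_pos
  have hGc := continuous_row hG
  have hφc := hφ.jacobiHolomorphic.continuous
  have hc := continuous_jacobiPeterssonIntegrand k m hφc hGc
  rw [integrableOn_jacobiStrip_iff]
  have hmeas : AEStronglyMeasurable (fun x : (ℝ × ℝ) × (ℝ × ℝ) =>
      jacobiPeterssonIntegrand k m φ G (jacobiPt x.1.1 x.1.2 x.2))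
      (jacobiHeightMeasure.prod unitSquare) := by
    rw [← measurePreserving_jacobiCoord.aestronglyMeasurable_comp_iff
      measurableEmbedding_jacobiCoord]
    exact hc.aestronglyMeasurable.congr (Filter.Eventually.of_forall fun p =>
      congrArg (jacobiPeterssonIntegrand k m φ G) (eq_jacobiPt p))
  rw [integrable_prod_iff hmeas]
  refine ⟨?_, ?_⟩
  · filter_upwards [ae_jacobiHeightMeasure_pos] with x hx
    exact (hc.comp (continuous_jacobiPt hx x.2)).integrable_unitSquare
  · refine Integrable.mono'
      (((integrable_heightKernel hm w (s := (k : ℝ) / 2) (by linarith)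
        (by positivity : 0 < 2 * Real.pi) hD).const_mul (M * C₀)).add
        ((integrable_heightKernel hm w (s := (k : ℝ) / 2 - a) (by linarith)
        (by positivity : 0 < 2 * Real.pi) hD).const_mul (M * C₁)))
      hmeas.norm.integral_prod_right' ?_
    filter_upwards [ae_jacobiHeightMeasure_pos] with x hx
    obtain ⟨S, hS, hST⟩ := hb x.1 hx
    have hT : 0 < C₀ + C₁ * x.1 ^ (-a) := by positivity
    have h1 := integral_norm_row_le hG hx x.2 hT hS hST
    set W := x.1 ^ ((k : ℝ) / 2) * Real.exp (-2 * Real.pi * m * ((x.2 / x.1) ^ 2 * x.1)) with hW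
    have hW0 : 0 < W := by positivity
    have hM0 : 0 ≤ M := (jacobiNorm_nonneg k m φ (jacobiPt x.1 x.2 (0, 0))).trans (hM _)
    have hGi : Integrable (fun s => ‖G (jacobiPt x.1 x.2 s)‖) unitSquare :=
      (hGc.comp (continuous_jacobiPt hx x.2)).norm.integrable_unitSquare
    rw [Real.norm_of_nonneg (integral_nonneg fun s => norm_nonneg _)]
    calc ∫ s, ‖jacobiPeterssonIntegrand k m φ G (jacobiPt x.1 x.2 s)‖ ∂unitSquare
        ≤ ∫ s, M * W * ‖G (jacobiPt x.1 x.2 s)‖ ∂unitSquare := by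
          refine integral_mono
            (hc.comp (continuous_jacobiPt hx x.2)).norm.integrable_unitSquare
            (hGi.const_mul _) fun s => ?_
          change ‖jacobiPeterssonIntegrand k m φ G (jacobiPt x.1 x.2 s)‖ ≤ _
          rw [norm_jacobiPeterssonIntegrand]
          have h2 : jacobiNorm k m G (jacobiPt x.1 x.2 s) = ‖G (jacobiPt x.1 x.2 s)‖ * W := by
            rw [jacobiNorm, jacobiWeight_jacobiPt k m hx]
          rw [h2]
          calc _ ≤ M * (‖G (jacobiPt x.1 x.2 s)‖ * W) := by
                gcongr
                exact hM _
            _ = _ := by ring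
      _ = M * W * ∫ s, ‖G (jacobiPt x.1 x.2 s)‖ ∂unitSquare := integral_const_mul _ _
      _ ≤ M * W * ((C₀ + C₁ * x.1 ^ (-a)) * Real.exp (-2 * Real.pi * (ℓ * x.1 + w * x.2))) := by
          gcongr
      _ = _ := by
          simp only [Pi.add_apply]
          rw [← weight_mul_exp_eq_heightKernel hm _ ℓ w hx,
            ← weight_mul_exp_eq_heightKernel hm _ ℓ w hx, sub_eq_add_neg, Real.rpow_add hx, hW]
          ring

/-- The scalar product over the strip of a cusp form with a series `∑ b j q ^ (ℓ + j) ζ ^ w`. -/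
theorem hasSum_integral_strip_row (hk : 3 / 2 < (k : ℝ)) {c : ℤ → ℤ → ℂ}
    (hc : HasJacobiFourierExpansion φ c)
    (hint : IntegrableOn (jacobiPeterssonIntegrand k m φ G) jacobiStrip jacobiMeasure)
    (hs : Summable fun j : ℕ => ‖c (ℓ + j) w * conj (b j)‖ *
      heightConst m k (4 * Real.pi) (jacobiDisc m (ℓ + j) w)) :
    HasSum (fun j : ℕ => c (ℓ + j) w * conj (b j) *
        (heightConst m k (4 * Real.pi) (jacobiDisc m (ℓ + j) w) : ℂ))
      (∫ p in jacobiStrip, jacobiPeterssonIntegrand k m φ G p ∂jacobiMeasure) := by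
  have hpi := Real.pi_pos
  have hDj : ∀ j : ℕ, 0 < jacobiDisc m (ℓ + j) w := by
    intro j
    rw [jacobiDisc_add]; positivity
  have hint' := (integrableOn_jacobiStrip_iff _).mp hint
  rw [integral_jacobiStrip, integral_prod _ hint']
  set H : ℕ → ℝ × ℝ → ℂ := fun j x => c (ℓ + j) w * conj (b j) *
    (heightKernel m w k (4 * Real.pi) (jacobiDisc m (ℓ + j) w) x : ℂ) with hH
  have hHi : ∀ j, Integrable (H j) jacobiHeightMeasure := fun j =>
    (integrable_heightKernel hm w hk (by positivity) (hDj j)).ofReal.const_mul _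
  have hn : ∀ j, ∫ x, ‖H j x‖ ∂jacobiHeightMeasure = ‖c (ℓ + j) w * conj (b j)‖ *
      heightConst m k (4 * Real.pi) (jacobiDisc m (ℓ + j) w) := by
    intro j
    rw [← integral_heightKernel hm w hk (by positivity) (hDj j), ← integral_const_mul]
    refine integral_congr_ae ?_
    filter_upwards [ae_heightKernel_nonneg m w k (4 * Real.pi) (jacobiDisc m (ℓ + j) w)] with x hx
    simp only [hH]
    rw [norm_mul, Complex.norm_real, Real.norm_of_nonneg hx]
  have h1 := hasSum_integral_of_summable_integral_norm hHi (hs.congr fun j => (hn j).symm)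
  have h2 : ∀ j, ∫ x, H j x ∂jacobiHeightMeasure = c (ℓ + j) w * conj (b j) *
      (heightConst m k (4 * Real.pi) (jacobiDisc m (ℓ + j) w) : ℂ) := by
    intro j
    refine (integral_const_mul (c (ℓ + j) w * conj (b j)) _).trans ?_
    rw [integral_complex_ofReal, integral_heightKernel hm w hk (by positivity) (hDj j)]
  simp only [h2] at h1
  refine (congrArg (fun t => HasSum _ t) (integral_congr_ae ?_)).mpr h1
  filter_upwards [ae_jacobiHeightMeasure_pos] with x hx
  set W := x.1 ^ ((k : ℝ) / 2) * Real.exp (-2 * Real.pi * m * ((x.2 / x.1) ^ 2 * x.1)) with hW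
  have h3 : ∀ s, jacobiPeterssonIntegrand k m φ G (jacobiPt x.1 x.2 s) =
      ((W ^ 2 : ℝ) : ℂ) * (φ (jacobiPt x.1 x.2 s) * conj (G (jacobiPt x.1 x.2 s))) := by
    intro s
    rw [jacobiPeterssonIntegrand_eq, jacobiWeight_jacobiPt k m hx, mul_comm]
  simp only [h3]
  rw [integral_const_mul]
  have h4 := (hasSum_integral_mul_conj_row hG hc hx x.2).mul_left ((W ^ 2 : ℝ) : ℂ)
  rw [← h4.tsum_eq]
  refine tsum_congr fun j => ?_
  simp only [hH]
  rw [← weight_sq_mul_exp_eq_heightKernel k hm (ℓ + j) w hx x.2 (0, 0),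
    jacobiWeight_jacobiPt k m hx, ← hW]
  push_cast
  ring

end

/-! ### Convergence of the series in the adjoint coefficients -/

/-- Bessel's inequality for a row of Fourier coefficients of a bounded form. -/
theorem sum_sq_coeff_le {k m : ℕ} (hm : 0 < m) {φ : ℍ × ℂ → ℂ} {c : ℤ → ℤ → ℂ}
    (hc : HasJacobiFourierExpansion φ c) {M : ℝ} (hM : ∀ p, jacobiNorm k m φ p ≤ M) (ℓ w : ℤ)
    {X : ℕ} (hX : 0 < X) :
    ∑ j ∈ Finset.Icc 1 X, ‖c (ℓ + j) w‖ ^ 2 ≤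
      Real.exp (Real.pi * (|jacobiDisc m ℓ w| / m + 4)) * M ^ 2 * (X : ℝ) ^ k := by
  have hm' : (0 : ℝ) < m := by positivity
  have hpi := Real.pi_pos
  have hX0 : (0 : ℝ) < X := by exact_mod_cast hX
  set v : ℝ := 1 / X with hv
  have hv0 : 0 < v := by positivity
  -- the height at which the Gaussian factor disappears
  set y : ℝ := -(w * v / (2 * m)) with hy
  set D := jacobiDisc m ℓ w with hD
  have hφc := hc.jacobiHolomorphic.continuous.comp (continuous_jacobiPt hv0 y)
  have h1 := hasSum_integral_mul_conj (hc.summable_norm' hv0 y) (hc.summable_norm' hv0 y)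
    (hc.hasSum_jacobiPt hv0 y) (hc.hasSum_jacobiPt hv0 y) hφc
  set W := jacobiWeight k m (jacobiPt v y (0, 0)) with hW
  have hWs : ∀ s, jacobiWeight k m (jacobiPt v y s) = W := fun s => by
    rw [hW, jacobiWeight_jacobiPt k m hv0, jacobiWeight_jacobiPt k m hv0]
  have h2 : W ^ 2 * ∫ s, ‖φ (jacobiPt v y s)‖ ^ 2 ∂unitSquare ≤ M ^ 2 := by
    rw [← integral_const_mul]
    have h3 : ∀ s, W ^ 2 * ‖φ (jacobiPt v y s)‖ ^ 2 ≤ M ^ 2 := by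
      intro s
      have h4 := hM (jacobiPt v y s)
      rw [jacobiNorm, hWs] at h4
      rw [← mul_pow, mul_comm]
      have : 0 ≤ W := (jacobiWeight_pos _ _ _).le
      gcongr
    refine (integral_mono ((hφc.norm.pow 2).integrable_unitSquare.const_mul _)
      (integrable_const (M ^ 2)) h3).trans ?_
    simp
  have h5 : ∀ s, φ (jacobiPt v y s) * conj (φ (jacobiPt v y s)) =
      ((‖φ (jacobiPt v y s)‖ ^ 2 : ℝ) : ℂ) := fun s => by
    rw [Complex.mul_conj']; push_cast; rfl
  simp only [h5] at h1
  rw [integral_complex_ofReal] at h1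
  have h6 : HasSum (fun i : ℤ × ℤ => ‖c i.1 i.2‖ ^ 2 *
      Real.exp (-4 * Real.pi * (i.1 * v + i.2 * y)))
      (∫ s, ‖φ (jacobiPt v y s)‖ ^ 2 ∂unitSquare) := by
    refine Complex.hasSum_ofReal.mp (h1.congr_fun fun i => ?_)
    rw [Complex.mul_conj', norm_mul, Complex.norm_real, Real.norm_of_nonneg (Real.exp_pos _).le,
      ← Complex.ofReal_pow, mul_pow, ← Real.exp_nat_mul]
    congr 3
    push_cast
    ring
  have h8 : ∑ j ∈ Finset.Icc 1 X, ‖c (ℓ + j) w‖ ^ 2 *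
      Real.exp (-4 * Real.pi * ((ℓ + j : ℤ) * v + w * y)) ≤
      ∫ s, ‖φ (jacobiPt v y s)‖ ^ 2 ∂unitSquare := by
    have h9 := sum_le_hasSum ((Finset.Icc 1 X).map ⟨_, injective_row ℓ w⟩)
      (fun i _ => by positivity) h6
    rw [Finset.sum_map] at h9
    exact h9
  have h10 : ∀ j ∈ Finset.Icc 1 X, Real.exp (-(Real.pi * (|D| / m + 4))) * v ^ k ≤
      W ^ 2 * Real.exp (-4 * Real.pi * ((ℓ + j : ℤ) * v + w * y)) := by
    intro j hj
    have hjX : (j : ℝ) ≤ X := by exact_mod_cast (Finset.mem_Icc.mp hj).2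
    rw [hW, weight_sq_mul_exp_eq_heightKernel k hm (ℓ + j) w hv0 y (0, 0), heightKernel,
      Real.rpow_natCast, mul_comm]
    refine mul_le_mul_of_nonneg_left (Real.exp_le_exp.mpr (neg_le_neg ?_)) (by positivity)
    rw [jacobiDisc_add, ← hD]
    rw [hy]
    have h11 : 4 * Real.pi * (m / v * (-(w * v / (2 * m)) + w * v / (2 * m)) ^ 2 +
        v * (D + 4 * m * j) / (4 * m)) = Real.pi * (D / m * v + 4 * (v * j)) := by
      field_simp; ring
    rw [h11]
    have h12 : v * j ≤ 1 := by
      rw [hv, one_div, inv_mul_le_iff₀ hX0, mul_one]; exact hjX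
    have h13 : v ≤ 1 := by
      rw [hv, div_le_one hX0]; exact_mod_cast hX
    have h14 : D / m * v ≤ |D| / m := by
      calc D / m * v ≤ |D| / m * v := by gcongr; exact le_abs_self D
        _ ≤ _ := mul_le_of_le_one_right (by positivity) h13
    gcongr
    linarith
  have h15 : Real.exp (-(Real.pi * (|D| / m + 4))) * v ^ k *
      ∑ j ∈ Finset.Icc 1 X, ‖c (ℓ + j) w‖ ^ 2 ≤ M ^ 2 := by
    refine le_trans ?_ ((mul_le_mul_of_nonneg_left h8 (sq_nonneg W)).trans h2)
    rw [Finset.mul_sum, Finset.mul_sum]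
    refine Finset.sum_le_sum fun j hj => ?_
    rw [mul_left_comm (W ^ 2), mul_comm]
    exact mul_le_mul_of_nonneg_left (h10 j hj) (by positivity)
  rw [hv, one_div, inv_pow, Real.exp_neg, ← mul_inv, inv_mul_le_iff₀ (by positivity)] at h15
  linarith

/-- The partial sums of `σ₁(j) |c(ℓ + j, w)|` are `O(n ^ (7 / 4 + (k + 2) / 2))` by the
Cauchy–Schwarz inequality, and this exponent is less than `k + 1 / 2` if `k > 9 / 2`. -/
theorem summable_sigma_mul_coeff {k m : ℕ} (hk : 4 < k) (hm : 0 < m) {φ : ℍ × ℂ → ℂ}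
    (hφ : IsJacobiCuspForm (k + 2) m φ) {c : ℤ → ℤ → ℂ} (hc : HasJacobiFourierExpansion φ c)
    {ℓ w : ℤ} (hD : 0 < jacobiDisc m ℓ w) :
    Summable fun j : ℕ => (ArithmeticFunction.sigma 1 j : ℝ) * ‖c (ℓ + j) w‖ *
      jacobiDisc m (ℓ + j) w ^ (-((k : ℝ) + 1 / 2)) := by
  have hm' : (1 : ℝ) ≤ m := by exact_mod_cast hm
  have hk' : (5 : ℝ) ≤ k := by exact_mod_cast hk
  obtain ⟨M, hM⟩ := hφ.exists_jacobiNorm_le hm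
  set f : ℕ → ℝ := fun j => (ArithmeticFunction.sigma 1 j : ℝ) * ‖c (ℓ + j) w‖ with hf
  have hf0 : ∀ j, 0 ≤ f j := fun j => by positivity
  set r : ℝ := 7 / 4 + (k + 2 : ℝ) / 2 with hr
  set C := Real.exp (Real.pi * (|jacobiDisc m ℓ w| / m + 4)) * M ^ 2 with hC
  have hC0 : 0 ≤ C := by positivity
  have hO : (fun n : ℕ => ∑ j ∈ Finset.Icc 1 n, f j) =O[Filter.atTop] fun n : ℕ => (n : ℝ) ^ r := by
    refine Asymptotics.IsBigO.of_bound (5 * √C) ?_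
    filter_upwards [Filter.eventually_gt_atTop 0] with n hn
    have hn0 : (0 : ℝ) < n := by exact_mod_cast hn
    rw [Real.norm_of_nonneg (Finset.sum_nonneg fun j _ => hf0 j), Real.norm_of_nonneg
      (by positivity)]
    refine (pow_le_pow_iff_left₀ (Finset.sum_nonneg fun j _ => hf0 j) (by positivity)
      two_ne_zero).mp ?_
    refine (Finset.sum_mul_sq_le_sq_mul_sq _ _ _).trans ?_
    have h1 : ∑ j ∈ Finset.Icc 1 n, (ArithmeticFunction.sigma 1 j : ℝ) ^ 2 ≤
        25 * (n : ℝ) ^ (7 / 2 : ℝ) := by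
      calc _ ≤ ∑ j ∈ Finset.Icc 1 n, (5 * (n : ℝ) ^ (5 / 4 : ℝ)) ^ 2 := by
            refine Finset.sum_le_sum fun j hj => ?_
            have hjn : (j : ℝ) ≤ n := by exact_mod_cast (Finset.mem_Icc.mp hj).2
            have := sigma_one_le j
            gcongr
            exact this.trans (by gcongr)
        _ = n * (25 * (n : ℝ) ^ (5 / 2 : ℝ)) := by
            rw [Finset.sum_const, Nat.card_Icc, nsmul_eq_mul, mul_pow, ← Real.rpow_natCast
              ((n : ℝ) ^ _), ← Real.rpow_mul hn0.le]
            norm_num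
        _ = 25 * ((n : ℝ) ^ (1 : ℝ) * (n : ℝ) ^ (5 / 2 : ℝ)) := by rw [Real.rpow_one]; ring
        _ = _ := by rw [← Real.rpow_add hn0]; norm_num
    have h2 := sum_sq_coeff_le hm hc hM ℓ w hn
    rw [← hC] at h2
    calc _ ≤ (25 * (n : ℝ) ^ (7 / 2 : ℝ)) * (C * (n : ℝ) ^ (k + 2)) := by gcongr
      _ = (5 * √C * (n : ℝ) ^ r) ^ 2 := by
          rw [mul_pow, mul_pow, Real.sq_sqrt hC0, ← Real.rpow_natCast ((n : ℝ) ^ r),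
            ← Real.rpow_mul hn0.le, ← Real.rpow_natCast (n : ℝ) (k + 2), hr]
          rw [show (7 / 4 + ((k : ℝ) + 2) / 2) * ((2 : ℕ) : ℝ) = 7 / 2 + ((k + 2 : ℕ) : ℝ) by
            push_cast; ring, Real.rpow_add hn0]
          ring
  have hL := LSeriesSummable_of_sum_norm_bigO_and_nonneg (s := (((k : ℝ) + 1 / 2 : ℝ) : ℂ)) hO hf0
    (by positivity) (by rw [Complex.ofReal_re, hr]; linarith)
  refine hL.norm.of_nonneg_of_le (fun j => ?_) fun j => ?_
  · rw [jacobiDisc_add]; positivity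
  · rcases Nat.eq_zero_or_pos j with rfl | hj
    · simp
    · have hj0 : (0 : ℝ) < j := by exact_mod_cast hj
      rw [LSeries.term_of_ne_zero hj.ne', norm_div, Complex.norm_real, Real.norm_of_nonneg (hf0 j),
        Complex.norm_natCast_cpow_of_pos hj, Complex.ofReal_re,
        show f j / (j : ℝ) ^ ((k : ℝ) + 1 / 2) = f j * (j : ℝ) ^ (-((k : ℝ) + 1 / 2)) by
          rw [Real.rpow_neg hj0.le, div_eq_mul_inv]]
      refine mul_le_mul_of_nonneg_left (Real.rpow_le_rpow_of_nonpos hj0 ?_ (by linarith)) (hf0 j)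
      rw [jacobiDisc_add]
      nlinarith

/-! ### Scalar products with the Poincaré series -/

/-- The scalar product of an invariant function with a sum over the cosets of translations. -/
theorem jacobiPetersson_eq_integral_strip {k m : ℕ} {F : Set (ℍ × ℂ)}
    (hF : IsFundamentalDomain JacobiGroup F jacobiMeasure) {φ G P : ℍ × ℂ → ℂ}
    (hφ : ∀ g, jacobiSlash k m φ g = φ) (hG : ∀ (a b : ℤ) p, G (JacobiGroup.trans a b • p) = G p)
    (hint : IntegrableOn (jacobiPeterssonIntegrand k m φ G) jacobiStrip jacobiMeasure)
    (hP : ∀ p, HasSum (fun q : JacobiCoset => jacobiSlash k m G q.rep p) (P p)) :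
    jacobiPetersson k m F φ P =
      ∫ p in jacobiStrip, jacobiPeterssonIntegrand k m φ G p ∂jacobiMeasure := by
  refine integral_fundamentalDomain_eq_strip hF (fun a b p => ?_) hint fun p => ?_
  · rw [← jacobiPeterssonIntegrand_slash, hφ]
    congr 1
    ext p
    rw [JacobiGroup.jacobiSlash_trans, hG]
  · have h := ((hP p).map (starRingEnd ℂ) Complex.continuous_conj).mul_left (φ p)
    refine (h.mul_right ((p.1.im ^ k *
      Real.exp (-4 * Real.pi * m * p.2.im ^ 2 / p.1.im) : ℝ) : ℂ)).congr_fun fun q => ?_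
    rw [← jacobiPeterssonIntegrand_slash, hφ]
    rfl

/-- The scalar product with a Poincaré series is a Fourier coefficient. -/
theorem jacobiPetersson_poincare {k m : ℕ} (hk : 4 < k) (hm : 0 < m) {F : Set (ℍ × ℂ)}
    (hF : IsFundamentalDomain JacobiGroup F jacobiMeasure) {φ : ℍ × ℂ → ℂ} {c : ℤ → ℤ → ℂ}
    (hφ : IsJacobiCuspForm k m φ) (hc : HasJacobiFourierExpansion φ c) {ℓ w : ℤ}
    (hD : 0 < jacobiDisc m ℓ w) :
    jacobiPetersson k m F φ (jacobiPoincare k m ℓ w) =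
      c ℓ w * (heightConst m k (4 * Real.pi) (jacobiDisc m ℓ w) : ℂ) := by
  have hk' : (5 : ℝ) ≤ k := by exact_mod_cast hk
  set b : ℕ → ℂ := fun j => if j = 0 then 1 else 0 with hb
  have hG : ∀ p, HasSum (fun j : ℕ => b j * jacobiExp (ℓ + j) w p) (jacobiExp ℓ w p) := by
    intro p
    convert hasSum_single (f := fun j : ℕ => b j * jacobiExp (ℓ + j) w p) 0 fun j hj => ?_ using 1
    · simp [hb]
    · simp [hb, hj]
  have hint := integrableOn_strip_row hG hm hD hφ (a := 0) (C₀ := 1) (C₁ := 0) le_rfl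
    (by linarith) one_pos le_rfl fun v _ => ⟨1, by
      convert hasSum_single (f := fun j : ℕ => ‖b j‖ ^ 2 * Real.exp (-4 * Real.pi * (j * v))) 0
        fun j hj => ?_ using 1
      · simp [hb]
      · simp [hb, hj], by norm_num⟩
  rw [jacobiPetersson_eq_integral_strip hF hφ.slash_eq (jacobiExp_trans_smul ℓ w) hint
    (hasSum_poincare hk.le hm hD.le)]
  have hz : ∀ j ∉ ({0} : Finset ℕ), b j = 0 := fun j hj => if_neg (by simpa using hj)
  have h := hasSum_integral_strip_row hG hm hD (by linarith) hc hint
    (summable_of_ne_finset_zero (s := {0}) fun j hj => by rw [hz j hj]; simp)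
  refine h.unique ?_
  convert hasSum_single (f := fun j : ℕ => c (ℓ + j) w * conj (b j) *
        (heightConst m k (4 * Real.pi) (jacobiDisc m (ℓ + j) w) : ℂ)) 0 fun j hj => ?_ using 1
  · simp [hb]
  · simp [hb, hj]

/-- The coefficients of the image of `q ^ ℓ ζ ^ w` under the modified heat operator, where
`D = 4 ℓ m - w ^ 2`. -/
def heatCoeff (k m : ℕ) (D : ℝ) (j : ℕ) : ℝ :=
  if j = 0 then D - m * (2 * k - 1) / 6
  else 4 * m * (2 * k - 1) * (ArithmeticFunction.sigma 1 j : ℝ)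

theorem hasSum_modifiedHeatOperator_jacobiExp (k m : ℕ) (ℓ w : ℤ) (p : ℍ × ℂ) :
    HasSum (fun j : ℕ => (heatCoeff k m (jacobiDisc m ℓ w) j : ℂ) * jacobiExp (ℓ + j) w p)
      (modifiedHeatOperator k m (jacobiExp ℓ w) p) := by
  have h1 := heatOperator_const_mul_jacobiExp m 1 ℓ w p
  simp only [one_mul, mul_one] at h1
  rw [modifiedHeatOperator, h1, mul_assoc _ (EisensteinSeries.E2 p.1)]
  have h2 := (hasSum_E2_mul_jacobiExp ℓ w p).mul_left (m * (2 * k - 1) / 6 : ℂ)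
  have h3 := hasSum_ite_eq (0 : ℕ) ((4 * ℓ * m - w ^ 2 : ℂ) * jacobiExp ℓ w p)
  refine (h3.sub h2).congr_fun fun j => ?_
  rcases eq_or_ne j 0 with rfl | hj
  · simp [heatCoeff, e2Coeff, jacobiDisc]
    ring
  · simp [heatCoeff, e2Coeff, hj]
    ring

/-- The quotient of the unfolding constants in weights `k + 2` and `k`. -/
theorem heightConst_add_two {k m : ℕ} (hk : 4 < k) (hm : 0 < m) {ℓ w : ℤ} {D : ℝ}
    (hD₀ : 0 < jacobiDisc m ℓ w) (hD : 0 < D) :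
    heightConst m ((k + 2 : ℕ) : ℝ) (4 * Real.pi) D =
      heightConst m k (4 * Real.pi) (jacobiDisc m ℓ w) * (adjointBeta k m ℓ w *
        (D ^ ((k : ℝ) + 1 / 2))⁻¹) := by
  have hk' : (5 : ℝ) ≤ k := by exact_mod_cast hk
  have hm' : (0 : ℝ) < m := by positivity
  have hpi := Real.pi_pos
  set D₀ := jacobiDisc m ℓ w with hD₀'
  have h1 : Real.Gamma (((k + 2 : ℕ) : ℝ) - 3 / 2) =
      ((k : ℝ) - 1 / 2) * (((k : ℝ) - 3 / 2) * Real.Gamma ((k : ℝ) - 3 / 2)) := by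
    rw [show ((k + 2 : ℕ) : ℝ) - 3 / 2 = (k : ℝ) - 3 / 2 + 1 + 1 by push_cast; ring,
      Real.Gamma_add_one (by linarith), Real.Gamma_add_one (by linarith)]
    ring
  have h2 : ∀ E : ℝ, 0 < E → ∀ t : ℝ, (1 / (4 * Real.pi * E / (4 * m))) ^ t =
      (m / Real.pi) ^ t * (E ^ t)⁻¹ := by
    intro E hE t
    rw [← Real.inv_rpow hE.le, ← Real.mul_rpow (by positivity) (by positivity)]
    congr 1
    field_simp
  have h3 : (m / Real.pi : ℝ) ^ (((k + 2 : ℕ) : ℝ) - 3 / 2) =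
      (m / Real.pi) ^ 2 * (m / Real.pi) ^ ((k : ℝ) - 3 / 2) := by
    rw [← Real.rpow_natCast (m / Real.pi) 2, ← Real.rpow_add (by positivity)]
    congr 1; push_cast; ring
  have h4 : ((k + 2 : ℕ) : ℝ) - 3 / 2 = (k : ℝ) + 1 / 2 := by push_cast; ring
  have h5 : D₀ ^ ((k : ℝ) - 3 / 2) ≠ 0 := (Real.rpow_pos_of_pos hD₀ _).ne'
  rw [heightConst, heightConst, h1, h2 D hD, h2 D₀ hD₀, h3, h4, adjointBeta, ← hD₀']
  field_simp

/-- The scalar product with the image of a Poincaré series under the modified heat operator. -/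
theorem hasSum_jacobiPetersson_modifiedHeatOperator_poincare {k m : ℕ} (hk : 4 < k) (hm : 0 < m)
    {F : Set (ℍ × ℂ)} (hF : IsFundamentalDomain JacobiGroup F jacobiMeasure) {φ : ℍ × ℂ → ℂ}
    {c : ℤ → ℤ → ℂ} (hφ : IsJacobiCuspForm (k + 2) m φ) (hc : HasJacobiFourierExpansion φ c)
    {ℓ w : ℤ} (hD : 0 < jacobiDisc m ℓ w) :
    HasSum (fun j : ℕ => c (ℓ + j) w * (heatCoeff k m (jacobiDisc m ℓ w) j : ℂ) *
        (heightConst m ((k + 2 : ℕ) : ℝ) (4 * Real.pi) (jacobiDisc m (ℓ + j) w) : ℂ))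
      (jacobiPetersson (k + 2) m F φ (modifiedHeatOperator k m (jacobiPoincare k m ℓ w))) := by
  have hk' : (5 : ℝ) ≤ k := by exact_mod_cast hk
  have hm' : (0 : ℝ) < m := by positivity
  have hkm : (0 : ℝ) ≤ 4 * m * (2 * k - 1) := mul_nonneg (by positivity) (by linarith)
  have hkc : ((k + 2 : ℕ) : ℝ) = k + 2 := by push_cast; ring
  have hDj : ∀ j : ℕ, 0 < jacobiDisc m (ℓ + j) w := fun j => by
    rw [jacobiDisc_add]; positivity
  set D := jacobiDisc m ℓ w with hDdef
  set b : ℕ → ℂ := fun j => (heatCoeff k m D j : ℂ) with hb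
  have hG : ∀ p, HasSum (fun j : ℕ => b j * jacobiExp (ℓ + j) w p)
      (modifiedHeatOperator k m (jacobiExp ℓ w) p) :=
    hasSum_modifiedHeatOperator_jacobiExp k m ℓ w
  have hbn : ∀ j, j ≠ 0 → ‖b j‖ = 4 * m * (2 * k - 1) * (ArithmeticFunction.sigma 1 j : ℝ) := by
    intro j hj
    rw [hb, Complex.norm_real, heatCoeff, if_neg hj, Real.norm_of_nonneg (by positivity)]
  obtain ⟨C₀, C₁, hC₀, hC₁, hS⟩ := exists_hasSum_sq_mul_exp_le (b := b)
    (A := 4 * m * (2 * k - 1) * 5) fun j hj => by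
      rw [hbn j hj, mul_assoc _ 5]
      exact mul_le_mul_of_nonneg_left (sigma_one_le j) hkm
  -- `15 / 8 + 3 / 2 < (k + 2) / 2` as `k ≥ 5`
  have hint := integrableOn_strip_row hG hm hD hφ (by norm_num) (by rw [hkc]; linarith) hC₀ hC₁ hS
  have hper : ∀ (a a' : ℤ) p, modifiedHeatOperator k m (jacobiExp ℓ w)
      (JacobiGroup.trans a a' • p) = modifiedHeatOperator k m (jacobiExp ℓ w) p := by
    intro a a' p
    have h := JacobiGroup.modifiedHeatOperator_slash (jacobiHolomorphic_jacobiExp ℓ w) k m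
      (JacobiGroup.trans a a')
    have h1 : jacobiSlash k m (jacobiExp ℓ w) (JacobiGroup.trans a a') = jacobiExp ℓ w := by
      ext p
      rw [JacobiGroup.jacobiSlash_trans, jacobiExp_trans_smul]
    rw [h1] at h
    rw [← JacobiGroup.jacobiSlash_trans (k + 2) m (modifiedHeatOperator k m (jacobiExp ℓ w)) a a' p,
      ← h]
  rw [jacobiPetersson_eq_integral_strip hF hφ.slash_eq hper hint
    (hasSum_modifiedHeatOperator_poincare hk.le hm hD.le)]
  -- the term at `j = 0` differs from `σ₁(0) = 0`, but one term does not affect convergence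
  have hs : Summable fun j : ℕ => ‖c (ℓ + j) w * conj (b j)‖ *
      heightConst m ((k + 2 : ℕ) : ℝ) (4 * Real.pi) (jacobiDisc m (ℓ + j) w) := by
    have h := (summable_sigma_mul_coeff hk hm hφ hc hD).mul_left
      (4 * m * (2 * k - 1) * (heightConst m k (4 * Real.pi) D * adjointBeta k m ℓ w))
    refine h.congr_cofinite ?_
    filter_upwards [(Set.finite_singleton (0 : ℕ)).compl_mem_cofinite] with j hj
    rw [norm_mul, RCLike.norm_conj, hbn j hj, heightConst_add_two hk hm hD (hDj j),
      Real.rpow_neg (hDj j).le]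
    ring
  refine (hasSum_integral_strip_row hG hm hD (by rw [hkc]; linarith) hc hint hs).congr_fun
    fun j => ?_
  rw [hb, Complex.conj_ofReal]

theorem disc_pos_iff (m : ℕ) (ℓ w : ℤ) : 0 < 4 * ℓ * m - w ^ 2 ↔ 0 < jacobiDisc m ℓ w := by
  rw [jacobiDisc]
  exact_mod_cast Iff.rfl

theorem summable_adjointSeriesTerm {k m : ℕ} (hk : 4 < k) (hm : 0 < m) {φ : ℍ × ℂ → ℂ}
    {c : ℤ → ℤ → ℂ} (hφ : IsJacobiCuspForm (k + 2) m φ) (hc : HasJacobiFourierExpansion φ c)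
    {ℓ w : ℤ} (hD : 0 < jacobiDisc m ℓ w) : Summable (adjointSeriesTerm k m c ℓ w) := by
  have h := (summable_sigma_mul_coeff hk hm hφ hc hD).comp_injective PNat.coe_injective
  refine Summable.of_norm (h.congr fun p => ?_)
  have hDp : 0 < jacobiDisc m (ℓ + (p : ℕ)) w := by
    rw [jacobiDisc_add]; positivity
  rw [Function.comp, adjointSeriesTerm, norm_div, norm_mul, Complex.norm_natCast,
    Complex.norm_real, Real.norm_of_nonneg (by positivity), Real.rpow_neg hDp.le,
    ← div_eq_mul_inv]

/-- The Fourier coefficients of the adjoint, by pairing with a Poincaré series. -/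
theorem coeff_of_isPeterssonAdjoint {k m : ℕ} (hk : 4 < k) (hm : 0 < m) {F : Set (ℍ × ℂ)}
    (hF : IsFundamentalDomain JacobiGroup F jacobiMeasure) {φ ψ : ℍ × ℂ → ℂ} {c c' : ℤ → ℤ → ℂ}
    (hφ : IsJacobiCuspForm (k + 2) m φ) (hc : HasJacobiFourierExpansion φ c)
    (hψ : IsJacobiCuspForm k m ψ) (hc' : HasJacobiFourierExpansion ψ c') {ℓ w : ℤ}
    (hD : 0 < jacobiDisc m ℓ w)
    (h : jacobiPetersson k m F ψ (jacobiPoincare k m ℓ w) =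
      jacobiPetersson (k + 2) m F φ (modifiedHeatOperator k m (jacobiPoincare k m ℓ w))) :
    c' ℓ w = adjointCoeff k m c ℓ w := by
  have hk' : (5 : ℝ) ≤ k := by exact_mod_cast hk
  have hDj : ∀ j : ℕ, 0 < jacobiDisc m (ℓ + j) w := fun j => by
    rw [jacobiDisc_add]; positivity
  have hκ := heightConst_pos hm (s := k) (lam := 4 * Real.pi) (by linarith) (by positivity) hD
  set κ := heightConst m k (4 * Real.pi) (jacobiDisc m ℓ w) with hκd
  have h1 := hasSum_jacobiPetersson_modifiedHeatOperator_poincare hk hm hF hφ hc hD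
  rw [← h, jacobiPetersson_poincare hk hm hF hψ hc' hD, ← hκd] at h1
  have h2 := h1.tsum_eq
  rw [← tsum_zero_pnat_eq_tsum_nat h1.summable] at h2
  have h3 : ∀ p : ℕ+, c (ℓ + ((p : ℕ) : ℤ)) w * (heatCoeff k m (jacobiDisc m ℓ w) p : ℂ) *
      (heightConst m ((k + 2 : ℕ) : ℝ) (4 * Real.pi) (jacobiDisc m (ℓ + ((p : ℕ) : ℤ)) w) : ℂ) =
      (κ : ℂ) * (adjointBeta k m ℓ w : ℂ) * (4 * m * (2 * k - 1)) *
        adjointSeriesTerm k m c ℓ w p := by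
    intro p
    rw [heightConst_add_two hk hm hD (hDj p), ← hκd, heatCoeff, if_neg p.ne_zero,
      adjointSeriesTerm]
    push_cast
    ring
  simp only [h3] at h2
  rw [tsum_mul_left, heightConst_add_two hk hm hD (hDj 0), ← hκd, heatCoeff, if_pos rfl] at h2
  simp only [Nat.cast_zero, add_zero] at h2
  refine mul_right_cancel₀ (Complex.ofReal_ne_zero.mpr hκ.ne') (h2.symm.trans ?_)
  rw [adjointCoeff]
  push_cast
  ring

/-! ### The adjoint of the modified heat operator -/

theorem jacobiDz_add {φ ψ : ℍ × ℂ → ℂ} (hφ : ∀ τ, Differentiable ℂ fun w => φ (τ, w))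
    (hψ : ∀ τ, Differentiable ℂ fun w => ψ (τ, w)) :
    jacobiDz (φ + ψ) = jacobiDz φ + jacobiDz ψ := by
  ext p
  simp only [jacobiDz, Pi.add_apply]
  rw [deriv_fun_add (hφ p.1 p.2) (hψ p.1 p.2), mul_add]

theorem modifiedHeatOperator_add {φ ψ : ℍ × ℂ → ℂ} (hφ : JacobiHolomorphic φ)
    (hψ : JacobiHolomorphic ψ) (k m : ℕ) :
    modifiedHeatOperator k m (φ + ψ) =
      modifiedHeatOperator k m φ + modifiedHeatOperator k m ψ := by
  ext p
  have h1 : jacobiDz (φ + ψ) = jacobiDz φ + jacobiDz ψ :=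
    jacobiDz_add hφ.differentiable_snd hψ.differentiable_snd
  have h2 : jacobiDz (jacobiDz φ + jacobiDz ψ) = jacobiDz (jacobiDz φ) + jacobiDz (jacobiDz ψ) :=
    jacobiDz_add (fun τ w => (hφ.hasDerivAt_snd_snd τ w).differentiableAt)
      fun τ w => (hψ.hasDerivAt_snd_snd τ w).differentiableAt
  have h3 : jacobiDτ (φ + ψ) p = jacobiDτ φ p + jacobiDτ ψ p := by
    simp only [jacobiDτ, Pi.add_apply]
    have d1 : DifferentiableAt ℂ (fun t => φ (ofComplex t, p.2)) (p.1 : ℂ) :=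
      (hφ.hasDerivAt_comp (hasDerivAt_id' (p.1 : ℂ)) (hasDerivAt_const (p.1 : ℂ) p.2) rfl
        rfl).differentiableAt
    have d2 : DifferentiableAt ℂ (fun t => ψ (ofComplex t, p.2)) (p.1 : ℂ) :=
      (hψ.hasDerivAt_comp (hasDerivAt_id' (p.1 : ℂ)) (hasDerivAt_const (p.1 : ℂ) p.2) rfl
        rfl).differentiableAt
    rw [deriv_fun_add d1 d2, mul_add]
  simp only [modifiedHeatOperator, heatOperator, h1, h2, h3, Pi.add_apply]
  ring

theorem modifiedHeatOperator_smul (a : ℂ) (φ : ℍ × ℂ → ℂ) (k m : ℕ) :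
    modifiedHeatOperator k m (a • φ) = a • modifiedHeatOperator k m φ := by
  have h1 : ∀ ψ : ℍ × ℂ → ℂ, jacobiDz (a • ψ) = a • jacobiDz ψ := by
    intro ψ
    ext p
    simp only [jacobiDz, Pi.smul_apply, smul_eq_mul, deriv_const_mul_field]
    ring
  ext p
  simp only [modifiedHeatOperator, heatOperator, h1, Pi.smul_apply, smul_eq_mul, jacobiDτ,
    deriv_const_mul_field]
  ring

/-- The modified heat operator on cusp forms. -/
def modifiedHeatOperatorLinear (k m : ℕ) :
    JacobiCuspForms k m →ₗ[ℂ] JacobiCuspForms (k + 2) m where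
  toFun f := ⟨modifiedHeatOperator k m f,
    (JacobiCuspForms.isJacobiCuspForm f).modifiedHeatOperator⟩
  map_add' f g := Subtype.ext (modifiedHeatOperator_add
      (JacobiCuspForms.isJacobiCuspForm f).jacobiHolomorphic
      (JacobiCuspForms.isJacobiCuspForm g).jacobiHolomorphic k m)
  map_smul' a f := Subtype.ext (modifiedHeatOperator_smul a f k m)

theorem mainTheorem2 (k m : ℕ) (hk : 4 < k) (hm : 0 < m)
    (F : Set (ℍ × ℂ)) (hF : IsFundamentalDomain JacobiGroup F jacobiMeasure) :
    -- the scalar products on both spaces converge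
    (∀ f g : JacobiCuspForms k m,
      IntegrableOn (jacobiPeterssonIntegrand k m f g) F jacobiMeasure) ∧
    (∀ f g : JacobiCuspForms (k + 2) m,
      IntegrableOn (jacobiPeterssonIntegrand (k + 2) m f g) F jacobiMeasure) ∧
    -- `L` is the modified heat operator on cusp forms and `T` its unique adjoint
    ∃ (L : JacobiCuspForms k m →ₗ[ℂ] JacobiCuspForms (k + 2) m)
      (T : JacobiCuspForms (k + 2) m →ₗ[ℂ] JacobiCuspForms k m),
      (∀ f : JacobiCuspForms k m,
        (L f : ℍ × ℂ → ℂ) = modifiedHeatOperator k m (f : ℍ × ℂ → ℂ)) ∧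
      IsPeterssonAdjoint k m F L T ∧
      (∀ T' : JacobiCuspForms (k + 2) m →ₗ[ℂ] JacobiCuspForms k m,
        IsPeterssonAdjoint k m F L T' → T' = T) ∧
      -- the Fourier expansion of `T φ`
      ∀ (φ : JacobiCuspForms (k + 2) m) (c : ℤ → ℤ → ℂ),
        HasJacobiFourierExpansion (φ : ℍ × ℂ → ℂ) c →
        (∀ n r : ℤ, c n r ≠ 0 → 0 < 4 * n * m - r ^ 2) →
        (∀ ℓ w : ℤ, 0 < 4 * ℓ * m - w ^ 2 → Summable (adjointSeriesTerm k m c ℓ w)) ∧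
        HasJacobiFourierExpansion (T φ : ℍ × ℂ → ℂ)
          (fun ℓ w => if 0 < 4 * ℓ * m - w ^ 2 then adjointCoeff k m c ℓ w else 0) := by
  have _ := JacobiCuspForms.finiteDimensional k hm
  have _ := JacobiCuspForms.finiteDimensional (k + 2) hm
  obtain ⟨T, hT⟩ := exists_adjoint_of_core (jacobiCore k hm hF) (jacobiCore (k + 2) hm hF)
    (modifiedHeatOperatorLinear k m)
  have hadj : IsPeterssonAdjoint k m F (modifiedHeatOperatorLinear k m) T := hT
  refine ⟨fun f g => (JacobiCuspForms.isJacobiCuspForm f).integrableOn_petersson hm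
      (JacobiCuspForms.isJacobiCuspForm g) hF,
    fun f g => (JacobiCuspForms.isJacobiCuspForm f).integrableOn_petersson hm
      (JacobiCuspForms.isJacobiCuspForm g) hF, modifiedHeatOperatorLinear k m, T,
    fun _ => rfl, hadj, fun T' hT' => isPeterssonAdjoint_unique hm hF hadj hT',
    fun φ c hc _ => ⟨fun ℓ w h => ?_, ?_⟩⟩
  · exact summable_adjointSeriesTerm hk hm (JacobiCuspForms.isJacobiCuspForm φ) hc
      ((disc_pos_iff m ℓ w).mp h)
  · convert JacobiCuspForms.hasJacobiFourierExpansion (T φ) using 3 with ℓ w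
    split_ifs with h
    · have hD := (disc_pos_iff m ℓ w).mp h
      exact (coeff_of_isPeterssonAdjoint hk hm hF (JacobiCuspForms.isJacobiCuspForm φ) hc
        (JacobiCuspForms.isJacobiCuspForm (T φ))
        (JacobiCuspForms.hasJacobiFourierExpansion (T φ)) hD
        (hadj φ ⟨_, isJacobiCuspForm_poincare hk hm hD⟩)).symm
    · by_contra hne
      exact h (JacobiCuspForms.disc_pos_of_coeff_ne_zero (T φ) ℓ w (Ne.symm hne))

end
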